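/- Let $X$ be a $\mathrm{CAT}(-1)$-space, that is, a complete geodesic metric space whose geodesic triangles are thinner than their comparison triangles in the hyperbolic plane $\mathbb{H}^2$, and let $\partial_\infty X$ be its boundary at infinity: the set of equivalence classes of sequences $(x_i)$ in $X$ with $(x_i|x_j)_o\to\infty$, where $(x|x')_o=\frac12(|ox|+|ox'|-|xx'|)$ and $(x_i)\sim(x_i')$ if $(x_i|x_i')_o\to\infty$ (this does not depend on $o\in X$). Let $Y$ and $|\cdot\,\cdot|$ be one of the following. (a) $Y=\partial_\infty X$ with the Bourdon metric $|yy'|=\sin\left(\tfrac12\theta_o(y,y')\right)$ of a base point $o\in X$. Here $\theta_o(y,y')$ is the limit as $t\to\infty$ of the angle at $\bar o$ of the comparison triangle in $\mathbb{H}^2$ of $o,y(t),y'(t)$, where $y(t)$ and $y'(t)$ are the points at distance $t$ from $o$ on the geodesic rays from $o$ to $y$ and to $y'$. (b) $Y=\partial_\infty X\setminus\{\omega\}$ for some $\omega\in\partial_\infty X$, with the Hamenstädt metric $|yy'|=e^{-(y|y')_b}$ of a Busemann function $b$ for $\omega$ (a function $b(x)=\lim_{t\to\infty}(|x\,c(t)|-t)+k$,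 where $c$ is a geodesic ray to $\omega$ and $k\in\mathbb{R}$). Here $(x|x')_b=\frac12(b(x)+b(x')-|xx'|)$ for $x,x'\in X$, and $(y|y')_b=\inf\liminf_{i\to\infty}(x_i|x_i')_b$ for $y,y'\in Y$, the infimum being over all sequences $(x_i)\in y$, $(x_i')\in y'$. Then all $y_1,y_2,y_3,y_4\in Y$ satisfy the Ptolemy inequality $$|y_1y_3|\,|y_2y_4|\le|y_1y_2|\,|y_3y_4|+|y_2y_3|\,|y_4y_1|.$$ If $y_1,y_2,y_3,y_4$ are pairwise distinct, then equality holds if and only if the convex hull of the four points (the smallest convex subset of $X$ that contains the geodesic lines joining any two of them) is isometric to an ideal quadrilateral in $\mathbb{H}^2$ (the convex hull of four distinct points of $\partial_\infty\mathbb{H}^2$) by an isometry that takes the geodesics $y_1y_3$ and $y_2y_4$ to the two diagonals, that is, to the two geodesics that join opposite vertices and cross each other. -/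

import Mathlib

open Filter Topology

namespace BoundaryPtolemy

noncomputable section

/-! ### CAT(-1) spaces -/

/-- `x` lies on a geodesic segment from `a` to `b`. In a geodesic metric space this is the same as
equality in the triangle inequality, because geodesics `a x` and `x b` can be concatenated. -/
def Between {X : Type*} [MetricSpace X] (a x b : X) : Prop :=
  dist a x + dist x b = dist a b

/-- Every two points are joined by a geodesic segment. -/
def IsGeodesicSpace (X : Type*) [MetricSpace X] : Prop :=
  ∀ x y : X, ∃ c : ℝ → X, c 0 = x ∧ c (dist x y) = y ∧
    ∀ s ∈ Set.Icc 0 (dist x y), ∀ t ∈ Set.Icc 0 (dist x y), dist (c s) (c t) = |s - t|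

/-- A CAT(-1) space: a complete geodesic metric space whose geodesic triangles are thinner than
their comparison triangles in the hyperbolic plane. Here `p q r` is a triangle in `X`, `x` and `y`
are points on the sides `p q` and `p r`, the triangle `p' q' r'` is a comparison triangle, and
`x'`, `y'` are the comparison points. (Two points on different sides are always of this form
after renaming the vertices, and for two points on the same side there is nothing to require.) -/
structure IsCATNegOne (X : Type*) [MetricSpace X] : Prop where
  complete : CompleteSpace X
  geodesic : IsGeodesicSpace X
  thin : ∀ (p q r x y : X) (p' q' r' x' y' : UpperHalfPlane),
    Between p x q → Between p y r →
    dist p' q' = dist p q → dist q' r' = dist q r → dist p' r' = dist p r →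
    dist p' x' = dist p x → dist x' q' = dist x q →
    dist p' y' = dist p y → dist y' r' = dist y r →
    dist x y ≤ dist x' y'

/-! ### The boundary at infinity -/

section Boundary

variable {X : Type*} [MetricSpace X]

/-- The Gromov product `(x | x')_o`. -/
def gromovProduct (o x x' : X) : ℝ := (dist o x + dist o x' - dist x x') / 2

/-- The sequence `u` converges to infinity: `(u i | u j)_o → ∞` as `i, j → ∞`. Changing `o` changes
the product by a bounded amount, so the condition for one `o` and for all `o` is the same. -/
def ConvergesToInfinity (u : ℕ → X) : Prop :=
  ∀ o : X, Tendsto (fun p : ℕ × ℕ => gromovProduct o (u p.1) (u p.2)) (atTop ×ˢ atTop) atTop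

/-- Equivalence of sequences converging to infinity: `(u i | v i)_o → ∞`. -/
def SeqEquiv (u v : ℕ → X) : Prop :=
  ∀ o : X, Tendsto (fun i : ℕ => gromovProduct o (u i) (v i)) atTop atTop

variable (X) in
/-- The boundary at infinity: the set of equivalence classes of sequences converging to
infinity. -/
def Boundary : Type _ :=
  {S : Set (ℕ → X) // ∃ u, ConvergesToInfinity u ∧ S = {v | ConvergesToInfinity v ∧ SeqEquiv u v}}

/-- The sequence `u` represents the boundary point `y`. -/
def Represents (u : ℕ → X) (y : Boundary X) : Prop := u ∈ y.1

/-- `c`, restricted to `[0, ∞)`, is a geodesic ray from `o` to the boundary point `y`. -/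
def IsRayTo (o : X) (y : Boundary X) (c : ℝ → X) : Prop :=
  c 0 = o ∧ (∀ s t : ℝ, 0 ≤ s → 0 ≤ t → dist (c s) (c t) = |s - t|) ∧
    Represents (fun n : ℕ => c n) y

/-- `c` is a geodesic line with end points `y` (at `-∞`) and `y'` (at `+∞`). -/
def IsLineJoining (y y' : Boundary X) (c : ℝ → X) : Prop :=
  (∀ s t : ℝ, dist (c s) (c t) = |s - t|) ∧
    Represents (fun n : ℕ => c (-n)) y ∧ Represents (fun n : ℕ => c n) y'

/-- The geodesic line `y y'` as a subset of `X` (in a CAT(-1) space there is exactly one such line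
if `y ≠ y'`, and none if `y = y'`). -/
def line (y y' : Boundary X) : Set X :=
  {x | ∃ c : ℝ → X, IsLineJoining y y' c ∧ x ∈ Set.range c}

/-! ### The Bourdon metric -/

/-- The angle between the sides of length `a` and `b` in a triangle of the hyperbolic plane with
side lengths `a, b, c`, by the hyperbolic law of cosines. -/
def comparisonAngle (a b c : ℝ) : ℝ :=
  Real.arccos ((Real.cosh a * Real.cosh b - Real.cosh c) / (Real.sinh a * Real.sinh b))

/-- The geodesic ray from `o` to the boundary point `y` (in a CAT(-1) space it exists and is unique
on `[0, ∞)`). -/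
def ray (o : X) (y : Boundary X) : ℝ → X :=
  @Classical.epsilon (ℝ → X) ⟨fun _ => o⟩ (IsRayTo o y)

/-- The asymptotic comparison angle `θ_o(y, y')`: the limit as `t → ∞` of the comparison angles at
`o` of the triangles `o, y(t), y'(t)`, where `y(t)`, `y'(t)` are the points at distance `t` from `o`
on the rays `o y`, `o y'`. (In a CAT(-1) space the comparison angle is monotone in `t`, so that the
limit exists.) -/
def asymptoticAngle (o : X) (y y' : Boundary X) : ℝ :=
  limUnder atTop (fun t : ℝ => comparisonAngle t t (dist (ray o y t) (ray o y' t)))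

/-- The Bourdon metric with base point `o`. -/
def bourdon (o : X) (y y' : Boundary X) : ℝ := Real.sin (asymptoticAngle o y y' / 2)

/-! ### The Hamenstädt metric -/

/-- `b` is a Busemann function for the boundary point `ω`: up to an additive constant `k` it is
`x ↦ lim (|x c(t)| - t)` for a geodesic ray `c` to `ω`. -/
def IsBusemann (ω : Boundary X) (b : X → ℝ) : Prop :=
  ∃ (c : ℝ → X) (k : ℝ), IsRayTo (c 0) ω c ∧
    ∀ x : X, Tendsto (fun t : ℝ => dist x (c t) - t + k) atTop (𝓝 (b x))

/-- The Gromov product `(x | x')_b` with respect to a Busemann function `b`. -/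
def busemannProduct (b : X → ℝ) (x x' : X) : ℝ := (b x + b x' - dist x x') / 2

/-- The extension of `(x | x')_b` to boundary points:
`(y | y')_b = inf liminf (u i | v i)_b`, where the infimum is over all sequences `u` in `y` and
`v` in `y'`. It is `∞` for `y = y'`. -/
def busemannProductAtInfinity (b : X → ℝ) (y y' : Boundary X) : EReal :=
  ⨅ (u : ℕ → X) (v : ℕ → X) (_ : Represents u y) (_ : Represents v y'),
    liminf (fun i : ℕ => ((busemannProduct b (u i) (v i) : ℝ) : EReal)) atTop

/-- The Hamenstädt metric `exp (-(y | y')_b)`, a metric on the complement of the centre `ω` of the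
Busemann function `b`. -/
def hamenstadt (b : X → ℝ) (y y' : Boundary X) : ℝ :=
  (EReal.exp (-busemannProductAtInfinity b y y')).toReal

/-- `ρ`, as a function on `Y × Y`, is a Bourdon metric on the whole boundary `Y`, or a Hamenstädt
metric on the boundary `Y` with the centre `ω` removed. -/
def IsBourdonOrHamenstadt (Y : Set (Boundary X)) (ρ : Boundary X → Boundary X → ℝ) : Prop :=
  (Y = Set.univ ∧ ∃ o : X, ρ = bourdon o) ∨
  (∃ (ω : Boundary X) (b : X → ℝ), IsBusemann ω b ∧ Y = {ω}ᶜ ∧ ρ = hamenstadt b)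

/-! ### Convex hulls and ideal quadrilaterals -/

/-- A set is convex if it contains every geodesic segment between two of its points. -/
def IsConvex (C : Set X) : Prop :=
  ∀ a ∈ C, ∀ b ∈ C, ∀ x, Between a x b → x ∈ C

/-- The convex hull in `X` of a set `S` of boundary points: the smallest convex subset of `X` that
contains the geodesic lines joining points of `S`. -/
def hull (S : Set (Boundary X)) : Set X :=
  ⋂₀ {C : Set X | IsConvex C ∧ ∀ y ∈ S, ∀ y' ∈ S, line y y' ⊆ C}

/-- The convex hull of the four points is isometric to an ideal quadrilateral of the hyperbolic
plane (the convex hull of four distinct boundary points `η₁, η₂, η₃, η₄`, labelled in such a way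
that the geodesics `η₁ η₃` and `η₂ η₄` cross, that is, are the diagonals), and the isometry takes
the geodesics `y₁ y₃` and `y₂ y₄` to the diagonals. -/
def SpansIdealQuadrilateral (y₁ y₂ y₃ y₄ : Boundary X) : Prop :=
  ∃ η₁ η₂ η₃ η₄ : Boundary UpperHalfPlane,
    [η₁, η₂, η₃, η₄].Nodup ∧ (line η₁ η₃ ∩ line η₂ η₄).Nonempty ∧
    ∃ e : hull {y₁, y₂, y₃, y₄} ≃ᵢ hull {η₁, η₂, η₃, η₄},
      (∀ p : hull {y₁, y₂, y₃, y₄}, (p : X) ∈ line y₁ y₃ ↔ (e p : UpperHalfPlane) ∈ line η₁ η₃) ∧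
      (∀ p : hull {y₁, y₂, y₃, y₄}, (p : X) ∈ line y₂ y₄ ↔ (e p : UpperHalfPlane) ∈ line η₂ η₄)

end Boundary

end

end BoundaryPtolemy

/-! The only curvature input is the Stewart inequality, which compares the distance from a point `z`
to a point of a segment with the distances to its ends. In the hyperboloid model it is an equality,
by linearity of the Lorentz form (`upperHalfPlane_stewart`). In a CAT(-1) space it is an inequality
(`IsCATNegOne.isStewartSpace`).

Inequality. Applied to a suitable point of one diagonal, Stewart gives the Ptolemy inequality for
the function `sinh (|x x'| / 2)` of four points of `X` (`IsStewartSpace.ptolemy`). With one of the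
points fixed at `o`, this is the triangle inequality for `inverted`, which approaches twice `visual`
at infinity. Hence `exp (-(x | x')_o)` has a limit `rho o y y'` at boundary points, and the limit is
again Ptolemaic (`rho_ptolemy`). The Bourdon metric is `rho`, and a Hamenstädt metric is a constant
times `rho o y y' / (rho o y ω * rho o y' ω)`. Such a rescaling multiplies all three products in the
Ptolemy inequality by the same factor (`exists_rho_scale`), so only `rho` matters, and its base
point may be moved.

Equality. The line `y y'` consists of the points `p` with `rho p y y' = 1`, the largest possible
value. From a point of `y₁ y₃`, a third boundary point is seen under two angles whose sum is at
least `π` (`IsLineJoining.one_le_rho_sq_add`). At a well chosen point of `y₁ y₃`, equality in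
Ptolemy then forces `rho y₂ y₄ = 1`, so the two lines cross there, and it makes all distances
between their points hyperbolic (`exists_crossing`). Rigidity in Stewart spreads this isometry from
the cross to the chords between the two lines. By completeness it extends to a whole ideal
quadrilateral (`exists_extension`), and the hulls correspond (`hull_eq_image`). Conversely, the
angles at the crossing point of two lines in the hyperbolic plane give equality
(`rho_ptolemy_eq_of_crossing`). -/

namespace BoundaryPtolemy

/-! ### The hyperboloid model of the hyperbolic plane -/

section Hyperboloid

open UpperHalfPlane

/-- The Lorentzian form on `ℝ³`. -/
def lorentz (v w : ℝ × ℝ × ℝ) : ℝ := v.1 * w.1 - v.2.1 * w.2.1 - v.2.2 * w.2.2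

/-- The point of the hyperboloid that corresponds to a point of the upper half-plane. -/
noncomputable def vec (z : ℍ) : ℝ × ℝ × ℝ :=
  ((z.re ^ 2 + z.im ^ 2 + 1) / (2 * z.im), (z.re ^ 2 + z.im ^ 2 - 1) / (2 * z.im), z.re / z.im)

lemma lorentz_comm (v w : ℝ × ℝ × ℝ) : lorentz v w = lorentz w v := by
  simp only [lorentz]; ring

lemma lorentz_add_left (u v w : ℝ × ℝ × ℝ) : lorentz (u + v) w = lorentz u w + lorentz v w := by
  simp only [lorentz, Prod.fst_add, Prod.snd_add]; ring

lemma lorentz_sub_left (u v w : ℝ × ℝ × ℝ) : lorentz (u - v) w = lorentz u w - lorentz v w := by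
  simp only [lorentz, Prod.fst_sub, Prod.snd_sub]; ring

lemma lorentz_smul_left (r : ℝ) (v w : ℝ × ℝ × ℝ) : lorentz (r • v) w = r * lorentz v w := by
  simp only [lorentz, Prod.smul_fst, Prod.smul_snd, smul_eq_mul]; ring

lemma lorentz_add_right (u v w : ℝ × ℝ × ℝ) : lorentz w (u + v) = lorentz w u + lorentz w v := by
  simp only [lorentz, Prod.fst_add, Prod.snd_add]; ring

lemma lorentz_sub_right (u v w : ℝ × ℝ × ℝ) : lorentz w (u - v) = lorentz w u - lorentz w v := by
  simp only [lorentz, Prod.fst_sub, Prod.snd_sub]; ring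

lemma lorentz_smul_right (r : ℝ) (v w : ℝ × ℝ × ℝ) : lorentz w (r • v) = r * lorentz w v := by
  simp only [lorentz, Prod.smul_fst, Prod.smul_snd, smul_eq_mul]; ring

lemma cosh_dist_eq_lorentz (z w : ℍ) : Real.cosh (dist z w) = lorentz (vec z) (vec w) := by
  rw [UpperHalfPlane.cosh_dist']
  have hz := z.im_pos
  have hw := w.im_pos
  simp only [lorentz, vec]
  field_simp
  ring

lemma lorentz_vec_self (z : ℍ) : lorentz (vec z) (vec z) = 1 := by
  rw [← cosh_dist_eq_lorentz, dist_self, Real.cosh_zero]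

lemma vec_fst_pos (z : ℍ) : 0 < (vec z).1 := by
  have hz := z.im_pos
  simp only [vec]
  positivity

lemma exists_vec_eq (v : ℝ × ℝ × ℝ) (hv : lorentz v v = 1) (h0 : 0 < v.1) : ∃ z : ℍ, vec z = v := by
  obtain ⟨c, x, y⟩ := v
  simp only [lorentz] at hv h0
  have hcx : 0 < c - x := by
    have : x ^ 2 < c ^ 2 := by nlinarith [sq_nonneg y]
    have := abs_lt_of_sq_lt_sq this h0.le
    linarith [(abs_lt.1 this).2, (abs_lt.1 this).1]
  -- The first two coordinates of `vec z` differ by `1 / z.im`, which dictates the imaginary part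
  -- and then the real part.
  refine ⟨⟨⟨y / (c - x), 1 / (c - x)⟩, by simpa using hcx⟩, ?_⟩
  have h1 : (y ^ 2 + 1) = (c - x) * (c + x) := by nlinarith
  simp only [vec, UpperHalfPlane.re, UpperHalfPlane.im, Prod.mk.injEq]
  refine ⟨?_, ?_, ?_⟩
  · field_simp
    rw [h1]
    field_simp
    ring
  · field_simp
    rw [h1]
    field_simp
    ring
  · field_simp

lemma abs_eq_abs_of_cosh_eq {x y : ℝ} (h : Real.cosh x = Real.cosh y) : |x| = |y| :=
  le_antisymm (Real.cosh_le_cosh.1 h.le) (Real.cosh_le_cosh.1 h.ge)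

lemma eq_of_cosh_dist_le_one {X : Type*} [MetricSpace X] {x y : X} (h : Real.cosh (dist x y) ≤ 1) :
    x = y := by
  by_contra hne
  have := Real.one_lt_cosh.2 (dist_pos.2 hne).ne'
  linarith

lemma vec_injective : Function.Injective vec := by
  intro z w h
  apply eq_of_cosh_dist_le_one
  rw [cosh_dist_eq_lorentz, h, lorentz_vec_self]

/-- Unit timelike vectors with positive product lie on the same sheet of the hyperboloid: with
opposite time signs, the product could be positive only against Cauchy–Schwarz for the space parts.
-/
lemma fst_pos_of_lorentz_pos {v w : ℝ × ℝ × ℝ} (hv : lorentz v v = 1) (hv0 : 0 < v.1)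
    (hw : lorentz w w = 1) (h : 0 < lorentz w v) : 0 < w.1 := by
  obtain ⟨c, x, y⟩ := v
  obtain ⟨c', x', y'⟩ := w
  simp only [lorentz] at *
  by_contra hc
  push Not at hc
  have h1 : (x * x' + y * y') ^ 2 ≤ (x ^ 2 + y ^ 2) * (x' ^ 2 + y' ^ 2) := by
    nlinarith [sq_nonneg (x * y' - y * x')]
  have h2 : 0 < -(x * x' + y * y') := by nlinarith
  have h3 : (c * c') ^ 2 < (x * x' + y * y') ^ 2 := by
    have : 0 ≤ -(c * c') := by nlinarith
    nlinarith
  have h4 : x ^ 2 + y ^ 2 = c ^ 2 - 1 := by nlinarith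
  have h5 : x' ^ 2 + y' ^ 2 = c' ^ 2 - 1 := by nlinarith
  rw [h4, h5] at h1
  nlinarith [sq_nonneg x, sq_nonneg y, sq_nonneg x', sq_nonneg y']

/-- The orthogonal complement of a timelike vector is negative definite. -/
lemma eq_zero_of_lorentz {v w : ℝ × ℝ × ℝ} (hv : lorentz v v = 1) (hwv : lorentz w v = 0)
    (hw : lorentz w w = 0) : w = 0 := by
  obtain ⟨c, x, y⟩ := v
  obtain ⟨c', x', y'⟩ := w
  simp only [lorentz] at *
  have h1 : (x * x' + y * y') ^ 2 ≤ (x ^ 2 + y ^ 2) * (x' ^ 2 + y' ^ 2) := by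
    nlinarith [sq_nonneg (x * y' - y * x')]
  have h2 : x * x' + y * y' = c * c' := by linarith
  have h3 : x ^ 2 + y ^ 2 = c ^ 2 - 1 := by linarith
  have h4 : x' ^ 2 + y' ^ 2 = c' ^ 2 := by linarith
  rw [h2, h3, h4] at h1
  have h5 : c' = 0 := by nlinarith
  subst h5
  have h6 : x' = 0 := by nlinarith [sq_nonneg x', sq_nonneg y']
  have h7 : y' = 0 := by nlinarith [sq_nonneg x', sq_nonneg y']
  simp [h6, h7]

lemma vec_of_between {a x b : ℍ} (h : Between a x b) :
    Real.sinh (dist a b) • vec x =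
      Real.sinh (dist x b) • vec a + Real.sinh (dist a x) • vec b := by
  rw [← sub_eq_zero]
  have hab : dist a b = dist a x + dist x b := h.symm
  have hxx := lorentz_vec_self x
  have haa := lorentz_vec_self a
  have hbb := lorentz_vec_self b
  have hax := (cosh_dist_eq_lorentz a x).symm
  have hxb := (cosh_dist_eq_lorentz x b).symm
  have hab' := (cosh_dist_eq_lorentz a b).symm
  have hxa := lorentz_comm (vec x) (vec a)
  have hbx := lorentz_comm (vec b) (vec x)
  have hba := lorentz_comm (vec b) (vec a)
  rw [hab] at hab' ⊢
  rw [Real.sinh_add]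
  rw [Real.cosh_add] at hab'
  have e1 := Real.cosh_sq (dist a x)
  have e2 := Real.cosh_sq (dist x b)
  -- By the addition theorems the difference of the two sides is orthogonal to the timelike vector
  -- `vec x` and has square zero.
  refine eq_zero_of_lorentz hxx ?_ ?_
  · simp only [lorentz_sub_left, lorentz_add_left, lorentz_smul_left, hbx, hxx, hax, hxb]
    ring
  · simp only [lorentz_sub_left, lorentz_add_left, lorentz_smul_left, lorentz_sub_right,
      lorentz_add_right, lorentz_smul_right, hbx, hxx, hax, hxb, hxa, hba, hab', haa, hbb]
    ring_nf
    simp only [e1, e2]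
    ring

/-- Products with `vec a`, `vec b` and `vec x` give the hyperbolic sines of the two parts as `m` and
`l` times that of the whole. The addition theorem then shows that the parts add up. -/
lemma between_of_vec {a x b : ℍ} {l m : ℝ} (hl : 0 ≤ l) (hm : 0 ≤ m)
    (h : vec x = l • vec a + m • vec b) : Between a x b := by
  have hax : Real.cosh (dist a x) = l + m * Real.cosh (dist a b) := by
    rw [cosh_dist_eq_lorentz, cosh_dist_eq_lorentz, h, lorentz_add_right, lorentz_smul_right,
      lorentz_smul_right, lorentz_vec_self]
    ring
  have hxb : Real.cosh (dist x b) = l * Real.cosh (dist a b) + m := by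
    rw [cosh_dist_eq_lorentz, cosh_dist_eq_lorentz, h, lorentz_add_left, lorentz_smul_left,
      lorentz_smul_left, lorentz_vec_self]
    ring
  have hxx : 1 = l * Real.cosh (dist a x) + m * Real.cosh (dist x b) := by
    rw [← lorentz_vec_self x, cosh_dist_eq_lorentz, cosh_dist_eq_lorentz, lorentz_comm (vec x) (vec b),
      ← lorentz_smul_left, ← lorentz_smul_left, ← lorentz_add_left, ← h]
  have s : Real.cosh (dist a b) ^ 2 = Real.sinh (dist a b) ^ 2 + 1 := Real.cosh_sq _
  have p0 : 0 ≤ Real.sinh (dist a b) := Real.sinh_nonneg_iff.2 dist_nonneg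
  rw [hax, hxb] at hxx
  have s1 : Real.sinh (dist a x) = m * Real.sinh (dist a b) := by
    have h1 := Real.cosh_sq (dist a x)
    refine (sq_eq_sq₀ (Real.sinh_nonneg_iff.2 dist_nonneg) (by positivity)).1 ?_
    rw [hax] at h1
    linear_combination -h1 - hxx + m ^ 2 * s
  have s2 : Real.sinh (dist x b) = l * Real.sinh (dist a b) := by
    have h1 := Real.cosh_sq (dist x b)
    refine (sq_eq_sq₀ (Real.sinh_nonneg_iff.2 dist_nonneg) (by positivity)).1 ?_
    rw [hxb] at h1
    linear_combination -h1 - hxx + l ^ 2 * s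
  have key : Real.sinh (dist a x + dist x b) = Real.sinh (dist a b) := by
    rw [Real.sinh_add, s1, s2, hax, hxb]
    linear_combination (- Real.sinh (dist a b)) * hxx
  exact Real.sinh_injective key

lemma exists_geodesic_of_frame {v u : ℝ × ℝ × ℝ} (hv : lorentz v v = 1) (hu : lorentz u u = -1)
    (hvu : lorentz v u = 0) (h0 : 0 < v.1) :
    ∃ c : ℝ → ℍ, (∀ t, vec (c t) = Real.cosh t • v + Real.sinh t • u) ∧
      ∀ s t, dist (c s) (c t) = |s - t| := by
  have huv : lorentz u v = 0 := by rw [lorentz_comm, hvu]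
  have key : ∀ s t : ℝ, lorentz (Real.cosh s • v + Real.sinh s • u)
      (Real.cosh t • v + Real.sinh t • u) = Real.cosh (s - t) := by
    intro s t
    simp only [lorentz_add_left, lorentz_smul_left, lorentz_add_right, lorentz_smul_right, hv, hu,
      hvu, huv, Real.cosh_sub]
    ring
  have hex : ∀ t : ℝ, ∃ z : ℍ, vec z = Real.cosh t • v + Real.sinh t • u := by
    intro t
    have h1 := key t t
    rw [sub_self, Real.cosh_zero] at h1
    refine exists_vec_eq _ h1 (fst_pos_of_lorentz_pos hv h0 h1 ?_)
    simp only [lorentz_add_left, lorentz_smul_left, hv, huv]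
    simpa using Real.cosh_pos t
  choose c hc using hex
  refine ⟨c, hc, fun s t => ?_⟩
  have := key s t
  rw [← hc, ← hc, ← cosh_dist_eq_lorentz] at this
  simpa using abs_eq_abs_of_cosh_eq this

/-- This is `vec_of_between` paired with `vec z`. That it is an equality is what later makes
comparison with the plane rigid. -/
lemma upperHalfPlane_stewart {a x b : ℍ} (h : Between a x b) (z : ℍ) :
    Real.sinh (dist a b) * Real.cosh (dist z x) =
      Real.sinh (dist x b) * Real.cosh (dist z a) + Real.sinh (dist a x) * Real.cosh (dist z b) := by
  rw [cosh_dist_eq_lorentz, cosh_dist_eq_lorentz, cosh_dist_eq_lorentz, ← lorentz_smul_right,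
    ← lorentz_smul_right, ← lorentz_smul_right, ← lorentz_add_right, vec_of_between h]

lemma upperHalfPlane_geodesic : IsGeodesicSpace ℍ := by
  intro a b
  rcases eq_or_ne a b with rfl | hab
  · refine ⟨fun _ => a, rfl, rfl, fun s hs t ht => ?_⟩
    rw [dist_self] at hs ht
    have h1 : s = 0 := le_antisymm hs.2 hs.1
    have h2 : t = 0 := le_antisymm ht.2 ht.1
    simp [h1, h2]
  have hL : 0 < Real.sinh (dist a b) := Real.sinh_pos_iff.2 (dist_pos.2 hab)
  have haa := lorentz_vec_self a
  have hbb := lorentz_vec_self b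
  have hab' := (cosh_dist_eq_lorentz a b).symm
  have hba := lorentz_comm (vec b) (vec a)
  have e := Real.cosh_sq (dist a b)
  -- The direction is `vec b` made orthogonal to `vec a` and normalised.
  obtain ⟨c, hc, hd⟩ := exists_geodesic_of_frame (v := vec a)
    (u := (Real.sinh (dist a b))⁻¹ • (vec b - Real.cosh (dist a b) • vec a)) haa
    (by
      simp only [lorentz_sub_left, lorentz_smul_left, lorentz_sub_right, lorentz_smul_right, haa,
        hbb, hba, hab']
      field_simp
      linear_combination -e)
    (by
      simp only [lorentz_smul_right, lorentz_sub_right, haa, hab']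
      ring)
    (vec_fst_pos a)
  refine ⟨c, ?_, ?_, fun s _ t _ => hd s t⟩
  · apply vec_injective
    rw [hc]
    simp
  · apply vec_injective
    rw [hc, smul_smul, mul_inv_cancel₀ hL.ne']
    simp

end Hyperboloid

/-! ### The Stewart inequality -/

/-- A complete geodesic space in which the distance from a point to a point of a geodesic segment is
at most the corresponding distance in a comparison triangle in the hyperbolic plane. -/
structure IsStewartSpace (X : Type*) [MetricSpace X] : Prop where
  complete : CompleteSpace X
  geodesic : IsGeodesicSpace X
  stewart : ∀ a x b : X, Between a x b → ∀ z : X,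
    Real.sinh (dist a b) * Real.cosh (dist z x) ≤
      Real.sinh (dist x b) * Real.cosh (dist z a) + Real.sinh (dist a x) * Real.cosh (dist z b)

-- Everything proved below for Stewart spaces thus also holds for the hyperbolic plane, which plays
-- both roles in the equality case.
open UpperHalfPlane in
lemma upperHalfPlane_isStewartSpace : IsStewartSpace ℍ where
  complete := inferInstance
  geodesic := upperHalfPlane_geodesic
  stewart _ _ _ h z := (upperHalfPlane_stewart h z).le

open UpperHalfPlane in
lemma exists_comparison_triangle {L r d : ℝ} (hL : 0 < L) (hr : 0 ≤ r) (hd : 0 ≤ d)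
    (h1 : L ≤ r + d) (h2 : r ≤ L + d) (h3 : d ≤ L + r) :
    ∃ (c : ℝ → ℍ) (q : ℍ), (∀ s t, dist (c s) (c t) = |s - t|) ∧ dist (c 0) q = r ∧
      dist (c L) q = d := by
  obtain ⟨c, hc, hcd⟩ := exists_geodesic_of_frame (v := (1, 0, 0)) (u := (0, 1, 0))
    (by simp [lorentz]) (by simp [lorentz]) (by simp [lorentz]) (by simp)
  have hs : 0 < Real.sinh L := Real.sinh_pos_iff.2 hL
  -- The product of `(cosh L, sinh L, 0)` with `(cosh r, S, _)` has to be `cosh d`. The triangle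
  -- inequalities give `|S| ≤ sinh r`, which leaves room for the last coordinate.
  set S := (Real.cosh r * Real.cosh L - Real.cosh d) / Real.sinh L with hS
  have hSL : S * Real.sinh L = Real.cosh r * Real.cosh L - Real.cosh d := by
    rw [hS]; field_simp
  have b1 : Real.cosh (L - r) ≤ Real.cosh d := by
    rw [Real.cosh_le_cosh, abs_of_nonneg hd, abs_le]
    constructor <;> linarith
  have b2 : Real.cosh d ≤ Real.cosh (L + r) := by
    rw [Real.cosh_le_cosh, abs_of_nonneg hd, abs_of_nonneg (by linarith)]
    exact h3
  rw [Real.cosh_sub] at b1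
  rw [Real.cosh_add] at b2
  have hSle : S ≤ Real.sinh r := le_of_mul_le_mul_right (by linarith) hs
  have hSge : -Real.sinh r ≤ S := le_of_mul_le_mul_right (by linarith) hs
  have hW : 0 ≤ Real.sinh r ^ 2 - S ^ 2 := by nlinarith
  have hW' := Real.mul_self_sqrt hW
  have e := Real.cosh_sq r
  obtain ⟨q, hq⟩ := exists_vec_eq (Real.cosh r, S, √(Real.sinh r ^ 2 - S ^ 2))
    (by simp only [lorentz]; nlinarith) (Real.cosh_pos r)
  refine ⟨c, q, hcd, ?_, ?_⟩
  · have : Real.cosh (dist (c 0) q) = Real.cosh r := by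
      rw [cosh_dist_eq_lorentz, hq, hc]; simp [lorentz]
    simpa [abs_of_nonneg hr] using abs_eq_abs_of_cosh_eq this
  · have : Real.cosh (dist (c L) q) = Real.cosh d := by
      rw [cosh_dist_eq_lorentz, hq, hc]; simp [lorentz]; linarith
    simpa [abs_of_nonneg hd] using abs_eq_abs_of_cosh_eq this

lemma IsCATNegOne.isStewartSpace {X : Type*} [MetricSpace X] (hX : IsCATNegOne X) :
    IsStewartSpace X where
  complete := hX.complete
  geodesic := hX.geodesic
  stewart a x b h z := by
    rcases eq_or_ne a b with rfl | hab
    · simp only [dist_self, Real.sinh_zero, zero_mul]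
      have h1 : 0 ≤ Real.sinh (dist x a) := Real.sinh_nonneg_iff.2 dist_nonneg
      have h2 : 0 ≤ Real.sinh (dist a x) := Real.sinh_nonneg_iff.2 dist_nonneg
      have := Real.cosh_pos (dist z a)
      positivity
    have hab' := dist_pos.2 hab
    obtain ⟨c, q, hc, h0, hL⟩ := exists_comparison_triangle (L := dist a b) (r := dist a z)
      (d := dist b z) hab' dist_nonneg dist_nonneg
      (by linarith [dist_triangle a z b, dist_comm z b]) (dist_triangle _ _ _)
      (by linarith [dist_triangle b a z, dist_comm a b])
    have hax : dist a x + dist x b = dist a b := h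
    have n1 := @dist_nonneg _ _ a x
    have n2 := @dist_nonneg _ _ x b
    have d1 : dist (c 0) (c (dist a b)) = dist a b := by
      rw [hc, zero_sub, abs_neg, abs_of_pos hab']
    have d2 : dist (c 0) (c (dist a x)) = dist a x := by
      rw [hc, zero_sub, abs_neg, abs_of_nonneg n1]
    have d3 : dist (c (dist a x)) (c (dist a b)) = dist x b := by
      rw [hc, abs_sub_comm, abs_of_nonneg (by linarith)]; linarith
    -- Thinness is needed only for a point on one side and the opposite vertex, so the second point
    -- is taken at the end `z` of its side.
    have hz : Between a z z := by simp [Between]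
    have key := hX.thin a b z x z (c 0) (c (dist a b)) q (c (dist a x)) q h hz d1 hL h0 d2 d3 h0
      (by simp)
    have hb : Between (c 0) (c (dist a x)) (c (dist a b)) := by
      simp only [Between, d1, d2, d3, hax]
    have st := upperHalfPlane_stewart hb q
    rw [d1, d2, d3, dist_comm q (c 0), h0, dist_comm q (c (dist a b)), hL] at st
    rw [dist_comm z a, dist_comm z b, ← st]
    have hs : 0 ≤ Real.sinh (dist a b) := Real.sinh_nonneg_iff.2 dist_nonneg
    refine mul_le_mul_of_nonneg_left ?_ hs
    rw [Real.cosh_le_cosh, abs_of_nonneg dist_nonneg, abs_of_nonneg dist_nonneg, dist_comm z x,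
      dist_comm q]
    exact key

/-! ### The Ptolemy inequality for four points -/

section Finite

variable {X : Type*} [MetricSpace X]

lemma cosh_eq_one_add (t : ℝ) : Real.cosh t = 1 + 2 * Real.sinh (t / 2) ^ 2 := by
  have h := Real.cosh_two_mul (t / 2)
  rw [mul_div_cancel₀ t two_ne_zero] at h
  linarith [Real.cosh_sq (t / 2)]

lemma IsGeodesicSpace.exists_between (hX : IsGeodesicSpace X) (a b : X) {s : ℝ} (h0 : 0 ≤ s)
    (h1 : s ≤ dist a b) : ∃ x, dist a x = s ∧ dist x b = dist a b - s := by
  obtain ⟨c, c0, c1, hc⟩ := hX a b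
  have m0 : (0 : ℝ) ∈ Set.Icc 0 (dist a b) := ⟨le_rfl, dist_nonneg⟩
  have m1 : dist a b ∈ Set.Icc 0 (dist a b) := ⟨dist_nonneg, le_rfl⟩
  refine ⟨c s, ?_, ?_⟩
  · have := hc 0 m0 s ⟨h0, h1⟩
    rw [c0] at this
    rw [this, zero_sub, abs_neg, abs_of_nonneg h0]
  · have := hc s ⟨h0, h1⟩ _ m1
    rw [c1] at this
    rw [this, abs_sub_comm, abs_of_nonneg (by linarith)]

/-- The final estimate for `IsStewartSpace.ptolemy`. After multiplication by `n ^ 2` and the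
addition theorem, the product of the hyperbolic sines has to be bounded by the expression in
`hdiff`. By `hsq` the squares of the two bounds differ by a perfect square. The sign needed to take
roots comes from `n ≤ Q + 2 * U` and `n ≤ Q + 2 * V`, that is, from `1 ≤ cosh`. -/
lemma cosh_add_le_of_le {Q U V K n α β : ℝ} (hQ : 0 < Q) (hU : 0 < U) (hV : 0 < V) (hK : 0 < K)
    (hn : 0 < n) (h : K * n ^ 2 = K * Q ^ 2 + 4 * U * V) (hα : 0 ≤ α) (hβ : 0 ≤ β)
    (h1 : n * Real.cosh α ≤ Q + 2 * U) (h2 : n * Real.cosh β ≤ Q + 2 * V) :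
    Real.cosh (α + β) ≤ 1 + 2 * K := by
  have c1 := Real.one_le_cosh α
  have c2 := Real.one_le_cosh β
  have s1 := Real.sinh_nonneg_iff.2 hα
  have s2 := Real.sinh_nonneg_iff.2 hβ
  have e1 := Real.cosh_sq α
  have e2 := Real.cosh_sq β
  have n1 : n ≤ Q + 2 * U := (le_mul_of_one_le_right hn.le c1).trans h1
  have n2 : n ≤ Q + 2 * V := (le_mul_of_one_le_right hn.le c2).trans h2
  have k1 : V ≤ K * (U + Q) := by
    have : K * n ^ 2 ≤ K * (Q + 2 * U) ^ 2 := by gcongr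
    have : U * V ≤ U * (K * (U + Q)) := by linarith
    exact le_of_mul_le_mul_left this hU
  have k2 : U ≤ K * (V + Q) := by
    have : K * n ^ 2 ≤ K * (Q + 2 * V) ^ 2 := by gcongr
    have : V * U ≤ V * (K * (V + Q)) := by linarith
    exact le_of_mul_le_mul_left this hV
  have hprod : 0 ≤ (K * Q - U) * (K * Q - V) + U * V + 2 * U * V * K := by
    have hUV : 0 < U * V := by positivity
    have hUVK : 0 < U * V * K := by positivity
    rcases le_total U (K * Q) with a | a <;> rcases le_total V (K * Q) with b | b
    · linarith [mul_nonneg (sub_nonneg.2 a) (sub_nonneg.2 b)]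
    · have : (V - K * Q) * (K * Q - U) ≤ (K * U) * V :=
        mul_le_mul (by linarith) (by linarith) (by linarith) (by positivity)
      linarith
    · have : (U - K * Q) * (K * Q - V) ≤ (K * V) * U :=
        mul_le_mul (by linarith) (by linarith) (by linarith) (by positivity)
      linarith
    · linarith [mul_nonneg (sub_nonneg.2 a) (sub_nonneg.2 b)]
  have hdiff : 0 ≤ (1 + 2 * K) * n ^ 2 - (Q + 2 * U) * (Q + 2 * V) := by
    refine nonneg_of_mul_nonneg_right (a := K) ?_ hK
    have : K * ((1 + 2 * K) * n ^ 2 - (Q + 2 * U) * (Q + 2 * V)) =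
      2 * ((K * Q - U) * (K * Q - V) + U * V + 2 * U * V * K) := by
      linear_combination (1 + 2 * K) * h
    rw [this]
    positivity
  have hcc : (n * Real.cosh α) * (n * Real.cosh β) ≤ (Q + 2 * U) * (Q + 2 * V) := by
    gcongr
  have hs1 : (n * Real.sinh α) ^ 2 ≤ (Q + 2 * U) ^ 2 - n ^ 2 := by
    have : (n * Real.cosh α) ^ 2 ≤ (Q + 2 * U) ^ 2 := by gcongr
    rw [mul_pow, e1] at this
    linarith
  have hs2 : (n * Real.sinh β) ^ 2 ≤ (Q + 2 * V) ^ 2 - n ^ 2 := by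
    have : (n * Real.cosh β) ^ 2 ≤ (Q + 2 * V) ^ 2 := by gcongr
    rw [mul_pow, e2] at this
    linarith
  have hsq : ((1 + 2 * K) * n ^ 2 - (Q + 2 * U) * (Q + 2 * V)) ^ 2 -
      ((Q + 2 * U) ^ 2 - n ^ 2) * ((Q + 2 * V) ^ 2 - n ^ 2) =
      4 * n ^ 2 * (U + V - K * Q) ^ 2 := by
    linear_combination (4 * n ^ 2 * (1 + K)) * h
  have hss : (n * Real.sinh α) * (n * Real.sinh β) ≤
      (1 + 2 * K) * n ^ 2 - (Q + 2 * U) * (Q + 2 * V) := by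
    refine le_of_sq_le_sq ?_ hdiff
    calc ((n * Real.sinh α) * (n * Real.sinh β)) ^ 2
        = (n * Real.sinh α) ^ 2 * (n * Real.sinh β) ^ 2 := by ring
      _ ≤ ((Q + 2 * U) ^ 2 - n ^ 2) * ((Q + 2 * V) ^ 2 - n ^ 2) := by
        gcongr
        exact (sq_nonneg _).trans hs1
      _ ≤ _ := by linarith [mul_nonneg (sq_nonneg n) (sq_nonneg (U + V - K * Q))]
  rw [Real.cosh_add]
  refine le_of_mul_le_mul_left (a := n ^ 2) ?_ (by positivity)
  linarith

lemma exists_sinh_ratio {L l m : ℝ} (hL : 0 < L) (hl : 0 < l) (hm : 0 < m) :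
    ∃ s k, 0 ≤ s ∧ s ≤ L ∧ 0 < k ∧ Real.sinh s = k * m ∧ Real.sinh (L - s) = k * l := by
  have hcont : Continuous fun s => Real.sinh s * l - Real.sinh (L - s) * m := by fun_prop
  have hsL := Real.sinh_pos_iff.2 hL
  have h0 : (0 : ℝ) ∈ Set.Icc (Real.sinh 0 * l - Real.sinh (L - 0) * m)
      (Real.sinh L * l - Real.sinh (L - L) * m) := by
    simp only [Real.sinh_zero, sub_zero, sub_self, zero_mul, zero_sub]
    constructor
    · have := mul_pos hsL hm; linarith
    · positivity
  obtain ⟨s, ⟨hs0, hsL'⟩, hs⟩ := intermediate_value_Icc hL.le hcont.continuousOn h0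
  have hspos : 0 < s := by
    rcases hs0.eq_or_lt with h | h
    · subst h
      simp only [Real.sinh_zero, sub_zero, zero_mul, zero_sub] at hs
      have := mul_pos hsL hm; linarith
    · exact h
  refine ⟨s, Real.sinh s / m, hs0, hsL', div_pos (Real.sinh_pos_iff.2 hspos) hm, ?_, ?_⟩
  · field_simp
  · simp only at hs
    field_simp
    linarith

/-- Stewart bounds the distances from `x₂` and `x₄` to one point `q` of the diagonal `x₁ x₃`, and
the triangle inequality through `q` bounds the other diagonal. Degenerate quadrilaterals are split
off so that all sides are positive. -/
lemma IsStewartSpace.ptolemy (hX : IsStewartSpace X) (x₁ x₂ x₃ x₄ : X) :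
    Real.sinh (dist x₁ x₃ / 2) * Real.sinh (dist x₂ x₄ / 2) ≤
      Real.sinh (dist x₁ x₂ / 2) * Real.sinh (dist x₃ x₄ / 2) +
      Real.sinh (dist x₂ x₃ / 2) * Real.sinh (dist x₄ x₁ / 2) := by
  rcases eq_or_ne x₁ x₂ with rfl | h12
  · simp [dist_comm]
  rcases eq_or_ne x₂ x₃ with rfl | h23
  · simp
  rcases eq_or_ne x₃ x₄ with rfl | h34
  · simp [dist_comm, mul_comm]
  rcases eq_or_ne x₄ x₁ with rfl | h41
  · simp [dist_comm, mul_comm]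
  have pos : ∀ {x y : X}, x ≠ y → 0 < Real.sinh (dist x y / 2) := fun h =>
    Real.sinh_pos_iff.2 (half_pos (dist_pos.2 h))
  have ha := pos h12
  have hb := pos h23
  have hc := pos h34
  have hd := pos h41
  rcases eq_or_ne x₁ x₃ with rfl | h13
  · simp only [dist_self, zero_div, Real.sinh_zero, zero_mul]; positivity
  have he := pos h13
  have c12 := cosh_eq_one_add (dist x₁ x₂)
  have c23 := cosh_eq_one_add (dist x₂ x₃)
  have c34 := cosh_eq_one_add (dist x₃ x₄)
  have c41 := cosh_eq_one_add (dist x₄ x₁)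
  have c13 := cosh_eq_one_add (dist x₁ x₃)
  have c24 := cosh_eq_one_add (dist x₂ x₄)
  have hf : 0 ≤ Real.sinh (dist x₂ x₄ / 2) := Real.sinh_nonneg_iff.2 (by positivity)
  set a := Real.sinh (dist x₁ x₂ / 2)
  set b := Real.sinh (dist x₂ x₃ / 2)
  set c := Real.sinh (dist x₃ x₄ / 2)
  set d := Real.sinh (dist x₄ x₁ / 2)
  set e := Real.sinh (dist x₁ x₃ / 2)
  set f := Real.sinh (dist x₂ x₄ / 2)
  -- The ratio `a * d : b * c` is the one in which the other diagonal cuts `x₁ x₃` in a Euclidean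
  -- cyclic quadrilateral, the equality case of the classical theorem.
  obtain ⟨s, k, hs0, hsL, hk, hs, hs'⟩ := exists_sinh_ratio (L := dist x₁ x₃) (l := b * c)
    (m := a * d) (dist_pos.2 h13) (by positivity) (by positivity)
  obtain ⟨q, hq1, hq3⟩ := hX.geodesic.exists_between x₁ x₃ hs0 hsL
  have hbt : Between x₁ q x₃ := by simp only [Between, hq1, hq3]; ring
  have st2 := hX.stewart _ _ _ hbt x₂
  have st4 := hX.stewart _ _ _ hbt x₄
  rw [hq1, hq3, hs, hs', dist_comm x₂ x₁, c12, c23] at st2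
  rw [hq1, hq3, hs, hs', dist_comm x₄ x₃, c41, c34] at st4
  have hsinhL : Real.sinh (dist x₁ x₃) ^ 2 =
      k ^ 2 * ((a * d + b * c) ^ 2 + 4 * (a * b * c * d) * e ^ 2) := by
    have h1 : dist x₁ x₃ = s + (dist x₁ x₃ - s) := by ring
    have h2 : Real.sinh (dist x₁ x₃) ^ 2 = Real.sinh s ^ 2 + Real.sinh (dist x₁ x₃ - s) ^ 2 +
        2 * Real.sinh s * Real.sinh (dist x₁ x₃ - s) * Real.cosh (dist x₁ x₃) := by
      generalize dist x₁ x₃ - s = r at h1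
      rw [h1, Real.sinh_add, Real.cosh_add]
      linear_combination (Real.sinh r ^ 2) * Real.cosh_sq s + (Real.sinh s ^ 2) * Real.cosh_sq r
    rw [h2, hs, hs', c13]
    ring
  have hsL0 : 0 < Real.sinh (dist x₁ x₃) := Real.sinh_pos_iff.2 (dist_pos.2 h13)
  have key := cosh_add_le_of_le (Q := a * d + b * c) (U := a * b * (a * c + b * d))
    (V := c * d * (a * c + b * d)) (K := (a * c + b * d) ^ 2 / e ^ 2)
    (n := Real.sinh (dist x₁ x₃) / k) (α := dist x₂ q) (β := dist x₄ q) (by positivity)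
    (by positivity) (by positivity) (by positivity) (by positivity)
    (by rw [div_pow, hsinhL]; field_simp) dist_nonneg dist_nonneg
    (by rw [div_mul_eq_mul_div, div_le_iff₀ hk]; linarith)
    (by rw [div_mul_eq_mul_div, div_le_iff₀ hk]; linarith)
  have tri : Real.cosh (dist x₂ x₄) ≤ Real.cosh (dist x₂ q + dist x₄ q) := by
    rw [Real.cosh_le_cosh, abs_of_nonneg dist_nonneg, abs_of_nonneg (by positivity),
      dist_comm x₄ q]
    exact dist_triangle _ _ _
  have h1 : f ^ 2 ≤ ((a * c + b * d) / e) ^ 2 := by rw [div_pow]; linarith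
  have h2 : f ≤ (a * c + b * d) / e := le_of_sq_le_sq h1 (by positivity)
  rw [le_div_iff₀ he] at h2
  linarith

/-- Uniqueness of geodesics: in Stewart with `z = x'` the right side collapses to `sinh |a b|` by
the addition theorem. -/
lemma IsStewartSpace.eq_of_between (hX : IsStewartSpace X) {a b x x' : X} (h : Between a x b)
    (h1 : dist a x = dist a x') (h2 : dist x b = dist x' b) : x = x' := by
  rcases eq_or_ne a b with rfl | hab
  · have h' : dist a x + dist x a = dist a a := h
    rw [dist_comm x a, dist_self] at h'
    have e1 : dist a x = 0 := by linarith
    rw [dist_eq_zero] at e1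
    rw [← e1, dist_self] at h1
    rw [← e1]
    exact dist_eq_zero.1 h1.symm
  have hs := hX.stewart _ _ _ h x'
  have hL : 0 < Real.sinh (dist a b) := Real.sinh_pos_iff.2 (dist_pos.2 hab)
  rw [dist_comm x' a, ← h1, ← h2, add_comm, mul_comm (Real.sinh (dist x b)), ← Real.sinh_add,
    show dist a x + dist x b = dist a b from h] at hs
  refine eq_of_cosh_dist_le_one ?_
  rw [dist_comm]
  exact le_of_mul_le_mul_left (by linarith) hL

end Finite

/-! ### Gromov products of boundary points -/

section GromovProducts

variable {X : Type*} [MetricSpace X]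

/-- The exponential `exp (-(x | x')_o)` of the Gromov product. -/
noncomputable def visual (o x x' : X) : ℝ := Real.exp (-gromovProduct o x x')

/-- The function `sinh (|x x'| / 2) / (sinh (|o x| / 2) sinh (|o x'| / 2))`. By the Ptolemy inequality
it is a metric on the complement of `o`. -/
noncomputable def inverted (o x x' : X) : ℝ :=
  Real.sinh (dist x x' / 2) / (Real.sinh (dist o x / 2) * Real.sinh (dist o x' / 2))

lemma sinh_half_dist_nonneg (x y : X) : 0 ≤ Real.sinh (dist x y / 2) :=
  Real.sinh_nonneg_iff.2 (by positivity)

lemma sinh_half_dist_pos {x y : X} (h : x ≠ y) : 0 < Real.sinh (dist x y / 2) :=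
  Real.sinh_pos_iff.2 (half_pos (dist_pos.2 h))

lemma inverted_comm (o x y : X) : inverted o x y = inverted o y x := by
  simp only [inverted, dist_comm x y, mul_comm]

lemma inverted_nonneg (o x y : X) : 0 ≤ inverted o x y :=
  div_nonneg (sinh_half_dist_nonneg _ _)
    (mul_nonneg (sinh_half_dist_nonneg _ _) (sinh_half_dist_nonneg _ _))

lemma visual_pos (o x y : X) : 0 < visual o x y := Real.exp_pos _

lemma visual_comm (o x y : X) : visual o x y = visual o y x := by
  simp only [visual, gromovProduct, dist_comm x y, add_comm]

lemma gromovProduct_nonneg (o x y : X) : 0 ≤ gromovProduct o x y := by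
  have := dist_triangle x o y
  rw [dist_comm x o] at this
  unfold gromovProduct
  linarith

lemma visual_le_one (o x y : X) : visual o x y ≤ 1 :=
  Real.exp_le_one_iff.2 (by linarith [gromovProduct_nonneg o x y])

lemma IsStewartSpace.inverted_triangle (hX : IsStewartSpace X) {o x y z : X} (hx : o ≠ x)
    (hy : o ≠ y) (hz : o ≠ z) : inverted o x z ≤ inverted o x y + inverted o y z := by
  have h := hX.ptolemy o x y z
  have px := sinh_half_dist_pos hx
  have py := sinh_half_dist_pos hy
  have pz := sinh_half_dist_pos hz
  rw [dist_comm z o] at h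
  unfold inverted
  rw [div_add_div _ _ (by positivity) (by positivity), div_le_div_iff₀ (by positivity)
    (by positivity)]
  have := mul_le_mul_of_nonneg_right h
    (show 0 ≤ Real.sinh (dist o x / 2) * Real.sinh (dist o z / 2) * Real.sinh (dist o y / 2) by
      positivity)
  linarith

lemma IsStewartSpace.abs_inverted_sub_le (hX : IsStewartSpace X) {o x y x' y' : X} (hx : o ≠ x)
    (hy : o ≠ y) (hx' : o ≠ x') (hy' : o ≠ y') :
    |inverted o x y - inverted o x' y'| ≤ inverted o x x' + inverted o y y' := by
  rw [abs_le]
  have h1 := hX.inverted_triangle hx hx' hy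
  have h2 := hX.inverted_triangle hx' hy' hy
  have h3 := hX.inverted_triangle hx' hx hy'
  have h4 := hX.inverted_triangle hx hy hy'
  rw [inverted_comm o y' y] at h2
  rw [inverted_comm o x' x] at h3
  constructor <;> linarith

lemma two_mul_sinh_half (t : ℝ) : 2 * Real.sinh (t / 2) = Real.exp (t / 2) * (1 - Real.exp (-t)) := by
  rw [Real.sinh_eq, mul_sub, ← Real.exp_add, show t / 2 + -t = -(t / 2) by ring]
  ring

/-- This rests on `exp (d / 2) = 2 sinh (d / 2) + exp (-d / 2)`. Far from `o` the correction factors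
tend to `1` and the last term to `0`, so limits of Gromov products can be studied with `inverted`,
for which a triangle inequality is available. -/
lemma visual_eq_inverted {o x y : X} (hx : o ≠ x) (hy : o ≠ y) :
    visual o x y = inverted o x y * ((1 - Real.exp (-dist o x)) * (1 - Real.exp (-dist o y))) / 2 +
      Real.exp (-((dist o x + dist o y + dist x y) / 2)) := by
  have px := sinh_half_dist_pos hx
  have py := sinh_half_dist_pos hy
  have e1 := two_mul_sinh_half (dist o x)
  have e2 := two_mul_sinh_half (dist o y)
  have e3 := Real.sinh_eq (dist x y / 2)
  have f1 : 1 - Real.exp (-dist o x) = 2 * Real.sinh (dist o x / 2) * Real.exp (-(dist o x / 2)) := by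
    rw [e1, mul_right_comm, ← Real.exp_add]; simp
  have f2 : 1 - Real.exp (-dist o y) = 2 * Real.sinh (dist o y / 2) * Real.exp (-(dist o y / 2)) := by
    rw [e2, mul_right_comm, ← Real.exp_add]; simp
  rw [f1, f2, inverted, e3]
  have e4 : visual o x y =
      Real.exp (dist x y / 2) * (Real.exp (-(dist o x / 2)) * Real.exp (-(dist o y / 2))) := by
    rw [visual, gromovProduct, ← Real.exp_add, ← Real.exp_add]; congr 1; ring
  have e5 : Real.exp (-((dist o x + dist o y + dist x y) / 2)) =
      Real.exp (-(dist x y / 2)) * (Real.exp (-(dist o x / 2)) * Real.exp (-(dist o y / 2))) := by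
    rw [← Real.exp_add, ← Real.exp_add]; congr 1; ring
  rw [e4, e5]
  field_simp
  ring

lemma eventually_ne_of_tendsto {ι : Type*} {l : Filter ι} {o : X} {u : ι → X}
    (h : Tendsto (fun i => dist o (u i)) l atTop) : ∀ᶠ i in l, o ≠ u i := by
  filter_upwards [h.eventually_gt_atTop 0] with i hi
  exact dist_pos.1 hi

lemma tendsto_one_sub_exp_neg {ι : Type*} {l : Filter ι} {f : ι → ℝ} (h : Tendsto f l atTop) :
    Tendsto (fun i => 1 - Real.exp (-f i)) l (𝓝 1) := by
  have := (Real.tendsto_exp_neg_atTop_nhds_zero.comp h).const_sub 1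
  simpa using this

lemma tendsto_visual_iff {ι : Type*} {l : Filter ι} {o : X} {u v : ι → X} {r : ℝ}
    (hu : Tendsto (fun i => dist o (u i)) l atTop) (hv : Tendsto (fun i => dist o (v i)) l atTop) :
    Tendsto (fun i => visual o (u i) (v i)) l (𝓝 r) ↔
      Tendsto (fun i => inverted o (u i) (v i)) l (𝓝 (2 * r)) := by
  have h1 := (tendsto_one_sub_exp_neg hu).mul (tendsto_one_sub_exp_neg hv)
  have h2 : Tendsto (fun i => Real.exp (-((dist o (u i) + dist o (v i) + dist (u i) (v i)) / 2))) l
      (𝓝 0) := by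
    refine Real.tendsto_exp_neg_atTop_nhds_zero.comp ?_
    refine tendsto_atTop_mono (fun i => ?_) (hu.atTop_div_const (zero_lt_two))
    have := @dist_nonneg _ _ o (v i)
    have := @dist_nonneg _ _ (u i) (v i)
    linarith
  have hne := (eventually_ne_of_tendsto hu).and (eventually_ne_of_tendsto hv)
  rw [one_mul] at h1
  constructor
  · intro h
    have h3 := (((h.sub h2).const_mul 2).div h1 one_ne_zero)
    simp only [sub_zero, div_one] at h3
    refine h3.congr' ?_
    filter_upwards [hne, h1.eventually_ne one_ne_zero] with i hi hi'
    rw [Pi.div_apply, visual_eq_inverted hi.1 hi.2, div_eq_iff hi']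
    ring
  · intro h
    have h3 := ((h.mul h1).div_const 2).add h2
    simp only [mul_one, add_zero] at h3
    rw [mul_div_cancel_left₀ r two_ne_zero] at h3
    refine h3.congr' ?_
    filter_upwards [hne] with i hi
    rw [visual_eq_inverted hi.1 hi.2]

lemma tendsto_visual_zero_iff {ι : Type*} {l : Filter ι} {o : X} {u v : ι → X} :
    Tendsto (fun i => visual o (u i) (v i)) l (𝓝 0) ↔
      Tendsto (fun i => gromovProduct o (u i) (v i)) l atTop := by
  unfold visual
  rw [Real.tendsto_exp_comp_nhds_zero, tendsto_neg_atBot_iff]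

lemma gromovProduct_le_add (o o' x y : X) :
    gromovProduct o x y ≤ gromovProduct o' x y + dist o o' := by
  unfold gromovProduct
  linarith [dist_triangle o o' x, dist_triangle o o' y]

lemma tendsto_gromovProduct_of_base {ι : Type*} {l : Filter ι} {o : X} {u v : ι → X}
    (h : Tendsto (fun i => gromovProduct o (u i) (v i)) l atTop) (o' : X) :
    Tendsto (fun i => gromovProduct o' (u i) (v i)) l atTop := by
  refine tendsto_atTop_mono (fun i => ?_) (tendsto_atTop_add_const_right l (-dist o o') h)
  linarith [gromovProduct_le_add o o' (u i) (v i)]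

lemma gromovProduct_self (o x : X) : gromovProduct o x x = dist o x := by
  simp [gromovProduct]

lemma ConvergesToInfinity.seqEquiv_self {u : ℕ → X} (h : ConvergesToInfinity u) : SeqEquiv u u :=
  fun o => (h o).comp (tendsto_id.prodMk tendsto_id)

lemma ConvergesToInfinity.tendsto_dist {u : ℕ → X} (h : ConvergesToInfinity u) (o : X) :
    Tendsto (fun i => dist o (u i)) atTop atTop := by
  simpa only [gromovProduct_self] using h.seqEquiv_self o

lemma SeqEquiv.symm {u v : ℕ → X} (h : SeqEquiv u v) : SeqEquiv v u := by
  intro o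
  refine (h o).congr fun i => ?_
  simp only [gromovProduct, dist_comm (u i), add_comm]

lemma ConvergesToInfinity.tendsto_inverted {u : ℕ → X} (h : ConvergesToInfinity u) (o : X) :
    Tendsto (fun p : ℕ × ℕ => inverted o (u p.1) (u p.2)) (atTop ×ˢ atTop) (𝓝 0) := by
  have := (tendsto_visual_iff ((h.tendsto_dist o).comp tendsto_fst)
    ((h.tendsto_dist o).comp tendsto_snd)).1 (tendsto_visual_zero_iff.2 (h o))
  simpa using this

lemma SeqEquiv.tendsto_inverted {u v : ℕ → X} (h : SeqEquiv u v) (hu : ConvergesToInfinity u)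
    (hv : ConvergesToInfinity v) (o : X) :
    Tendsto (fun i => inverted o (u i) (v i)) atTop (𝓝 0) := by
  have := (tendsto_visual_iff (hu.tendsto_dist o) (hv.tendsto_dist o)).1
    (tendsto_visual_zero_iff.2 (h o))
  simpa using this

lemma seqEquiv_of_tendsto_inverted {u v : ℕ → X} (hu : ConvergesToInfinity u)
    (hv : ConvergesToInfinity v) {o : X}
    (h : Tendsto (fun i => inverted o (u i) (v i)) atTop (𝓝 0)) : SeqEquiv u v := by
  refine fun o' => tendsto_gromovProduct_of_base (o := o) ?_ o'
  refine tendsto_visual_zero_iff.1 ((tendsto_visual_iff (hu.tendsto_dist o) (hv.tendsto_dist o)).2 ?_)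
  simpa using h

lemma SeqEquiv.trans (hX : IsStewartSpace X) {u v w : ℕ → X} (h : SeqEquiv u v) (h' : SeqEquiv v w)
    (hu : ConvergesToInfinity u) (hv : ConvergesToInfinity v) (hw : ConvergesToInfinity w) :
    SeqEquiv u w := by
  refine seqEquiv_of_tendsto_inverted hu hw (o := u 0) ?_
  have h0 := (h.tendsto_inverted hu hv (u 0)).add (h'.tendsto_inverted hv hw (u 0))
  rw [add_zero] at h0
  refine tendsto_of_tendsto_of_tendsto_of_le_of_le' tendsto_const_nhds h0
    (Eventually.of_forall fun i => inverted_nonneg _ _ _) ?_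
  filter_upwards [eventually_ne_of_tendsto (hu.tendsto_dist (u 0)),
    eventually_ne_of_tendsto (hv.tendsto_dist (u 0)),
    eventually_ne_of_tendsto (hw.tendsto_dist (u 0))] with i h1 h2 h3
  exact hX.inverted_triangle h1 h2 h3

/-- A metric is continuous in both arguments. Since `v` need not diverge, constant sequences are
allowed, as the construction of Busemann functions requires. -/
lemma IsStewartSpace.cauchySeq_inverted (hX : IsStewartSpace X) {u v : ℕ → X} {o : X}
    (hu : Tendsto (fun i => dist o (u i)) atTop atTop)
    (hv : ∀ᶠ i in atTop, o ≠ v i)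
    (hu' : Tendsto (fun p : ℕ × ℕ => inverted o (u p.1) (u p.2)) (atTop ×ˢ atTop) (𝓝 0))
    (hv' : Tendsto (fun p : ℕ × ℕ => inverted o (v p.1) (v p.2)) (atTop ×ˢ atTop) (𝓝 0)) :
    CauchySeq fun i => inverted o (u i) (v i) := by
  rw [cauchySeq_iff_tendsto_dist_atTop_0, ← prod_atTop_atTop_eq]
  have h0 := hu'.add hv'
  rw [add_zero] at h0
  have hu := eventually_ne_of_tendsto hu
  refine tendsto_of_tendsto_of_tendsto_of_le_of_le' tendsto_const_nhds h0
    (Eventually.of_forall fun i => dist_nonneg) ?_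
  filter_upwards [(hu.and hv).prod_mk (hu.and hv)] with p hp
  exact hX.abs_inverted_sub_le hp.1.1 hp.1.2 hp.2.1 hp.2.2

lemma IsStewartSpace.tendsto_inverted_of_equiv (hX : IsStewartSpace X) {u v u' v' : ℕ → X} {o : X}
    {r : ℝ} (hu : ∀ᶠ i in atTop, o ≠ u i) (hv : ∀ᶠ i in atTop, o ≠ v i)
    (hu' : ∀ᶠ i in atTop, o ≠ u' i) (hv' : ∀ᶠ i in atTop, o ≠ v' i)
    (huu : Tendsto (fun i => inverted o (u i) (u' i)) atTop (𝓝 0))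
    (hvv : Tendsto (fun i => inverted o (v i) (v' i)) atTop (𝓝 0))
    (h : Tendsto (fun i => inverted o (u i) (v i)) atTop (𝓝 r)) :
    Tendsto (fun i => inverted o (u' i) (v' i)) atTop (𝓝 r) := by
  have h0 := huu.add hvv
  rw [add_zero] at h0
  refine tendsto_of_tendsto_of_dist h ?_
  refine tendsto_of_tendsto_of_tendsto_of_le_of_le' tendsto_const_nhds h0
    (Eventually.of_forall fun i => dist_nonneg) ?_
  filter_upwards [hu, hv, hu', hv'] with i h1 h2 h3 h4
  exact hX.abs_inverted_sub_le h1 h2 h3 h4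

/-! ### Sequences representing boundary points -/

lemma Represents.conv {u : ℕ → X} {y : Boundary X} (h : Represents u y) : ConvergesToInfinity u := by
  obtain ⟨w, -, hw⟩ := y.2
  rw [Represents, hw] at h
  exact h.1

lemma exists_represents (y : Boundary X) : ∃ u, Represents u y := by
  obtain ⟨u, hu, hy⟩ := y.2
  refine ⟨u, ?_⟩
  rw [Represents, hy]
  exact ⟨hu, hu.seqEquiv_self⟩

lemma Represents.seqEquiv (hX : IsStewartSpace X) {u v : ℕ → X} {y : Boundary X}
    (hu : Represents u y) (hv : Represents v y) : SeqEquiv u v := by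
  obtain ⟨w, hw, hy⟩ := y.2
  rw [Represents, hy] at hu hv
  exact SeqEquiv.trans hX hu.2.symm hv.2 hu.1 hw hv.1

lemma Represents.of_seqEquiv (hX : IsStewartSpace X) {u v : ℕ → X} {y : Boundary X}
    (hu : Represents u y) (hv : ConvergesToInfinity v) (h : SeqEquiv u v) : Represents v y := by
  obtain ⟨w, hw, hy⟩ := y.2
  rw [Represents, hy] at hu ⊢
  exact ⟨hv, SeqEquiv.trans hX hu.2 h hw hu.1 hv⟩

lemma ConvergesToInfinity.exists_represents {u : ℕ → X} (h : ConvergesToInfinity u) :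
    ∃ y : Boundary X, Represents u y :=
  ⟨⟨_, u, h, rfl⟩, h, h.seqEquiv_self⟩

lemma Represents.eq_of_seqEquiv (hX : IsStewartSpace X) {u v : ℕ → X} {y y' : Boundary X}
    (hu : Represents u y) (hv : Represents v y') (h : SeqEquiv u v) : y = y' := by
  apply Subtype.ext
  ext w
  constructor
  · intro hw
    have hw' : Represents w y := hw
    exact hv.of_seqEquiv hX hw'.conv (h.symm.trans hX (hu.seqEquiv hX hw') hv.conv hu.conv hw'.conv)
  · intro hw
    have hw' : Represents w y' := hw
    exact hu.of_seqEquiv hX hw'.conv (h.trans hX (hv.seqEquiv hX hw') hu.conv hv.conv hw'.conv)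

/-- A sequence representing a boundary point. -/
noncomputable def rep (y : Boundary X) : ℕ → X := (exists_represents y).choose

lemma rep_spec (y : Boundary X) : Represents (rep y) y := (exists_represents y).choose_spec

/-- The limit of `exp (-(x | x')_o)` for `x → y`, `x' → y'`. -/
noncomputable def rho (o : X) (y y' : Boundary X) : ℝ :=
  limUnder atTop fun i => visual o (rep y i) (rep y' i)

/-- Existence of the limit is the Cauchy property of `inverted`; independence of the chosen
sequences holds because equivalent sequences have `inverted` distance tending to `0`. -/
lemma tendsto_rho (hX : IsStewartSpace X) {u v : ℕ → X} {y y' : Boundary X}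
    (hu : Represents u y) (hv : Represents v y') (o : X) :
    Tendsto (fun i => visual o (u i) (v i)) atTop (𝓝 (rho o y y')) := by
  have hc := (rep_spec y).conv
  have hc' := (rep_spec y').conv
  obtain ⟨r, hr⟩ := cauchySeq_tendsto_of_complete (hX.cauchySeq_inverted (hc.tendsto_dist o)
    (eventually_ne_of_tendsto (hc'.tendsto_dist o)) (hc.tendsto_inverted o)
    (hc'.tendsto_inverted o))
  obtain ⟨r, rfl⟩ : ∃ r', r = 2 * r' := ⟨r / 2, by ring⟩
  have h1 := (tendsto_visual_iff (hc.tendsto_dist o) (hc'.tendsto_dist o)).2 hr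
  rw [rho, h1.limUnder_eq, tendsto_visual_iff (hu.conv.tendsto_dist o) (hv.conv.tendsto_dist o)]
  refine hX.tendsto_inverted_of_equiv ?_ ?_ ?_ ?_
    (((rep_spec y).seqEquiv hX hu).tendsto_inverted hc hu.conv o)
    (((rep_spec y').seqEquiv hX hv).tendsto_inverted hc' hv.conv o) hr
  · exact eventually_ne_of_tendsto (hc.tendsto_dist o)
  · exact eventually_ne_of_tendsto (hc'.tendsto_dist o)
  · exact eventually_ne_of_tendsto (hu.conv.tendsto_dist o)
  · exact eventually_ne_of_tendsto (hv.conv.tendsto_dist o)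

lemma rho_comm (o : X) (y y' : Boundary X) : rho o y y' = rho o y' y := by
  simp only [rho, visual_comm]

lemma rho_nonneg (hX : IsStewartSpace X) (o : X) (y y' : Boundary X) : 0 ≤ rho o y y' :=
  ge_of_tendsto' (tendsto_rho hX (rep_spec y) (rep_spec y') o) fun _ => (visual_pos _ _ _).le

lemma rho_le_one (hX : IsStewartSpace X) (o : X) (y y' : Boundary X) : rho o y y' ≤ 1 :=
  le_of_tendsto' (tendsto_rho hX (rep_spec y) (rep_spec y') o) fun _ => visual_le_one _ _ _

lemma rho_eq_zero_iff (hX : IsStewartSpace X) (o : X) (y y' : Boundary X) :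
    rho o y y' = 0 ↔ y = y' := by
  have h := tendsto_rho hX (rep_spec y) (rep_spec y') o
  constructor
  · intro h0
    rw [h0] at h
    exact (rep_spec y).eq_of_seqEquiv hX (rep_spec y') fun o' =>
      tendsto_gromovProduct_of_base (tendsto_visual_zero_iff.1 h) o'
  · rintro rfl
    exact tendsto_nhds_unique h
      (tendsto_visual_zero_iff.2 ((rep_spec y).conv.seqEquiv_self o))

lemma rho_pos (hX : IsStewartSpace X) (o : X) {y y' : Boundary X} (h : y ≠ y') : 0 < rho o y y' :=
  (rho_nonneg hX o y y').lt_of_ne fun h0 => h ((rho_eq_zero_iff hX o y y').1 h0.symm)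

/-- Divide `IsStewartSpace.ptolemy` by one factor `sinh (|o x| / 2)` for each of the four points;
this denominator is common to the three products. -/
lemma rho_ptolemy (hX : IsStewartSpace X) (o : X) (y₁ y₂ y₃ y₄ : Boundary X) :
    rho o y₁ y₃ * rho o y₂ y₄ ≤ rho o y₁ y₂ * rho o y₃ y₄ + rho o y₂ y₃ * rho o y₄ y₁ := by
  have d := fun y : Boundary X => (rep_spec y).conv.tendsto_dist o
  have t := fun y y' : Boundary X =>
    (tendsto_visual_iff (d y) (d y')).1 (tendsto_rho hX (rep_spec y) (rep_spec y') o)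
  have h1 := (t y₁ y₃).mul (t y₂ y₄)
  have h2 := ((t y₁ y₂).mul (t y₃ y₄)).add ((t y₂ y₃).mul (t y₄ y₁))
  have h3 := le_of_tendsto_of_tendsto h1 h2 ?_
  · linarith
  have e := fun y : Boundary X => eventually_ne_of_tendsto (d y)
  filter_upwards [e y₁, e y₂, e y₃, e y₄] with i n1 n2 n3 n4
  have p1 := sinh_half_dist_pos n1
  have p2 := sinh_half_dist_pos n2
  have p3 := sinh_half_dist_pos n3
  have p4 := sinh_half_dist_pos n4
  have pt := hX.ptolemy (rep y₁ i) (rep y₂ i) (rep y₃ i) (rep y₄ i)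
  simp only [inverted]
  rw [div_mul_div_comm, div_mul_div_comm, div_mul_div_comm]
  set a := Real.sinh (dist o (rep y₁ i) / 2)
  set b := Real.sinh (dist o (rep y₂ i) / 2)
  set c := Real.sinh (dist o (rep y₃ i) / 2)
  set d := Real.sinh (dist o (rep y₄ i) / 2)
  rw [show a * c * (b * d) = a * b * c * d by ring, show a * b * (c * d) = a * b * c * d by ring,
    show b * c * (d * a) = a * b * c * d by ring, ← add_div]
  gcongr

/-! ### Busemann functions -/

/-- The Busemann function of `y` that vanishes at `o`. -/
noncomputable def bus (o : X) (y : Boundary X) (x : X) : ℝ :=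
  limUnder atTop fun i => dist x (rep y i) - dist o (rep y i)

/-- As `u` goes to infinity the last two factors tend to `1`, so Busemann functions exist because
`inverted o u x` converges. -/
lemma exp_half_sub_eq {o x u : X} (hx : x ≠ o) (hu : o ≠ u) (hu' : x ≠ u) :
    Real.exp ((dist x u - dist o u) / 2) = inverted o u x * Real.sinh (dist o x / 2) *
      (1 - Real.exp (-dist o u)) / (1 - Real.exp (-dist x u)) := by
  have p := sinh_half_dist_pos hx.symm
  have p' := sinh_half_dist_pos hu
  have p'' := sinh_half_dist_pos hu'
  have e1 := two_mul_sinh_half (dist o u)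
  have e2 := two_mul_sinh_half (dist x u)
  have n1 : 1 - Real.exp (-dist o u) = 2 * Real.sinh (dist o u / 2) / Real.exp (dist o u / 2) := by
    rw [e1]; field_simp
  have n2 : 1 - Real.exp (-dist x u) = 2 * Real.sinh (dist x u / 2) / Real.exp (dist x u / 2) := by
    rw [e2]; field_simp
  rw [n1, n2, inverted, sub_div, Real.exp_sub, dist_comm u x]
  field_simp

lemma exists_tendsto_bus (hX : IsStewartSpace X) {o x : X} (hx : x ≠ o) (y : Boundary X) :
    ∃ r, ∀ u, Represents u y → Tendsto (fun i => dist x (u i) - dist o (u i)) atTop (𝓝 r) := by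
  have hc := (rep_spec y).conv
  have hne : ∀ᶠ _ : ℕ in atTop, o ≠ x := Eventually.of_forall fun _ => hx.symm
  have hxx : inverted o x x = 0 := by simp [inverted]
  obtain ⟨r, hr⟩ := cauchySeq_tendsto_of_complete (hX.cauchySeq_inverted (hc.tendsto_dist o) hne
    (hc.tendsto_inverted o) (by simp [hxx]))
  have p := sinh_half_dist_pos hx.symm
  have key : ∀ u, Represents u y → Tendsto (fun i => Real.exp ((dist x (u i) - dist o (u i)) / 2))
      atTop (𝓝 (r * Real.sinh (dist o x / 2))) := by
    intro u hu
    have h1 := hX.tendsto_inverted_of_equiv (eventually_ne_of_tendsto (hc.tendsto_dist o)) hne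
      (eventually_ne_of_tendsto (hu.conv.tendsto_dist o)) hne
      (((rep_spec y).seqEquiv hX hu).tendsto_inverted hc hu.conv o) (by simp [hxx]) hr
    have h2 := ((h1.mul_const (Real.sinh (dist o x / 2))).mul
      (tendsto_one_sub_exp_neg (hu.conv.tendsto_dist o))).div
      (tendsto_one_sub_exp_neg (hu.conv.tendsto_dist x)) one_ne_zero
    rw [mul_one, div_one] at h2
    refine h2.congr' ?_
    filter_upwards [eventually_ne_of_tendsto (hu.conv.tendsto_dist o),
      eventually_ne_of_tendsto (hu.conv.tendsto_dist x)] with i i1 i2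
    exact (exp_half_sub_eq hx i1 i2).symm
  -- The triangle inequality keeps the limit away from `0`, so that its logarithm can be taken.
  have hpos : 0 < r * Real.sinh (dist o x / 2) := by
    refine (Real.exp_pos (-(dist o x / 2))).trans_le (ge_of_tendsto' (key _ (rep_spec y)) fun i => ?_)
    rw [Real.exp_le_exp]
    linarith [dist_triangle o x (rep y i)]
  refine ⟨2 * Real.log (r * Real.sinh (dist o x / 2)), fun u hu => ?_⟩
  have := ((Real.continuousAt_log hpos.ne').tendsto.comp (key u hu)).const_mul 2
  refine this.congr fun i => ?_
  simp only [Function.comp, Real.log_exp]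
  ring

lemma tendsto_bus (hX : IsStewartSpace X) {u : ℕ → X} {y : Boundary X} (hu : Represents u y)
    (o x : X) : Tendsto (fun i => dist x (u i) - dist o (u i)) atTop (𝓝 (bus o y x)) := by
  rcases eq_or_ne x o with rfl | hx
  · have h : bus x y x = 0 := by
      simp only [bus, sub_self]
      exact tendsto_const_nhds.limUnder_eq
    simp [h]
  · obtain ⟨r, hr⟩ := exists_tendsto_bus hX hx y
    rw [bus, (hr _ (rep_spec y)).limUnder_eq]
    exact hr u hu

/-- A change of base point is conformal: the factor is a product of a function of `y` and a function
of `y'`. -/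
lemma rho_eq_mul_exp (hX : IsStewartSpace X) (o x : X) (y y' : Boundary X) :
    rho x y y' = rho o y y' * Real.exp (-((bus o y x + bus o y' x) / 2)) := by
  have hu := rep_spec y
  have hv := rep_spec y'
  refine tendsto_nhds_unique (tendsto_rho hX hu hv x) ?_
  have h1 := (((tendsto_bus hX hu o x).add (tendsto_bus hX hv o x)).div_const 2).neg
  refine ((tendsto_rho hX hu hv o).mul ((Real.continuous_exp.tendsto _).comp h1)).congr fun i => ?_
  simp only [visual, gromovProduct, Function.comp, ← Real.exp_add]
  congr 1
  ring

lemma bus_sub_le (hX : IsStewartSpace X) (o x x' : X) (y : Boundary X) :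
    bus o y x - bus o y x' ≤ dist x x' := by
  refine le_of_tendsto' ((tendsto_bus hX (rep_spec y) o x).sub (tendsto_bus hX (rep_spec y) o x'))
    fun i => ?_
  linarith [dist_triangle x x' (rep y i)]

lemma tendsto_cosh_div_cosh {ι : Type*} {l : Filter ι} {f g : ι → ℝ} {r : ℝ}
    (hf : Tendsto f l atTop) (hg : Tendsto g l atTop) (h : Tendsto (fun i => f i - g i) l (𝓝 r)) :
    Tendsto (fun i => Real.cosh (f i) / Real.cosh (g i)) l (𝓝 (Real.exp r)) := by
  have aux : ∀ {φ : ι → ℝ}, Tendsto φ l atTop →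
      Tendsto (fun i => 1 + Real.exp (-(2 * φ i))) l (𝓝 1) := by
    intro φ hφ
    have := (Real.tendsto_exp_neg_atTop_nhds_zero.comp
      (hφ.const_mul_atTop (zero_lt_two' ℝ))).const_add 1
    simpa using this
  have := (((Real.continuous_exp.tendsto _).comp h).mul (aux hf)).div (aux hg) one_ne_zero
  rw [mul_one, div_one] at this
  refine this.congr fun i => ?_
  have e : ∀ t : ℝ, Real.cosh t = Real.exp t * (1 + Real.exp (-(2 * t))) / 2 := by
    intro t
    rw [Real.cosh_eq, mul_add, ← Real.exp_add, mul_one, show t + -(2 * t) = -t by ring]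
  simp only [Function.comp, Pi.div_apply, e, Real.exp_sub]
  have : (0 : ℝ) < 1 + Real.exp (-(2 * g i)) := by positivity
  field_simp

/-- The Stewart inequality with one vertex at infinity. -/
lemma stewart_bus (hX : IsStewartSpace X) {a x b : X} (h : Between a x b) (o : X)
    (y : Boundary X) :
    Real.sinh (dist a b) * Real.exp (bus o y x) ≤
      Real.sinh (dist x b) * Real.exp (bus o y a) + Real.sinh (dist a x) * Real.exp (bus o y b) := by
  have hu := rep_spec y
  have t := fun z => tendsto_cosh_div_cosh (hu.conv.tendsto_dist z) (hu.conv.tendsto_dist o)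
    (tendsto_bus hX hu o z)
  refine le_of_tendsto_of_tendsto' ((t x).const_mul _) (((t a).const_mul _).add ((t b).const_mul _))
    fun i => ?_
  have := hX.stewart a x b h (rep y i)
  have hp := Real.cosh_pos (dist o (rep y i))
  rw [dist_comm x (rep y i), dist_comm a (rep y i), dist_comm b (rep y i), ← mul_div_assoc,
    ← mul_div_assoc, ← mul_div_assoc, ← add_div]
  gcongr

end GromovProducts

/-! ### Geodesic rays -/

section Rays

variable {X : Type*} [MetricSpace X]

/-- By the law of cosines, `cosh |p q| - cosh (|o p| - |o q|)` is `sinh |o p| * sinh |o q|` times `1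
- cos` of the comparison angle at `o`. The lemma is monotonicity of this angle, by two applications
of Stewart: to `p` on `o u` seen from `q`, and to `q` on `o v` seen from `u`. -/
lemma IsStewartSpace.cosh_dist_sub_le (hX : IsStewartSpace X) {o u v p q : X}
    (hp : Between o p u) (hq : Between o q v) :
    Real.sinh (dist o u) * Real.sinh (dist o v) *
        (Real.cosh (dist p q) - Real.cosh (dist o p - dist o q)) ≤
      Real.sinh (dist o p) * Real.sinh (dist o q) *
        (Real.cosh (dist u v) - Real.cosh (dist o u - dist o v)) := by
  have h1 := hX.stewart _ _ _ hp q
  have h2 := hX.stewart _ _ _ hq u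
  have e1 : dist p u = dist o u - dist o p := by unfold Between at hp; linarith
  have e2 : dist q v = dist o v - dist o q := by unfold Between at hq; linarith
  rw [e1, dist_comm q p, dist_comm q o, dist_comm q u] at h1
  rw [e2, dist_comm u o] at h2
  rw [Real.sinh_sub] at h1 h2
  rw [Real.cosh_sub, Real.cosh_sub]
  have n1 : 0 ≤ Real.sinh (dist o v) := Real.sinh_nonneg_iff.2 dist_nonneg
  have n2 : 0 ≤ Real.sinh (dist o p) := Real.sinh_nonneg_iff.2 dist_nonneg
  have h3 := mul_le_mul_of_nonneg_left h1 n1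
  have h4 := mul_le_mul_of_nonneg_left h2 n2
  linarith

lemma IsStewartSpace.cosh_dist_sub_le_inverted (hX : IsStewartSpace X) {o u v p q : X}
    (hu : o ≠ u) (hv : o ≠ v) (hp : Between o p u) (hq : Between o q v) :
    Real.cosh (dist p q) - Real.cosh (dist o p - dist o q) ≤
      Real.sinh (dist o p) * Real.sinh (dist o q) * (inverted o u v ^ 2 / 2) := by
  have h := hX.cosh_dist_sub_le hp hq
  have pu := sinh_half_dist_pos hu
  have pv := sinh_half_dist_pos hv
  have su : Real.sinh (dist o u) = 2 * Real.sinh (dist o u / 2) * Real.cosh (dist o u / 2) := by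
    rw [← Real.sinh_two_mul]; congr 1; ring
  have sv : Real.sinh (dist o v) = 2 * Real.sinh (dist o v / 2) * Real.cosh (dist o v / 2) := by
    rw [← Real.sinh_two_mul]; congr 1; ring
  have cu := (Real.sinh_lt_cosh (dist o u / 2)).le
  have cv := (Real.sinh_lt_cosh (dist o v / 2)).le
  have hpos : 0 < Real.sinh (dist o u) * Real.sinh (dist o v) :=
    mul_pos (Real.sinh_pos_iff.2 (dist_pos.2 hu)) (Real.sinh_pos_iff.2 (dist_pos.2 hv))
  refine le_of_mul_le_mul_left (h.trans ?_) hpos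
  have n1 : 0 ≤ Real.sinh (dist o p) * Real.sinh (dist o q) :=
    mul_nonneg (Real.sinh_nonneg_iff.2 dist_nonneg) (Real.sinh_nonneg_iff.2 dist_nonneg)
  rw [mul_left_comm]
  refine mul_le_mul_of_nonneg_left ?_ n1
  have c1 := Real.one_le_cosh (dist o u - dist o v)
  rw [cosh_eq_one_add (dist u v), su, sv, inverted, div_pow]
  have key : 2 * Real.sinh (dist u v / 2) ^ 2 ≤
      2 * Real.sinh (dist o u / 2) * Real.cosh (dist o u / 2) *
        (2 * Real.sinh (dist o v / 2) * Real.cosh (dist o v / 2)) *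
        (Real.sinh (dist u v / 2) ^ 2 /
          (Real.sinh (dist o u / 2) * Real.sinh (dist o v / 2)) ^ 2 / 2) := by
    have : 2 * Real.sinh (dist o u / 2) * Real.cosh (dist o u / 2) *
        (2 * Real.sinh (dist o v / 2) * Real.cosh (dist o v / 2)) *
        (Real.sinh (dist u v / 2) ^ 2 /
          (Real.sinh (dist o u / 2) * Real.sinh (dist o v / 2)) ^ 2 / 2) =
        2 * Real.sinh (dist u v / 2) ^ 2 * ((Real.cosh (dist o u / 2) / Real.sinh (dist o u / 2)) *
          (Real.cosh (dist o v / 2) / Real.sinh (dist o v / 2))) := by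
      field_simp
    rw [this]
    refine le_mul_of_one_le_right (by positivity) ?_
    have a1 : 1 ≤ Real.cosh (dist o u / 2) / Real.sinh (dist o u / 2) := by rwa [one_le_div pu]
    have a2 : 1 ≤ Real.cosh (dist o v / 2) / Real.sinh (dist o v / 2) := by rwa [one_le_div pv]
    nlinarith
  linarith

lemma sq_le_two_mul_cosh_sub_one {t : ℝ} (ht : 0 ≤ t) : t ^ 2 ≤ 2 * (Real.cosh t - 1) := by
  have h := Real.self_le_sinh_iff.2 (show 0 ≤ t / 2 by positivity)
  rw [cosh_eq_one_add t]
  have : (t / 2) ^ 2 ≤ Real.sinh (t / 2) ^ 2 := by gcongr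
  linarith

lemma tendsto_zero_of_cosh {ι : Type*} {l : Filter ι} {f : ι → ℝ} (hf : ∀ i, 0 ≤ f i)
    (h : Tendsto (fun i => Real.cosh (f i)) l (𝓝 1)) : Tendsto f l (𝓝 0) := by
  have h1 := ((h.sub_const 1).const_mul 2).sqrt
  rw [sub_self, mul_zero, Real.sqrt_zero] at h1
  exact squeeze_zero hf (fun i => Real.le_sqrt_of_sq_le (sq_le_two_mul_cosh_sub_one (hf i))) h1

/-- `c`, restricted to `[0, ∞)`, is a geodesic ray. -/
def IsRay (c : ℝ → X) : Prop := ∀ s t : ℝ, 0 ≤ s → 0 ≤ t → dist (c s) (c t) = |s - t|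

lemma IsRay.gromovProduct {c : ℝ → X} (hc : IsRay c) {s t : ℝ} (hs : 0 ≤ s) (ht : 0 ≤ t) :
    gromovProduct (c 0) (c s) (c t) = min s t := by
  rw [BoundaryPtolemy.gromovProduct, hc 0 s le_rfl hs, hc 0 t le_rfl ht, hc s t hs ht, zero_sub,
    zero_sub, abs_neg, abs_neg, abs_of_nonneg hs, abs_of_nonneg ht]
  rcases le_total s t with h | h
  · rw [min_eq_left h, abs_of_nonpos (by linarith)]; ring
  · rw [min_eq_right h, abs_of_nonneg (by linarith)]; ring

lemma IsRay.tendsto_gromovProduct {c : ℝ → X} (hc : IsRay c) {ι : Type*} {l : Filter ι}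
    {f g : ι → ℝ} (hf : Tendsto f l atTop) (hg : Tendsto g l atTop) (o : X) :
    Tendsto (fun i => BoundaryPtolemy.gromovProduct o (c (f i)) (c (g i))) l atTop := by
  refine tendsto_gromovProduct_of_base (o := c 0) ?_ o
  have hmin : Tendsto (fun i => min (f i) (g i)) l atTop := by
    rw [tendsto_atTop] at *
    intro b
    filter_upwards [hf b, hg b] with i h1 h2 using le_min h1 h2
  refine hmin.congr' ?_
  filter_upwards [hf.eventually_ge_atTop 0, hg.eventually_ge_atTop 0] with i h1 h2
  exact (hc.gromovProduct h1 h2).symm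

lemma IsRay.conv {c : ℝ → X} (hc : IsRay c) {τ : ℕ → ℝ} (hτ : Tendsto τ atTop atTop) :
    ConvergesToInfinity fun n => c (τ n) := fun o =>
  hc.tendsto_gromovProduct (hτ.comp tendsto_fst) (hτ.comp tendsto_snd) o

lemma IsRay.seqEquiv {c : ℝ → X} (hc : IsRay c) {τ τ' : ℕ → ℝ} (hτ : Tendsto τ atTop atTop)
    (hτ' : Tendsto τ' atTop atTop) : SeqEquiv (fun n => c (τ n)) fun n => c (τ' n) := fun o =>
  hc.tendsto_gromovProduct hτ hτ' o

lemma IsRayTo.isRay {o : X} {y : Boundary X} {c : ℝ → X} (hc : IsRayTo o y c) : IsRay c := hc.2.1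

lemma IsRayTo.represents (hX : IsStewartSpace X) {o : X} {y : Boundary X} {c : ℝ → X}
    (hc : IsRayTo o y c) {τ : ℕ → ℝ} (hτ : Tendsto τ atTop atTop) :
    Represents (fun n => c (τ n)) y :=
  Represents.of_seqEquiv hX hc.2.2 (hc.isRay.conv hτ)
    (hc.isRay.seqEquiv tendsto_natCast_atTop_atTop hτ)

/-- The segments from `o` to `u n` converge pointwise by `IsStewartSpace.cosh_dist_sub_le_inverted`,
since `inverted o (u m) (u n)` tends to `0`. -/
lemma exists_limit_ray (hX : IsStewartSpace X) (o : X) {u : ℕ → X} (hu : ConvergesToInfinity u) :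
    ∃ c : ℝ → X, c 0 = o ∧ IsRay c ∧ SeqEquiv u fun n : ℕ => c n := by
  have := hX.complete
  have hd := hu.tendsto_dist o
  have hI := hu.tendsto_inverted o
  have hne := eventually_ne_of_tendsto hd
  choose g g0 g1 hg using fun n => hX.geodesic o (u n)
  have hgd : ∀ {n : ℕ} {t : ℝ}, 0 ≤ t → t ≤ dist o (u n) → dist o (g n t) = t := by
    intro n t h0 h1
    have := hg n 0 ⟨le_rfl, dist_nonneg⟩ t ⟨h0, h1⟩
    rw [g0] at this
    rw [this, zero_sub, abs_neg, abs_of_nonneg h0]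
  have hgb : ∀ {n : ℕ} {t : ℝ}, 0 ≤ t → t ≤ dist o (u n) → Between o (g n t) (u n) := by
    intro n t h0 h1
    have := hg n t ⟨h0, h1⟩ (dist o (u n)) ⟨dist_nonneg, le_rfl⟩
    rw [g1, abs_sub_comm, abs_of_nonneg (by linarith)] at this
    rw [Between, hgd h0 h1, this]
    ring
  have hcauchy : ∀ t : ℝ, ∃ x, 0 ≤ t → Tendsto (fun n => g n t) atTop (𝓝 x) := by
    intro t
    rcases lt_or_ge t 0 with ht | ht
    · exact ⟨o, fun h => absurd h (not_le.2 ht)⟩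
    have hc : CauchySeq fun n => g n t := by
      rw [cauchySeq_iff_tendsto_dist_atTop_0, ← prod_atTop_atTop_eq]
      refine tendsto_zero_of_cosh (fun _ => dist_nonneg) ?_
      have h2 := (((hI.pow 2).div_const 2).const_mul (Real.sinh t * Real.sinh t)).const_add 1
      norm_num at h2
      refine tendsto_of_tendsto_of_tendsto_of_le_of_le' tendsto_const_nhds h2
        (Eventually.of_forall fun i => Real.one_le_cosh _) ?_
      filter_upwards [(hne.and (hd.eventually_ge_atTop t)).prod_mk
        (hne.and (hd.eventually_ge_atTop t))] with p hp
      have h3 := hX.cosh_dist_sub_le_inverted hp.1.1 hp.2.1 (hgb ht hp.1.2) (hgb ht hp.2.2)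
      rw [hgd ht hp.1.2, hgd ht hp.2.2, sub_self, Real.cosh_zero] at h3
      linarith
    obtain ⟨x, hx⟩ := cauchySeq_tendsto_of_complete hc
    exact ⟨x, fun _ => hx⟩
  choose c hc using hcauchy
  have hray : IsRay c := by
    intro s t hs ht
    refine tendsto_nhds_unique ((hc s hs).dist (hc t ht)) ?_
    refine tendsto_const_nhds.congr' ?_
    filter_upwards [hd.eventually_ge_atTop s, hd.eventually_ge_atTop t] with n h1 h2
    exact (hg n s ⟨hs, h1⟩ t ⟨ht, h2⟩).symm
  have hc0 : c 0 = o := tendsto_nhds_unique (hc 0 le_rfl) (by simp [g0])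
  refine ⟨c, hc0, hray, ?_⟩
  have hnat : Tendsto (fun n : ℕ => (n : ℝ)) atTop atTop := tendsto_natCast_atTop_atTop
  -- To see that the ray is equivalent to `u`, compare `u n` with the point at distance `n` on the
  -- segment to `u m`, and let `m` tend to infinity first.
  have hbound : ∀ ε > 0, ∀ᶠ n : ℕ in atTop, Real.cosh (dist (u n) (c n)) -
      Real.cosh (dist o (u n) - n) ≤ Real.sinh (dist o (u n)) * Real.sinh n * (ε / 2) := by
    intro ε hε
    have hlt : ∀ᶠ p in atTop ×ˢ atTop, inverted o (u p.1) (u p.2) ^ 2 < ε := by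
      have := hI.pow 2
      norm_num at this
      exact this.eventually (gt_mem_nhds hε)
    filter_upwards [hlt.curry, hne] with n hn hne'
    have hn0 : (0 : ℝ) ≤ n := Nat.cast_nonneg n
    have hlim : Tendsto (fun m => Real.cosh (dist (u n) (g m n)) - Real.cosh (dist o (u n) - n)) atTop
        (𝓝 (Real.cosh (dist (u n) (c n)) - Real.cosh (dist o (u n) - n))) :=
      ((Real.continuous_cosh.tendsto _).comp (tendsto_const_nhds.dist (hc n hn0))).sub_const _
    refine le_of_tendsto hlim ?_
    filter_upwards [hn, hne, hd.eventually_ge_atTop (n : ℝ)] with m h1 h2 h3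
    have h4 := hX.cosh_dist_sub_le_inverted hne' h2 (show Between o (u n) (u n) by simp [Between])
      (hgb hn0 h3)
    rw [hgd hn0 h3] at h4
    refine h4.trans (mul_le_mul_of_nonneg_left (by linarith) ?_)
    exact mul_nonneg (Real.sinh_nonneg_iff.2 dist_nonneg) (Real.sinh_nonneg_iff.2 hn0)
  intro o'
  refine tendsto_gromovProduct_of_base (o := o) (tendsto_visual_zero_iff.1 ?_) o'
  have hsq : Tendsto (fun n : ℕ => visual o (u n) (c n) ^ 2) atTop (𝓝 0) := by
    rw [Metric.tendsto_nhds]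
    intro ε hε
    have e1 := (Real.tendsto_exp_neg_atTop_nhds_zero.comp
      (hnat.const_mul_atTop (zero_lt_two' ℝ))).eventually
        (gt_mem_nhds (show (0 : ℝ) < ε / 4 by positivity))
    have e2 := (Real.tendsto_exp_neg_atTop_nhds_zero.comp
      (hd.const_mul_atTop (zero_lt_two' ℝ))).eventually
        (gt_mem_nhds (show (0 : ℝ) < ε / 4 by positivity))
    filter_upwards [hbound ε hε, e1, e2] with n h1 h2 h3
    simp only [Function.comp] at h2 h3
    have hn0 : (0 : ℝ) ≤ n := Nat.cast_nonneg n
    have hon : dist o (c n) = n := by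
      rw [← hc0, hray 0 n le_rfl hn0, zero_sub, abs_neg, abs_of_nonneg hn0]
    rw [Real.dist_0_eq_abs, abs_of_nonneg (by positivity)]
    set a := dist o (u n)
    set d := dist (u n) (c n)
    have v1 : visual o (u n) (c n) ^ 2 = Real.exp d * Real.exp (-(a + n)) := by
      rw [visual, gromovProduct, hon, ← Real.exp_nat_mul, ← Real.exp_add]
      congr 1
      push_cast
      ring
    have v2 : Real.exp d ≤ 2 * Real.cosh d := by
      rw [Real.cosh_eq]; linarith [Real.exp_pos (-d)]
    have v3 : 2 * Real.cosh (a - n) * Real.exp (-(a + n)) =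
        Real.exp (-(2 * n)) + Real.exp (-(2 * a)) := by
      rw [Real.cosh_eq, mul_div_cancel₀ _ two_ne_zero, add_mul, ← Real.exp_add, ← Real.exp_add]
      congr 2 <;> ring
    have v4 : 2 * (Real.sinh a * Real.sinh n) * Real.exp (-(a + n)) ≤ 1 / 2 := by
      have s1 : Real.sinh a ≤ Real.exp a / 2 := by
        rw [Real.sinh_eq]; linarith [Real.exp_pos (-a)]
      have s2 : Real.sinh (n : ℝ) ≤ Real.exp n / 2 := by
        rw [Real.sinh_eq]; linarith [Real.exp_pos (-(n : ℝ))]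
      have s3 : Real.sinh a * Real.sinh (n : ℝ) ≤ Real.exp a / 2 * (Real.exp n / 2) :=
        mul_le_mul s1 s2 (Real.sinh_nonneg_iff.2 hn0) (by positivity)
      have s4 : Real.exp a * Real.exp n * Real.exp (-(a + n)) = 1 := by
        rw [← Real.exp_add, ← Real.exp_add]; simp
      have := mul_le_mul_of_nonneg_right s3 (Real.exp_pos (-(a + n))).le
      linarith
    have hE := Real.exp_pos (-(a + n))
    calc visual o (u n) (c n) ^ 2 = Real.exp d * Real.exp (-(a + n)) := v1
      _ ≤ 2 * (Real.cosh (a - n) + Real.sinh a * Real.sinh n * (ε / 2)) * Real.exp (-(a + n)) := by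
        gcongr
        linarith
      _ = 2 * Real.cosh (a - n) * Real.exp (-(a + n)) +
          (2 * (Real.sinh a * Real.sinh n) * Real.exp (-(a + n))) * (ε / 2) := by ring
      _ ≤ (Real.exp (-(2 * n)) + Real.exp (-(2 * a))) + 1 / 2 * (ε / 2) := by
        rw [v3]
        gcongr
      _ < ε := by linarith
  have := hsq.sqrt
  rw [Real.sqrt_zero] at this
  exact this.congr fun n => Real.sqrt_sq (visual_pos _ _ _).le

lemma exists_isRayTo (hX : IsStewartSpace X) (o : X) (y : Boundary X) : ∃ c, IsRayTo o y c := by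
  obtain ⟨u, hu⟩ := exists_represents y
  obtain ⟨c, h0, hc, h⟩ := exists_limit_ray hX o hu.conv
  exact ⟨c, h0, hc, hu.of_seqEquiv hX (hc.conv tendsto_natCast_atTop_atTop) h⟩

lemma ray_spec (hX : IsStewartSpace X) (o : X) (y : Boundary X) : IsRayTo o y (ray o y) :=
  Classical.epsilon_spec (exists_isRayTo hX o y)

lemma IsRayTo.dist_eq {o : X} {y : Boundary X} {c : ℝ → X} (hc : IsRayTo o y c) {t : ℝ}
    (ht : 0 ≤ t) : dist o (c t) = t := by
  have := hc.2.1 0 t le_rfl ht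
  rwa [hc.1, zero_sub, abs_neg, abs_of_nonneg ht] at this

lemma IsRayTo.tendsto_rho (hX : IsStewartSpace X) {o p : X} {y y' : Boundary X} {c c' : ℝ → X}
    (hc : IsRayTo o y c) (hc' : IsRayTo p y' c') (x : X) :
    Tendsto (fun t : ℝ => visual x (c t) (c' t)) atTop (𝓝 (rho x y y')) :=
  tendsto_of_seq_tendsto fun _ hτ =>
    BoundaryPtolemy.tendsto_rho hX (hc.represents hX hτ) (hc'.represents hX hτ) x

lemma IsRayTo.tendsto_bus (hX : IsStewartSpace X) {p : X} {y : Boundary X} {c : ℝ → X}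
    (hc : IsRayTo p y c) (o x : X) :
    Tendsto (fun t : ℝ => dist x (c t) - dist o (c t)) atTop (𝓝 (bus o y x)) :=
  tendsto_of_seq_tendsto fun _ hτ => BoundaryPtolemy.tendsto_bus hX (hc.represents hX hτ) o x

/-- The comparison angles determine `rho`, because `sin (θ / 2) = sinh (d / 2) / sinh t`. -/
lemma IsRayTo.tendsto_sinh_div_sinh (hX : IsStewartSpace X) {o : X} {y y' : Boundary X}
    {c c' : ℝ → X} (hc : IsRayTo o y c) (hc' : IsRayTo o y' c') :
    Tendsto (fun t : ℝ => Real.sinh (dist (c t) (c' t) / 2) / Real.sinh t) atTop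
      (𝓝 (rho o y y')) := by
  have h1 := hc.tendsto_rho hX hc' o
  have h2 : Tendsto (fun t : ℝ => Real.exp (-(2 * t))) atTop (𝓝 0) :=
    Real.tendsto_exp_neg_atTop_nhds_zero.comp (tendsto_id.const_mul_atTop (zero_lt_two' ℝ))
  have h3 : Tendsto (fun t : ℝ => Real.exp (-t) * Real.exp (-(dist (c t) (c' t) / 2))) atTop
      (𝓝 0) := by
    refine squeeze_zero (fun t => by positivity) (fun t => ?_) Real.tendsto_exp_neg_atTop_nhds_zero
    refine mul_le_of_le_one_right (Real.exp_pos _).le (Real.exp_le_one_iff.2 ?_)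
    linarith [@dist_nonneg _ _ (c t) (c' t)]
  have h4 := (h1.sub h3).div (h2.const_sub 1) (by norm_num)
  rw [sub_zero, sub_zero, div_one] at h4
  refine h4.congr' ?_
  filter_upwards [eventually_gt_atTop 0] with t ht
  have e1 : visual o (c t) (c' t) = Real.exp (dist (c t) (c' t) / 2) * Real.exp (-t) := by
    rw [visual, gromovProduct, hc.dist_eq ht.le, hc'.dist_eq ht.le, ← Real.exp_add]
    congr 1
    ring
  have e2 : 1 - Real.exp (-(2 * t)) = 2 * Real.sinh t * Real.exp (-t) := by
    rw [Real.sinh_eq, mul_div_cancel₀ _ two_ne_zero, sub_mul, ← Real.exp_add, ← Real.exp_add]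
    congr 2
    · simp
    · ring
  have hs := Real.sinh_pos_iff.2 ht
  rw [Pi.div_apply, e1, e2, Real.sinh_eq (dist (c t) (c' t) / 2)]
  field_simp

lemma sin_half_arccos {r : ℝ} (h0 : 0 ≤ r) (h1 : r ≤ 1) :
    Real.sin (Real.arccos (1 - 2 * r ^ 2) / 2) = r := by
  have hr : r ^ 2 ≤ 1 := pow_le_one₀ h0 h1
  have hc : Real.cos (Real.arccos (1 - 2 * r ^ 2)) = 1 - 2 * r ^ 2 :=
    Real.cos_arccos (by linarith) (by nlinarith)
  have hcos := Real.cos_two_mul (Real.arccos (1 - 2 * r ^ 2) / 2)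
  rw [mul_div_cancel₀ _ two_ne_zero, hc] at hcos
  have hsq := Real.sin_sq_add_cos_sq (Real.arccos (1 - 2 * r ^ 2) / 2)
  have hn : 0 ≤ Real.sin (Real.arccos (1 - 2 * r ^ 2) / 2) := by
    apply Real.sin_nonneg_of_nonneg_of_le_pi
    · linarith [Real.arccos_nonneg (1 - 2 * r ^ 2)]
    · linarith [Real.arccos_le_pi (1 - 2 * r ^ 2), Real.pi_pos]
  exact (sq_eq_sq₀ hn h0).1 (by linarith)

lemma bourdon_eq_rho (hX : IsStewartSpace X) (o : X) (y y' : Boundary X) :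
    bourdon o y y' = rho o y y' := by
  have h := (ray_spec hX o y).tendsto_sinh_div_sinh hX (ray_spec hX o y')
  have h1 : Tendsto (fun t : ℝ => comparisonAngle t t (dist (ray o y t) (ray o y' t))) atTop
      (𝓝 (Real.arccos (1 - 2 * rho o y y' ^ 2))) := by
    have h2 := ((h.pow 2).const_mul 2).const_sub 1
    refine ((Real.continuous_arccos.tendsto _).comp h2).congr' ?_
    filter_upwards [eventually_gt_atTop 0] with t ht
    have hs := Real.sinh_pos_iff.2 ht
    simp only [Function.comp, comparisonAngle]
    congr 1
    rw [cosh_eq_one_add (dist _ _), ← sq, ← sq, Real.cosh_sq t]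
    field_simp
    ring
  rw [bourdon, asymptoticAngle, h1.limUnder_eq,
    sin_half_arccos (rho_nonneg hX _ _ _) (rho_le_one hX _ _ _)]

lemma ConvergesToInfinity.comp {u : ℕ → X} (hu : ConvergesToInfinity u) {j : ℕ → ℕ}
    (hj : Tendsto j atTop atTop) : ConvergesToInfinity (u ∘ j) := fun o =>
  (hu o).comp (hj.prodMap hj)

lemma Represents.comp (hX : IsStewartSpace X) {u : ℕ → X} {y : Boundary X} (hu : Represents u y)
    {j : ℕ → ℕ} (hj : Tendsto j atTop atTop) : Represents (u ∘ j) y :=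
  hu.of_seqEquiv hX (hu.conv.comp hj) fun o => (hu.conv o).comp (tendsto_id.prodMk hj)

/-- A diagonal argument: for fixed `i` the limit over the second sequence is the Busemann
expression. An index `j i ≥ i` with error below `1 / (i + 1)` turns the iterated limit into the one
that defines `rho`. -/
lemma tendsto_exp_bus_sub_dist (hX : IsStewartSpace X) {u : ℕ → X} {y ω : Boundary X}
    (hu : Represents u y) (o : X) :
    Tendsto (fun i => Real.exp ((bus o ω (u i) - dist o (u i)) / 2)) atTop (𝓝 (rho o y ω)) := by
  have hw := rep_spec ω
  have h1 : ∀ i, Tendsto (fun j => visual o (u i) (rep ω j)) atTop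
      (𝓝 (Real.exp ((bus o ω (u i) - dist o (u i)) / 2))) := by
    intro i
    refine ((Real.continuous_exp.tendsto _).comp
      (((tendsto_bus hX hw o (u i)).sub_const (dist o (u i))).div_const 2)).congr fun j => ?_
    simp only [Function.comp, visual, gromovProduct]
    congr 1
    ring
  have h2 : ∀ i : ℕ, ∃ j ≥ i, dist (visual o (u i) (rep ω j))
      (Real.exp ((bus o ω (u i) - dist o (u i)) / 2)) < 1 / ((i : ℝ) + 1) := by
    intro i
    have := (Metric.tendsto_nhds.1 (h1 i) (1 / ((i : ℝ) + 1)) (by positivity)).and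
      (eventually_ge_atTop i)
    obtain ⟨j, hj, hij⟩ := this.exists
    exact ⟨j, hij, hj⟩
  choose j hj hd using h2
  have hjt : Tendsto j atTop atTop := tendsto_atTop_mono hj tendsto_id
  have h3 := tendsto_rho hX hu (hw.comp hX hjt) o
  refine tendsto_of_tendsto_of_dist h3 ?_
  exact squeeze_zero (fun _ => dist_nonneg) (fun i => (hd i).le)
    tendsto_one_div_add_atTop_nhds_zero_nat

lemma IsBusemann.exists_eq_bus (hX : IsStewartSpace X) {ω : Boundary X} {b : X → ℝ}
    (hb : IsBusemann ω b) : ∃ (o : X) (k : ℝ), ∀ x, b x = bus o ω x + k := by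
  obtain ⟨c, k, hc, hb⟩ := hb
  refine ⟨c 0, k, fun x => tendsto_nhds_unique (hb x) ?_⟩
  refine ((hc.tendsto_bus hX (c 0) x).add_const k).congr' ?_
  filter_upwards [eventually_ge_atTop 0] with t ht
  rw [hc.dist_eq ht]

/-- The product `(x | x')_b` is `(x | x')_o` corrected by half of `b - |o ·|` at both points, and
the corrections have limits too. All pairs of sequences therefore give the same limit, and the
infimum and the lower limit do no work. For `y = y'` the product is `⊤` and both sides are `0`. -/
lemma hamenstadt_eq (hX : IsStewartSpace X) {ω : Boundary X} {b : X → ℝ} {o : X} {k : ℝ}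
    (hb : ∀ x, b x = bus o ω x + k) {y y' : Boundary X} (hy : y ≠ ω) (hy' : y' ≠ ω) :
    hamenstadt b y y' = Real.exp (-k) * rho o y y' / (rho o y ω * rho o y' ω) := by
  have p := rho_pos hX o hy
  have p' := rho_pos hX o hy'
  have hlim : ∀ u v, Represents u y → Represents v y' →
      Tendsto (fun i => Real.exp (-busemannProduct b (u i) (v i))) atTop
        (𝓝 (Real.exp (-k) * rho o y y' / (rho o y ω * rho o y' ω))) := by
    intro u v hu hv
    have := ((tendsto_rho hX hu hv o).const_mul (Real.exp (-k))).div
      ((tendsto_exp_bus_sub_dist hX hu (ω := ω) o).mul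
        (tendsto_exp_bus_sub_dist hX hv (ω := ω) o)) (by positivity)
    refine this.congr fun i => ?_
    rw [Pi.div_apply, ← Real.exp_add, visual, ← Real.exp_add, ← Real.exp_sub, busemannProduct, hb,
      hb, gromovProduct]
    congr 1
    ring
  rcases eq_or_ne y y' with rfl | hne
  · have h0 : rho o y y = 0 := (rho_eq_zero_iff hX o y y).2 rfl
    have : busemannProductAtInfinity b y y = ⊤ := by
      unfold busemannProductAtInfinity
      simp only [iInf_eq_top]
      intro u v hu hv
      have h := hlim u v hu hv
      rw [h0, mul_zero, zero_div, Real.tendsto_exp_comp_nhds_zero, tendsto_neg_atBot_iff] at h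
      exact (EReal.tendsto_coe_atTop.comp h).liminf_eq
    rw [hamenstadt, this, h0]
    simp
  · have q := rho_pos hX o hne
    set r := Real.exp (-k) * rho o y y' / (rho o y ω * rho o y' ω) with hr
    have hrpos : 0 < r := by positivity
    have : busemannProductAtInfinity b y y' = ((-Real.log r : ℝ) : EReal) := by
      have hl : ∀ u v, Represents u y → Represents v y' →
          liminf (fun i : ℕ => ((busemannProduct b (u i) (v i) : ℝ) : EReal)) atTop =
            ((-Real.log r : ℝ) : EReal) := by
        intro u v hu hv
        have h := (((Real.continuousAt_log hrpos.ne').tendsto.comp (hlim u v hu hv))).neg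
        have h' : Tendsto (fun i => busemannProduct b (u i) (v i)) atTop (𝓝 (-Real.log r)) := by
          refine h.congr fun i => ?_
          simp
        exact ((continuous_coe_real_ereal.tendsto _).comp h').liminf_eq
      unfold busemannProductAtInfinity
      refine le_antisymm ?_ ?_
      · refine iInf_le_of_le (rep y) (iInf_le_of_le (rep y') (iInf_le_of_le (rep_spec y)
          (iInf_le_of_le (rep_spec y') ?_)))
        exact (hl _ _ (rep_spec y) (rep_spec y')).le
      · exact le_iInf fun u => le_iInf fun v => le_iInf fun hu => le_iInf fun hv =>
          (hl u v hu hv).ge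
    rw [hamenstadt, this, ← EReal.coe_neg, neg_neg, EReal.exp_coe, ENNReal.toReal_ofReal
      (Real.exp_pos _).le, Real.exp_log hrpos]

end Rays

/-! ### Geodesic lines -/

section Lines

variable {X : Type*} [MetricSpace X]

lemma IsRayTo.bus_eq (hX : IsStewartSpace X) {p : X} {y : Boundary X} {c : ℝ → X}
    (hc : IsRayTo p y c) {t : ℝ} (ht : 0 ≤ t) : bus p y (c t) = -t := by
  refine tendsto_nhds_unique (hc.tendsto_bus hX p (c t)) (tendsto_const_nhds.congr' ?_)
  filter_upwards [eventually_ge_atTop t] with s hs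
  rw [hc.dist_eq (ht.trans hs), hc.2.1 t s ht (ht.trans hs), abs_of_nonpos (by linarith)]
  ring

lemma IsRayTo.between {p : X} {y : Boundary X} {c : ℝ → X} (hc : IsRayTo p y c) {s t : ℝ}
    (hs : 0 ≤ s) (hst : s ≤ t) : Between p (c s) (c t) := by
  rw [Between, hc.dist_eq hs, hc.dist_eq (hs.trans hst), hc.2.1 s t hs (hs.trans hst),
    abs_of_nonpos (by linarith)]
  ring

/-- Monotonicity of the comparison angle with the outer points sent to infinity; since `rho` is the
sine of half the asymptotic angle, `2 * rho ^ 2` is `1 - cos`. -/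
lemma IsRayTo.cosh_dist_le (hX : IsStewartSpace X) {o : X} {y y' : Boundary X} {c c' : ℝ → X}
    (hc : IsRayTo o y c) (hc' : IsRayTo o y' c') {s t : ℝ} (hs : 0 ≤ s) (ht : 0 ≤ t) :
    Real.cosh (dist (c s) (c' t)) ≤
      Real.cosh (s - t) + Real.sinh s * Real.sinh t * (2 * rho o y y' ^ 2) := by
  have h := (((hc.tendsto_sinh_div_sinh hX hc').pow 2).const_mul 2).const_mul
    (Real.sinh s * Real.sinh t)
  rw [← sub_le_iff_le_add']
  refine ge_of_tendsto h ?_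
  filter_upwards [eventually_ge_atTop s, eventually_ge_atTop t, eventually_gt_atTop 0] with T h1 h2 h3
  have hT := Real.sinh_pos_iff.2 h3
  have key := hX.cosh_dist_sub_le (hc.between hs h1) (hc'.between ht h2)
  rw [hc.dist_eq hs, hc'.dist_eq ht, hc.dist_eq h3.le, hc'.dist_eq h3.le, sub_self, Real.cosh_zero,
    cosh_eq_one_add (dist (c T) (c' T))] at key
  rw [div_pow, ← mul_div_assoc, ← mul_div_assoc, le_div_iff₀ (by positivity)]
  linarith

/-- Divide `IsRayTo.cosh_dist_le` by `cosh s` and let `s` tend to infinity. -/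
lemma exp_bus_ray_le (hX : IsStewartSpace X) {o : X} {y y' : Boundary X} {c' : ℝ → X}
    (hc' : IsRayTo o y' c') {t : ℝ} (ht : 0 ≤ t) :
    Real.exp (bus o y (c' t)) ≤ Real.exp (-t) + 2 * rho o y y' ^ 2 * Real.sinh t := by
  have hc := ray_spec hX o y
  have hid : Tendsto (fun s : ℝ => s) atTop atTop := tendsto_id
  have hd : Tendsto (fun s : ℝ => dist (c' t) (ray o y s)) atTop atTop := by
    refine tendsto_atTop_mono' atTop ?_ (tendsto_atTop_add_const_right atTop (-t) tendsto_id)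
    filter_upwards [eventually_ge_atTop 0] with s hs
    have := dist_triangle o (c' t) (ray o y s)
    rw [hc.dist_eq hs, hc'.dist_eq ht] at this
    simp only [id]
    linarith
  have h1 : Tendsto (fun s : ℝ => dist (c' t) (ray o y s) - s) atTop (𝓝 (bus o y (c' t))) := by
    refine (hc.tendsto_bus hX o (c' t)).congr' ?_
    filter_upwards [eventually_ge_atTop 0] with s hs
    rw [hc.dist_eq hs]
  have h2 := tendsto_cosh_div_cosh hd hid h1
  have h3 : Tendsto (fun s : ℝ => Real.cosh (s - t) / Real.cosh s) atTop (𝓝 (Real.exp (-t))) := by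
    refine tendsto_cosh_div_cosh (tendsto_atTop_add_const_right atTop (-t) tendsto_id) hid ?_
    refine tendsto_const_nhds.congr fun s => ?_
    simp
  refine le_of_tendsto_of_tendsto h2 (h3.add_const (2 * rho o y y' ^ 2 * Real.sinh t)) ?_
  filter_upwards [eventually_ge_atTop 0] with s hs
  have h := hc.cosh_dist_le hX hc' hs ht
  have hp := Real.cosh_pos s
  have hsc := (Real.sinh_lt_cosh s).le
  have hst := Real.sinh_nonneg_iff.2 ht
  rw [div_add' _ _ _ hp.ne', dist_comm]
  gcongr
  refine h.trans ?_
  have : Real.sinh s * Real.sinh t * (2 * rho o y y' ^ 2) ≤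
      Real.cosh s * Real.sinh t * (2 * rho o y y' ^ 2) := by gcongr
  linarith

/-- Stewart with a vertex at infinity. One midpoint serves all boundary points, and the factor `cosh
(|a b| / 2)` is the uniform convexity behind existence and uniqueness of lines. -/
lemma exists_midpoint (hX : IsStewartSpace X) (a b : X) :
    ∃ m, ∀ (o : X) (y : Boundary X), 2 * Real.cosh (dist a b / 2) * Real.exp (bus o y m) ≤
      Real.exp (bus o y a) + Real.exp (bus o y b) := by
  rcases eq_or_ne a b with rfl | hab
  · exact ⟨a, fun o y => by simp [two_mul]⟩
  obtain ⟨m, h1, h2⟩ := hX.geodesic.exists_between a b (s := dist a b / 2) (by positivity)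
    (by linarith [@dist_nonneg _ _ a b])
  refine ⟨m, fun o y => ?_⟩
  have h2' : dist m b = dist a b / 2 := by rw [h2]; ring
  have h := stewart_bus hX (show Between a m b by rw [Between, h1, h2']; ring) o y
  have hs := sinh_half_dist_pos hab
  have e : Real.sinh (dist a b) = 2 * Real.sinh (dist a b / 2) * Real.cosh (dist a b / 2) := by
    rw [← Real.sinh_two_mul]; congr 1; ring
  rw [h1, h2', e] at h
  refine le_of_mul_le_mul_left ?_ hs
  linarith

lemma rho_le_exp_half (hX : IsStewartSpace X) (o x : X) (y y' : Boundary X) :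
    rho o y y' ≤ Real.exp ((bus o y x + bus o y' x) / 2) := by
  have h := rho_eq_mul_exp hX o x y y'
  have h1 := rho_le_one hX x y y'
  rw [h, Real.exp_neg, ← div_eq_mul_inv, div_le_one (Real.exp_pos _)] at h1
  exact h1

lemma exp_half_add (a b : ℝ) : Real.exp ((a + b) / 2) ^ 2 = Real.exp a * Real.exp b := by
  rw [← Real.exp_nat_mul, ← Real.exp_add]
  congr 1
  push_cast
  ring

lemma two_mul_rho_le (hX : IsStewartSpace X) (o x : X) (y y' : Boundary X) :
    2 * rho o y y' ≤ Real.exp (bus o y x) + Real.exp (bus o y' x) := by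
  have h := rho_le_exp_half hX o x y y'
  have h2 := exp_half_add (bus o y x) (bus o y' x)
  have p := Real.exp_pos (bus o y x)
  have p' := Real.exp_pos (bus o y' x)
  have := Real.exp_pos ((bus o y x + bus o y' x) / 2)
  nlinarith [sq_nonneg (Real.exp (bus o y x) - Real.exp (bus o y' x))]

lemma continuous_bus (hX : IsStewartSpace X) (o : X) (y : Boundary X) : Continuous (bus o y) := by
  refine LipschitzWith.continuous (K := 1) (LipschitzWith.of_dist_le_mul fun x x' => ?_)
  rw [Real.dist_eq, abs_le, NNReal.coe_one, one_mul]
  have h1 := bus_sub_le hX o x x' y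
  have h2 := bus_sub_le hX o x' x y
  rw [dist_comm] at h2
  constructor <;> linarith

/-- Midpoints of the points at distance `n` on the two rays from `o`: convexity bounds the sum by
about `2 * rho ^ 2 * sinh n / cosh (d / 2)`, and `sinh (d / 2) / sinh n` tends to `rho`. -/
lemma exists_minimizing (hX : IsStewartSpace X) (o : X) {y y' : Boundary X} (h : y ≠ y') :
    ∃ m : ℕ → X, Tendsto (fun n => Real.exp (bus o y (m n)) + Real.exp (bus o y' (m n))) atTop
      (𝓝 (2 * rho o y y')) := by
  have hc := ray_spec hX o y
  have hc' := ray_spec hX o y'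
  have hρ := rho_pos hX o h
  have hnat : Tendsto (fun n : ℕ => (n : ℝ)) atTop atTop := tendsto_natCast_atTop_atTop
  choose m hm using fun n : ℕ => exists_midpoint hX (ray o y n) (ray o y' n)
  refine ⟨m, ?_⟩
  have hr := (hc.tendsto_sinh_div_sinh hX hc').comp hnat
  have h1 : Tendsto (fun n : ℕ => 2 * Real.exp (-(n : ℝ)) +
      2 * rho o y y' ^ 2 * (Real.sinh (dist (ray o y n) (ray o y' n) / 2) / Real.sinh n)⁻¹) atTop
      (𝓝 (2 * rho o y y')) := by
    have := ((Real.tendsto_exp_neg_atTop_nhds_zero.comp hnat).const_mul 2).add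
      ((hr.inv₀ hρ.ne').const_mul (2 * rho o y y' ^ 2))
    rw [mul_zero, zero_add, show 2 * rho o y y' ^ 2 * (rho o y y')⁻¹ = 2 * rho o y y' by
      field_simp] at this
    exact this
  refine tendsto_of_tendsto_of_tendsto_of_le_of_le' tendsto_const_nhds h1
    (Eventually.of_forall fun n => two_mul_rho_le hX o (m n) y y') ?_
  filter_upwards [hr.eventually (lt_mem_nhds hρ), eventually_gt_atTop 0] with n hn hn0
  have hn0' : (0 : ℝ) < n := Nat.cast_pos.2 hn0
  have a1 := hm n o y
  have a2 := hm n o y'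
  have b1 := exp_bus_ray_le hX hc' (y := y) hn0'.le
  have b2 := exp_bus_ray_le hX hc (y := y') hn0'.le
  rw [hc.bus_eq hX hn0'.le] at a1
  rw [hc'.bus_eq hX hn0'.le] at a2
  rw [rho_comm] at b2
  have hs : 0 < Real.sinh (n : ℝ) := Real.sinh_pos_iff.2 hn0'
  simp only [Function.comp] at hn
  have hS : 0 < Real.sinh (dist (ray o y n) (ray o y' n) / 2) := by
    have := mul_pos hn hs
    rwa [div_mul_cancel₀ _ hs.ne'] at this
  have hSC := (Real.sinh_lt_cosh (dist (ray o y n) (ray o y' n) / 2)).le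
  have hC1 := Real.one_le_cosh (dist (ray o y n) (ray o y' n) / 2)
  set C := Real.cosh (dist (ray o y n) (ray o y' n) / 2)
  set S := Real.sinh (dist (ray o y n) (ray o y' n) / 2)
  have hC : 0 < C := by linarith
  have key : C * (Real.exp (bus o y (m n)) + Real.exp (bus o y' (m n))) ≤
      C * (2 * Real.exp (-(n : ℝ))) + C * (2 * rho o y y' ^ 2 * (S / Real.sinh n)⁻¹) := by
    have e1 : 2 * rho o y y' ^ 2 * Real.sinh n ≤ C * (2 * rho o y y' ^ 2 * (S / Real.sinh n)⁻¹) := by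
      rw [inv_div, ← mul_div_assoc, ← mul_div_assoc, le_div_iff₀ hS]
      have : 0 ≤ 2 * rho o y y' ^ 2 * Real.sinh n := by positivity
      nlinarith
    have e2 : Real.exp (-(n : ℝ)) ≤ C * Real.exp (-(n : ℝ)) :=
      le_mul_of_one_le_left (Real.exp_pos _).le hC1
    linarith
  rw [← mul_add] at key
  exact le_of_mul_le_mul_left key hC

/-- A minimising sequence for `exp (bus o y) + exp (bus o y')` is Cauchy by uniform convexity. At
its limit the arithmetic–geometric mean inequality behind `two_mul_rho_le` is an equality, which
says that `rho p y y' = 1`. -/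
lemma exists_rho_eq_one (hX : IsStewartSpace X) {y y' : Boundary X} (h : y ≠ y') :
    ∃ p : X, rho p y y' = 1 := by
  have := hX.complete
  obtain ⟨o⟩ : Nonempty X := ⟨rep y 0⟩
  have hρ := rho_pos hX o h
  obtain ⟨m, hm⟩ := exists_minimizing hX o h
  have hcauchy : CauchySeq m := by
    rw [cauchySeq_iff_tendsto_dist_atTop_0, ← prod_atTop_atTop_eq]
    have h1 := ((hm.comp tendsto_fst).add (hm.comp (tendsto_snd (f := atTop (α := ℕ))))).div_const
      (4 * rho o y y')
    rw [show (2 * rho o y y' + 2 * rho o y y') / (4 * rho o y y') = 1 by field_simp; norm_num] at h1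
    have h2 : Tendsto (fun p : ℕ × ℕ => Real.cosh (dist (m p.1) (m p.2) / 2)) (atTop ×ˢ atTop)
        (𝓝 1) := by
      refine tendsto_of_tendsto_of_tendsto_of_le_of_le tendsto_const_nhds h1
        (fun p => Real.one_le_cosh _) fun p => ?_
      obtain ⟨q, hq⟩ := exists_midpoint hX (m p.1) (m p.2)
      have q1 := hq o y
      have q2 := hq o y'
      have q3 := two_mul_rho_le hX o q y y'
      have hC := Real.cosh_pos (dist (m p.1) (m p.2) / 2)
      simp only [Function.comp]
      rw [le_div_iff₀ (by positivity)]
      nlinarith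
    have h3 := (tendsto_zero_of_cosh (fun p => by positivity) h2).const_mul 2
    rw [mul_zero] at h3
    refine h3.congr fun p => ?_
    ring
  obtain ⟨p, hp⟩ := cauchySeq_tendsto_of_complete hcauchy
  have hcont : Continuous fun x => Real.exp (bus o y x) + Real.exp (bus o y' x) :=
    (Real.continuous_exp.comp (continuous_bus hX o y)).add
      (Real.continuous_exp.comp (continuous_bus hX o y'))
  have hG := tendsto_nhds_unique ((hcont.tendsto p).comp hp) hm
  refine ⟨p, ?_⟩
  have h1 := rho_le_exp_half hX o p y y'
  have h2 := exp_half_add (bus o y p) (bus o y' p)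
  have h3 := Real.exp_pos ((bus o y p + bus o y' p) / 2)
  have h4 : Real.exp ((bus o y p + bus o y' p) / 2) = rho o y y' := by
    refine le_antisymm ?_ h1
    refine le_of_sq_le_sq ?_ hρ.le
    nlinarith [sq_nonneg (Real.exp (bus o y p) - Real.exp (bus o y' p))]
  rw [rho_eq_mul_exp hX o p, Real.exp_neg, h4, mul_inv_cancel₀ hρ.ne']

/-- The Gromov product can only grow along the rays; its limit is `0`, so it vanishes all the way
and the rays form a line. -/
lemma IsRayTo.dist_eq_add (hX : IsStewartSpace X) {p : X} {y y' : Boundary X} {c c' : ℝ → X}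
    (hc : IsRayTo p y c) (hc' : IsRayTo p y' c') (h : rho p y y' = 1) {s t : ℝ} (hs : 0 ≤ s)
    (ht : 0 ≤ t) : dist (c s) (c' t) = s + t := by
  have hv : 1 ≤ visual p (c s) (c' t) := by
    have h1 := hc.tendsto_rho hX hc' p
    rw [h] at h1
    refine le_of_tendsto h1 ?_
    filter_upwards [eventually_ge_atTop s, eventually_ge_atTop t] with T h2 h3
    rw [visual, visual, Real.exp_le_exp, gromovProduct, gromovProduct, hc.dist_eq hs,
      hc'.dist_eq ht, hc.dist_eq (hs.trans h2), hc'.dist_eq (ht.trans h3)]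
    have e1 := hc.2.1 T s (hs.trans h2) hs
    have e2 := hc'.2.1 t T ht (ht.trans h3)
    rw [abs_of_nonneg (by linarith)] at e1
    rw [abs_of_nonpos (by linarith)] at e2
    have := dist_triangle4 (c T) (c s) (c' t) (c' T)
    linarith
  have hg : gromovProduct p (c s) (c' t) ≤ 0 := by
    rw [visual, Real.one_le_exp_iff] at hv
    linarith
  refine le_antisymm ?_ ?_
  · have := dist_triangle (c s) p (c' t)
    rwa [dist_comm (c s) p, hc.dist_eq hs, hc'.dist_eq ht] at this
  · rw [gromovProduct, hc.dist_eq hs, hc'.dist_eq ht] at hg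
    linarith

lemma exists_line_of_rho_eq_one (hX : IsStewartSpace X) {p : X} {y y' : Boundary X}
    (h : rho p y y' = 1) : ∃ c, IsLineJoining y y' c ∧ c 0 = p := by
  have hc := ray_spec hX p y
  have hc' := ray_spec hX p y'
  set r := ray p y
  set r' := ray p y'
  have hadd := fun {s t : ℝ} (hs : 0 ≤ s) (ht : 0 ≤ t) => hc.dist_eq_add hX hc' h hs ht
  have hpos : ∀ {t : ℝ}, 0 ≤ t → (if t < 0 then r (-t) else r' t) = r' t := fun ht =>
    if_neg (not_lt.2 ht)
  have hneg : ∀ {t : ℝ}, t ≤ 0 → (if t < 0 then r (-t) else r' t) = r (-t) := by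
    intro t ht
    rcases ht.lt_or_eq with h0 | rfl
    · exact if_pos h0
    · rw [if_neg (lt_irrefl _), neg_zero, hc.1, hc'.1]
  refine ⟨fun t => if t < 0 then r (-t) else r' t, ⟨fun s t => ?_, ?_, ?_⟩, ?_⟩
  · rcases le_total s 0 with hs | hs <;> rcases le_total t 0 with ht | ht <;>
      simp only [hpos, hneg, hs, ht]
    · rw [hc.2.1 _ _ (by linarith) (by linarith), ← abs_neg]
      congr 1
      ring
    · rw [hadd (by linarith) ht, abs_of_nonpos (by linarith)]
      ring
    · rw [dist_comm, hadd (by linarith) hs, abs_of_nonneg (by linarith)]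
      ring
    · exact hc'.2.1 _ _ hs ht
  · have : (fun n : ℕ => if -(n : ℝ) < 0 then r (- -(n : ℝ)) else r' (-(n : ℝ))) =
        fun n : ℕ => r n := by
      funext n
      rw [hneg (by simp), neg_neg]
    rw [this]
    exact hc.2.2
  · have : (fun n : ℕ => if (n : ℝ) < 0 then r (-(n : ℝ)) else r' (n : ℝ)) =
        fun n : ℕ => r' n := by
      funext n
      rw [hpos (by simp)]
    rw [this]
    exact hc'.2.2
  · simp only [lt_irrefl, if_false]
    exact hc'.1

lemma exists_line (hX : IsStewartSpace X) {y y' : Boundary X} (h : y ≠ y') :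
    ∃ c, IsLineJoining y y' c := by
  obtain ⟨p, hp⟩ := exists_rho_eq_one hX h
  obtain ⟨c, hc, -⟩ := exists_line_of_rho_eq_one hX hp
  exact ⟨c, hc⟩

lemma IsLineJoining.isRayTo_right {y y' : Boundary X} {c : ℝ → X} (hc : IsLineJoining y y' c) :
    IsRayTo (c 0) y' c := ⟨rfl, fun s t _ _ => hc.1 s t, hc.2.2⟩

lemma IsLineJoining.isRayTo_left {y y' : Boundary X} {c : ℝ → X} (hc : IsLineJoining y y' c) :
    IsRayTo (c 0) y fun t => c (-t) := by
  refine ⟨by simp, fun s t _ _ => ?_, hc.2.1⟩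
  rw [hc.1, ← abs_neg]
  congr 1
  ring

lemma IsLineJoining.shift (hX : IsStewartSpace X) {y y' : Boundary X} {c : ℝ → X}
    (hc : IsLineJoining y y' c) (s : ℝ) : IsLineJoining y y' fun t => c (t + s) := by
  have hnat : Tendsto (fun n : ℕ => (n : ℝ)) atTop atTop := tendsto_natCast_atTop_atTop
  refine ⟨fun t t' => by rw [hc.1]; congr 1; ring, ?_, ?_⟩
  · have := hc.isRayTo_left.represents hX (tendsto_atTop_add_const_right atTop (-s) hnat)
    convert this using 3
    ring
  · exact hc.isRayTo_right.represents hX (tendsto_atTop_add_const_right atTop s hnat)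

lemma IsLineJoining.rho_zero (hX : IsStewartSpace X) {y y' : Boundary X} {c : ℝ → X}
    (hc : IsLineJoining y y' c) : rho (c 0) y y' = 1 := by
  refine tendsto_nhds_unique (tendsto_rho hX hc.2.1 hc.2.2 (c 0)) (tendsto_const_nhds.congr fun n => ?_)
  have hn : (0 : ℝ) ≤ n := Nat.cast_nonneg n
  rw [visual, gromovProduct, hc.1, hc.1, hc.1, abs_of_nonneg (by linarith),
    abs_of_nonpos (by linarith), abs_of_nonpos (by linarith)]
  rw [eq_comm, Real.exp_eq_one_iff]
  ring

lemma IsLineJoining.rho_eq_one (hX : IsStewartSpace X) {y y' : Boundary X} {c : ℝ → X}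
    (hc : IsLineJoining y y' c) (t : ℝ) : rho (c t) y y' = 1 := by
  simpa using (hc.shift hX t).rho_zero hX

lemma IsLineJoining.bus_right (hX : IsStewartSpace X) {y y' : Boundary X} {c : ℝ → X}
    (hc : IsLineJoining y y' c) (o : X) (t : ℝ) : bus o y' (c t) = bus o y' (c 0) - t := by
  have h1 := (tendsto_bus hX hc.2.2 o (c t)).sub (tendsto_bus hX hc.2.2 o (c 0))
  have h2 : bus o y' (c t) - bus o y' (c 0) = -t := by
    refine tendsto_nhds_unique h1 (tendsto_const_nhds.congr' ?_)
    filter_upwards [tendsto_natCast_atTop_atTop.eventually_ge_atTop t] with n hn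
    have hn0 : (0 : ℝ) ≤ n := Nat.cast_nonneg n
    rw [hc.1, hc.1, abs_of_nonpos (by linarith), abs_of_nonpos (by linarith)]
    ring
  linarith

lemma IsLineJoining.bus_left (hX : IsStewartSpace X) {y y' : Boundary X} {c : ℝ → X}
    (hc : IsLineJoining y y' c) (o : X) (t : ℝ) : bus o y (c t) = bus o y (c 0) + t := by
  have h1 := (tendsto_bus hX hc.2.1 o (c t)).sub (tendsto_bus hX hc.2.1 o (c 0))
  have h2 : bus o y (c t) - bus o y (c 0) = t := by
    refine tendsto_nhds_unique h1 (tendsto_const_nhds.congr' ?_)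
    filter_upwards [tendsto_natCast_atTop_atTop.eventually_ge_atTop (-t)] with n hn
    have hn0 : (0 : ℝ) ≤ n := Nat.cast_nonneg n
    rw [hc.1, hc.1, abs_of_nonneg (by linarith), abs_of_nonneg (by linarith)]
    ring
  linarith

lemma IsLineJoining.ne (hX : IsStewartSpace X) {y y' : Boundary X} {c : ℝ → X}
    (hc : IsLineJoining y y' c) : y ≠ y' := by
  rintro rfl
  have h := hc.rho_zero hX
  rw [(rho_eq_zero_iff hX (c 0) y y).2 rfl] at h
  exact zero_ne_one h

/-- If `p ≠ q`, uniform convexity would make `rho` at their midpoint exceed `1`. This gives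
uniqueness of the line, parametrised by a Busemann function. -/
lemma eq_of_rho_eq_one (hX : IsStewartSpace X) {y y' : Boundary X} {o p q : X}
    (hp : rho p y y' = 1) (hq : rho q y y' = 1) (h : bus o y p = bus o y q) : p = q := by
  rw [rho_eq_mul_exp hX o] at hp hq
  obtain ⟨m, hm⟩ := exists_midpoint hX p q
  have m1 := hm o y
  have m2 := hm o y'
  have hm3 := rho_le_exp_half hX o m y y'
  have e : Real.exp ((bus o y p + bus o y' p) / 2) = rho o y y' := by
    rw [Real.exp_neg, mul_inv_eq_one₀ (Real.exp_pos _).ne'] at hp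
    exact hp.symm
  have e' : Real.exp ((bus o y q + bus o y' q) / 2) = rho o y y' := by
    rw [Real.exp_neg, mul_inv_eq_one₀ (Real.exp_pos _).ne'] at hq
    exact hq.symm
  have h' : bus o y' p = bus o y' q := by
    have := Real.exp_injective (e.trans e'.symm)
    linarith
  rw [h] at m1 e
  rw [h'] at m2 e
  have s1 := exp_half_add (bus o y q) (bus o y' q)
  have s2 := exp_half_add (bus o y m) (bus o y' m)
  rw [e] at s1
  have hρ : 0 < rho o y y' := e ▸ Real.exp_pos _
  have hC := Real.one_le_cosh (dist p q / 2)
  set C := Real.cosh (dist p q / 2)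
  have p1 := Real.exp_pos (bus o y m)
  have p2 := Real.exp_pos (bus o y' m)
  have m3 : (C * Real.exp (bus o y m)) * (C * Real.exp (bus o y' m)) ≤
      Real.exp (bus o y q) * Real.exp (bus o y' q) := by
    apply mul_le_mul <;> first | linarith | positivity
  have m4 : rho o y y' ^ 2 ≤ Real.exp ((bus o y m + bus o y' m) / 2) ^ 2 := by gcongr
  have m5 : C ^ 2 * rho o y y' ^ 2 ≤ rho o y y' ^ 2 := by
    rw [s1]
    calc C ^ 2 * (Real.exp (bus o y q) * Real.exp (bus o y' q))
        ≤ C ^ 2 * (Real.exp (bus o y m) * Real.exp (bus o y' m)) := by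
          rw [← s1, ← s2]; gcongr
      _ = (C * Real.exp (bus o y m)) * (C * Real.exp (bus o y' m)) := by ring
      _ ≤ _ := m3
  have m6 : C ^ 2 ≤ 1 := le_of_mul_le_mul_right (by linarith) (show 0 < rho o y y' ^ 2 by positivity)
  have m7 : C ≤ 1 := by nlinarith
  have := sq_le_two_mul_cosh_sub_one (show 0 ≤ dist p q / 2 by positivity)
  have h0 : (dist p q / 2) ^ 2 ≤ 0 := this.trans (by linarith)
  have : dist p q / 2 = 0 := pow_eq_zero_iff (two_ne_zero) |>.1 (le_antisymm h0 (sq_nonneg _))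
  exact dist_eq_zero.1 (by linarith)

lemma IsLineJoining.range_subset (hX : IsStewartSpace X) {y y' : Boundary X} {c c' : ℝ → X}
    (hc : IsLineJoining y y' c) (hc' : IsLineJoining y y' c') : Set.range c ⊆ Set.range c' := by
  rintro _ ⟨t, rfl⟩
  refine ⟨bus (c 0) y (c t) - bus (c 0) y (c' 0), ?_⟩
  refine eq_of_rho_eq_one hX (o := c 0) (hc'.rho_eq_one hX _) (hc.rho_eq_one hX _) ?_
  rw [hc'.bus_left hX]
  ring

lemma line_eq_range (hX : IsStewartSpace X) {y y' : Boundary X} {c : ℝ → X}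
    (hc : IsLineJoining y y' c) : line y y' = Set.range c := by
  ext x
  constructor
  · rintro ⟨c', hc', hx⟩
    exact hc'.range_subset hX hc hx
  · exact fun hx => ⟨c, hc, hx⟩

lemma line_self (hX : IsStewartSpace X) (y : Boundary X) : line y y = ∅ := by
  ext x
  simp only [Set.mem_empty_iff_false, iff_false]
  rintro ⟨c, hc, -⟩
  exact hc.ne hX rfl

lemma between_of_line {c : ℝ → X} (hc : ∀ s t, dist (c s) (c t) = |s - t|) {r s t : ℝ}
    (hrs : r ≤ s) (hst : s ≤ t) : Between (c r) (c s) (c t) := by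
  rw [Between, hc, hc, hc, abs_of_nonpos (by linarith), abs_of_nonpos (by linarith),
    abs_of_nonpos (by linarith)]
  ring

lemma IsLineJoining.stewart_mid (hX : IsStewartSpace X) {y y' : Boundary X} {c : ℝ → X}
    (hc : IsLineJoining y y' c) (t : ℝ) (z : X) :
    2 * Real.cosh t * Real.cosh (dist z (c 0)) ≤
      Real.cosh (dist z (c (-t))) + Real.cosh (dist z (c t)) := by
  wlog ht : 0 < t generalizing t with H
  · rcases (not_lt.1 ht).lt_or_eq with h | rfl
    · have := H (-t) (by linarith)
      rw [Real.cosh_neg, neg_neg] at this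
      linarith
    · simp [two_mul]
  have h := hX.stewart _ _ _ (between_of_line hc.1 (by linarith : -t ≤ 0) ht.le) z
  rw [hc.1, hc.1, hc.1, abs_of_neg (by linarith), abs_of_neg (by linarith), abs_of_neg (by linarith),
    show -(-t - t) = 2 * t by ring, Real.sinh_two_mul, show -(0 - t) = t by ring,
    show -(-t - 0) = t by ring] at h
  exact le_of_mul_le_mul_left (by linarith) (Real.sinh_pos_iff.2 ht)

/-- The limit of Stewart at the midpoint of `c (-t)` and `c t`. With `rho` as the sine of a half
angle, it says that the angles on both sides of the ray to `z` add up to at least `π`. -/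
lemma IsLineJoining.one_le_rho_sq_add (hX : IsStewartSpace X) {y y' : Boundary X} {c : ℝ → X}
    (hc : IsLineJoining y y' c) (z : Boundary X) :
    1 ≤ rho (c 0) y z ^ 2 + rho (c 0) y' z ^ 2 := by
  have hr := ray_spec hX (c 0) z
  have h1 := ((hc.isRayTo_left.tendsto_sinh_div_sinh hX hr).pow 2).add
    ((hc.isRayTo_right.tendsto_sinh_div_sinh hX hr).pow 2)
  refine ge_of_tendsto h1 ?_
  filter_upwards [eventually_gt_atTop 0] with t ht
  have hs := Real.sinh_pos_iff.2 ht
  have h := hc.stewart_mid hX t (ray (c 0) z t)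
  rw [dist_comm _ (c 0), hr.dist_eq ht.le, dist_comm _ (c (-t)), dist_comm _ (c t),
    cosh_eq_one_add (dist (c (-t)) _), cosh_eq_one_add (dist (c t) _)] at h
  rw [div_pow, div_pow, ← add_div, one_le_div (by positivity)]
  have := Real.cosh_sq t
  linarith

end Lines

/-! ### The equality case and crossing geodesics -/

section Crossing

variable {X : Type*} [MetricSpace X]

lemma rho_ptolemy_eq_of_base (hX : IsStewartSpace X) (o p : X) {y₁ y₂ y₃ y₄ : Boundary X}
    (h : rho p y₁ y₃ * rho p y₂ y₄ = rho p y₁ y₂ * rho p y₃ y₄ + rho p y₂ y₃ * rho p y₄ y₁) :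
    rho o y₁ y₃ * rho o y₂ y₄ = rho o y₁ y₂ * rho o y₃ y₄ + rho o y₂ y₃ * rho o y₄ y₁ := by
  have e : ∀ y y' : Boundary X, rho o y y' =
      rho p y y' * (Real.exp (-(bus p y o / 2)) * Real.exp (-(bus p y' o / 2))) := by
    intro y y'
    rw [rho_eq_mul_exp hX p o, ← Real.exp_add]
    congr 2
    ring
  rw [e y₁ y₃, e y₂ y₄, e y₁ y₂, e y₃ y₄, e y₂ y₃, e y₄ y₁]
  linear_combination (Real.exp (-(bus p y₁ o / 2)) * Real.exp (-(bus p y₂ o / 2)) *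
    Real.exp (-(bus p y₃ o / 2)) * Real.exp (-(bus p y₄ o / 2))) * h

/-- The vectors `(a, b)` and `(c, d)` are parallel, of length at least `1`, with inner product at
most `1`; so they are the same unit vector. -/
lemma eq_of_parallel {a b c d : ℝ} (ha : 0 ≤ a) (hb : 0 ≤ b) (hc : 0 ≤ c) (hd : 0 ≤ d)
    (hpar : a * d = b * c) (h : a * c + b * d ≤ 1) (h1 : 1 ≤ a ^ 2 + b ^ 2)
    (h2 : 1 ≤ d ^ 2 + c ^ 2) : a = c ∧ b = d ∧ d ^ 2 + c ^ 2 = 1 := by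
  have e : (a * c + b * d) ^ 2 = (a ^ 2 + b ^ 2) * (d ^ 2 + c ^ 2) := by
    linear_combination -(a * d - b * c) * hpar
  have hle : (a * c + b * d) ^ 2 ≤ 1 := pow_le_one₀ (by positivity) h
  have h3 : a ^ 2 + b ^ 2 = 1 := by nlinarith
  have h4 : d ^ 2 + c ^ 2 = 1 := by nlinarith
  rw [h3, h4, one_mul] at e
  have h5 : a * c + b * d = 1 := by
    have : 0 ≤ a * c + b * d := by positivity
    nlinarith
  have h6 : (a - c) ^ 2 + (b - d) ^ 2 = 0 := by linarith
  have h7 : (a - c) ^ 2 = 0 := le_antisymm (by linarith [sq_nonneg (b - d)]) (sq_nonneg _)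
  have h8 : (b - d) ^ 2 = 0 := le_antisymm (by linarith [sq_nonneg (a - c)]) (sq_nonneg _)
  exact ⟨sub_eq_zero.1 (pow_eq_zero_iff two_ne_zero |>.1 h7),
    sub_eq_zero.1 (pow_eq_zero_iff two_ne_zero |>.1 h8), h4⟩

open UpperHalfPlane in
/-- Two geodesic lines that cross in `X` and span an isometric copy of two crossing lines in the
hyperbolic plane have end points for which equality holds in the Ptolemy inequality. -/
lemma rho_ptolemy_eq_of_crossing (hX : IsStewartSpace X) {y₁ y₂ y₃ y₄ : Boundary X} {c c' : ℝ → X}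
    (hc : IsLineJoining y₁ y₃ c) (hc' : IsLineJoining y₂ y₄ c') (h0 : c 0 = c' 0) {e e' : ℝ → ℍ}
    (he : ∀ s t, dist (e s) (e t) = |s - t|) (he' : ∀ s t, dist (e' s) (e' t) = |s - t|)
    (hee : ∀ s t, dist (e s) (e' t) = dist (c s) (c' t)) :
    rho (c 0) y₁ y₃ * rho (c 0) y₂ y₄ =
      rho (c 0) y₁ y₂ * rho (c 0) y₃ y₄ + rho (c 0) y₂ y₃ * rho (c 0) y₄ y₁ := by
  have he0 : e 0 = e' 0 := dist_eq_zero.1 (by rw [hee, h0, dist_self])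
  have mid : ∀ {g : ℝ → ℍ}, (∀ s t, dist (g s) (g t) = |s - t|) → ∀ {t : ℝ}, 0 < t → ∀ z : ℍ,
      2 * Real.cosh t * Real.cosh (dist z (g 0)) =
        Real.cosh (dist z (g (-t))) + Real.cosh (dist z (g t)) := by
    intro g hg t ht z
    have h := upperHalfPlane_stewart (between_of_line hg (by linarith : -t ≤ 0) ht.le) z
    rw [hg, hg, hg, abs_of_neg (by linarith), abs_of_neg (by linarith), abs_of_neg (by linarith),
      show -(-t - t) = 2 * t by ring, Real.sinh_two_mul, show -(0 - t) = t by ring,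
      show -(-t - 0) = t by ring] at h
    exact mul_left_cancel₀ (Real.sinh_pos_iff.2 ht).ne' (by linarith)
  have dz : ∀ {g : ℝ → ℍ}, (∀ s t, dist (g s) (g t) = |s - t|) → ∀ t : ℝ,
      dist (g t) (g 0) = |t| := fun hg t => by rw [hg, sub_zero]
  -- Stewart is an equality in the plane. So opposite angles at the crossing point agree and
  -- adjacent ones are supplementary, which gives the two equalities and the sum of squares.
  have key : ∀ t : ℝ, 0 < t →
      Real.sinh (dist (c (-t)) (c' (-t)) / 2) = Real.sinh (dist (c t) (c' t) / 2) ∧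
      Real.sinh (dist (c (-t)) (c' t) / 2) = Real.sinh (dist (c t) (c' (-t)) / 2) ∧
      Real.sinh (dist (c t) (c' t) / 2) ^ 2 + Real.sinh (dist (c t) (c' (-t)) / 2) ^ 2 =
        Real.sinh t ^ 2 := by
    intro t ht
    have a1 := mid he' ht (e t)
    have a2 := mid he' ht (e (-t))
    have a3 := mid he ht (e' t)
    rw [← he0, dz he, abs_of_pos ht, hee, hee] at a1
    rw [← he0, dz he, abs_neg, abs_of_pos ht, hee, hee] at a2
    rw [he0, dz he', abs_of_pos ht, dist_comm (e' t) (e (-t)), hee, dist_comm (e' t) (e t), hee] at a3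
    simp only [cosh_eq_one_add (dist _ _)] at a1 a2 a3
    have e1 := Real.cosh_sq t
    refine ⟨?_, ?_, ?_⟩
    · exact (sq_eq_sq₀ (sinh_half_dist_nonneg _ _) (sinh_half_dist_nonneg _ _)).1 (by linarith)
    · exact (sq_eq_sq₀ (sinh_half_dist_nonneg _ _) (sinh_half_dist_nonneg _ _)).1 (by linarith)
    · linarith
  have r1 := hc.isRayTo_left
  have r3 := hc.isRayTo_right
  have r2 := hc'.isRayTo_left
  have r4 := hc'.isRayTo_right
  rw [← h0] at r2 r4
  have t12 := r1.tendsto_sinh_div_sinh hX r2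
  have t34 := r3.tendsto_sinh_div_sinh hX r4
  have t14 := r1.tendsto_sinh_div_sinh hX r4
  have t32 := r3.tendsto_sinh_div_sinh hX r2
  have e1 : rho (c 0) y₁ y₂ = rho (c 0) y₃ y₄ := by
    refine tendsto_nhds_unique t12 (t34.congr' ?_)
    filter_upwards [eventually_gt_atTop 0] with t ht
    rw [(key t ht).1]
  have e2 : rho (c 0) y₁ y₄ = rho (c 0) y₃ y₂ := by
    refine tendsto_nhds_unique t14 (t32.congr' ?_)
    filter_upwards [eventually_gt_atTop 0] with t ht
    rw [(key t ht).2.1]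
  have e3 : rho (c 0) y₃ y₄ ^ 2 + rho (c 0) y₃ y₂ ^ 2 = 1 := by
    refine tendsto_nhds_unique ((t34.pow 2).add (t32.pow 2)) (tendsto_const_nhds.congr' ?_)
    filter_upwards [eventually_gt_atTop 0] with t ht
    have hs := Real.sinh_pos_iff.2 ht
    rw [div_pow, div_pow, ← add_div, (key t ht).2.2, div_self (by positivity)]
  have e4 := hc.rho_eq_one hX 0
  have e5 := hc'.rho_eq_one hX 0
  rw [← h0] at e5
  rw [e4, e5, e1, rho_comm _ y₂ y₃, rho_comm _ y₄ y₁, e2]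
  linarith

/-- If equality holds in the Ptolemy inequality, the geodesics joining opposite points cross, and
distances between their points are as in the hyperbolic plane. -/
lemma exists_crossing (hX : IsStewartSpace X) {y₁ y₂ y₃ y₄ : Boundary X} (h12 : y₁ ≠ y₂)
    (h13 : y₁ ≠ y₃) (h14 : y₁ ≠ y₄) (h23 : y₂ ≠ y₃) (h34 : y₃ ≠ y₄) {o : X}
    (h : rho o y₁ y₃ * rho o y₂ y₄ = rho o y₁ y₂ * rho o y₃ y₄ + rho o y₂ y₃ * rho o y₄ y₁) :
    ∃ (c c' : ℝ → X) (k : ℝ), IsLineJoining y₁ y₃ c ∧ IsLineJoining y₂ y₄ c' ∧ -1 < k ∧ k < 1 ∧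
      ∀ s t, Real.cosh (dist (c s) (c' t)) =
        Real.cosh s * Real.cosh t - Real.sinh s * Real.sinh t * k := by
  obtain ⟨c₀, hc₀⟩ := exists_line hX h13
  set q := c₀ 0 with hq
  have p12 := rho_pos hX q h12
  have p14 := rho_pos hX q h14.symm
  have p23 := rho_pos hX q h23
  have p34 := rho_pos hX q h34
  -- Moving the base point by `τ` along the line multiplies the numerator by `exp (-τ)` and the
  -- denominator by `exp τ`, up to a common factor. With `τ = log R / 2` the two become equal, as
  -- `eq_of_parallel` requires.
  set R := rho q y₁ y₂ * rho q y₄ y₁ / (rho q y₂ y₃ * rho q y₃ y₄) with hR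
  have hRpos : 0 < R := by positivity
  set τ := Real.log R / 2 with hτ
  have hc : IsLineJoining y₁ y₃ fun t => c₀ (t + τ) := hc₀.shift hX τ
  set c := fun t => c₀ (t + τ) with hcdef
  have hp : c 0 = c₀ τ := by simp [hcdef]
  have hb : ∀ y : Boundary X, bus q y q = 0 := by
    intro y
    simp only [bus, sub_self]
    exact tendsto_const_nhds.limUnder_eq
  have b1 : bus q y₁ (c 0) = τ := by rw [hp, hc₀.bus_left hX, ← hq, hb, zero_add]
  have b3 : bus q y₃ (c 0) = -τ := by rw [hp, hc₀.bus_right hX, ← hq, hb, zero_sub]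
  have hpar : rho (c 0) y₁ y₂ * rho (c 0) y₄ y₁ = rho (c 0) y₂ y₃ * rho (c 0) y₃ y₄ := by
    have e1 : Real.exp (2 * τ) = R := by
      rw [hτ, mul_div_cancel₀ _ two_ne_zero, Real.exp_log hRpos]
    have e2 : rho q y₁ y₂ * rho q y₄ y₁ = Real.exp (2 * τ) * (rho q y₂ y₃ * rho q y₃ y₄) := by
      rw [e1, hR]
      field_simp
    set E := Real.exp (-((bus q y₂ (c 0) + bus q y₄ (c 0)) / 2)) with hE
    have l : Real.exp (-((bus q y₁ (c 0) + bus q y₂ (c 0)) / 2)) *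
        Real.exp (-((bus q y₄ (c 0) + bus q y₁ (c 0)) / 2)) = Real.exp (-τ) * E := by
      rw [b1, hE, ← Real.exp_add, ← Real.exp_add]; congr 1; ring
    have r : Real.exp (-((bus q y₂ (c 0) + bus q y₃ (c 0)) / 2)) *
        Real.exp (-((bus q y₃ (c 0) + bus q y₄ (c 0)) / 2)) = Real.exp τ * E := by
      rw [b3, hE, ← Real.exp_add, ← Real.exp_add]; congr 1; ring
    have e3 : Real.exp (2 * τ) * Real.exp (-τ) = Real.exp τ := by
      rw [← Real.exp_add]; congr 1; ring
    rw [rho_eq_mul_exp hX q (c 0) y₁ y₂, rho_eq_mul_exp hX q (c 0) y₄ y₁,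
      rho_eq_mul_exp hX q (c 0) y₂ y₃, rho_eq_mul_exp hX q (c 0) y₃ y₄, mul_mul_mul_comm, l,
      mul_mul_mul_comm (rho q y₂ y₃), r, e2]
    linear_combination (rho q y₂ y₃ * rho q y₃ y₄ * E) * e3
  have hpt := rho_ptolemy_eq_of_base hX (c 0) o h
  have n1 := hc.one_le_rho_sq_add hX y₂
  have n2 := hc.one_le_rho_sq_add hX y₄
  have p13 := hc.rho_eq_one hX 0
  have p24 := rho_le_one hX (c 0) y₂ y₄
  have q12 := rho_pos hX (c 0) h12
  have q14 := rho_pos hX (c 0) h14.symm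
  have q23 := rho_pos hX (c 0) h23
  have q34 := rho_pos hX (c 0) h34
  rw [rho_comm _ y₃ y₂] at n1
  rw [rho_comm _ y₁ y₄] at n2
  rw [p13, one_mul] at hpt
  rw [hpt] at p24
  set x1 := rho (c 0) y₁ y₂ with hx1
  set x2 := rho (c 0) y₂ y₃ with hx2
  set x3 := rho (c 0) y₃ y₄ with hx3
  set x4 := rho (c 0) y₄ y₁ with hx4
  obtain ⟨a4, a5, a2⟩ := eq_of_parallel q12.le q23.le q34.le q14.le hpar p24 n1 n2
  have hone : rho (c 0) y₂ y₄ = 1 := by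
    rw [hpt, a4, a5]
    linarith
  obtain ⟨c', hc', hc'0⟩ := exists_line_of_rho_eq_one hX hone
  have r1 := hc.isRayTo_left
  have r3 := hc.isRayTo_right
  have r2 := hc'.isRayTo_left
  have r4 := hc'.isRayTo_right
  rw [hc'0] at r2 r4
  have upper : ∀ s t, Real.cosh (dist (c s) (c' t)) ≤
      Real.cosh s * Real.cosh t - Real.sinh s * Real.sinh t * (1 - 2 * x3 ^ 2) := by
    intro s t
    rcases le_total s 0 with hs | hs <;> rcases le_total t 0 with ht | ht
    · have := r1.cosh_dist_le hX r2 (neg_nonneg.2 hs) (neg_nonneg.2 ht)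
      rw [neg_neg, neg_neg, ← hx1, a4, Real.cosh_sub, Real.cosh_neg, Real.cosh_neg, Real.sinh_neg,
        Real.sinh_neg] at this
      linarith
    · have := r1.cosh_dist_le hX r4 (neg_nonneg.2 hs) ht
      rw [neg_neg, rho_comm, ← hx4, Real.cosh_sub, Real.cosh_neg, Real.sinh_neg,
        show x4 ^ 2 = 1 - x3 ^ 2 by linarith] at this
      linarith
    · have := r3.cosh_dist_le hX r2 hs (neg_nonneg.2 ht)
      rw [neg_neg, rho_comm, ← hx2, a5, Real.cosh_sub, Real.cosh_neg, Real.sinh_neg,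
        show x4 ^ 2 = 1 - x3 ^ 2 by linarith] at this
      linarith
    · have := r3.cosh_dist_le hX r4 hs ht
      rw [← hx3, Real.cosh_sub] at this
      linarith
  -- The constant is the cosine of the angle at the crossing point between the rays to `y₃` and
  -- `y₄`. For the lower bound, Stewart at the crossing point bounds the sum of the values at `s`
  -- and `-s` from below, while `upper` bounds the value at `-s` from above.
  refine ⟨c, c', 1 - 2 * x3 ^ 2, hc, hc', by nlinarith, by nlinarith, fun s t => ?_⟩
  refine le_antisymm (upper s t) ?_
  have h1 := hc.stewart_mid hX s (c' t)
  have h2 := upper (-s) t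
  rw [← hc'0, hc'.1, sub_zero, Real.cosh_abs, dist_comm _ (c (-s)), dist_comm _ (c s)] at h1
  rw [Real.cosh_neg, Real.sinh_neg] at h2
  linarith

end Crossing

/-! ### Extending an isometry from two crossing lines to the quadrilateral spanned by them -/

section Chords

open UpperHalfPlane

variable {X : Type*} [MetricSpace X]

lemma IsStewartSpace.dist_le_of_comparison (hX : IsStewartSpace X) {a x b z : X} {a' x' b' w : ℍ}
    (h : Between a x b) (h' : Between a' x' b') (hax : dist a x = dist a' x')
    (hxb : dist x b = dist x' b') (ha : dist z a ≤ dist w a') (hb : dist z b ≤ dist w b') :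
    dist z x ≤ dist w x' := by
  have hab : dist a b = dist a' b' := by unfold Between at h h'; linarith
  rcases eq_or_ne a b with rfl | hne
  · have h1 : dist a x + dist x a = dist a a := h
    rw [dist_self, dist_comm x a] at h1
    have h2 : dist a x = 0 := by linarith
    have e : a = x := dist_eq_zero.1 h2
    have e' : a' = x' := dist_eq_zero.1 (hax ▸ h2)
    rwa [← e, ← e']
  have s := hX.stewart _ _ _ h z
  have s' := upperHalfPlane_stewart h' w
  rw [← hab, ← hax, ← hxb] at s'
  have hpos : 0 < Real.sinh (dist a b) := Real.sinh_pos_iff.2 (dist_pos.2 hne)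
  have n1 : 0 ≤ Real.sinh (dist a x) := Real.sinh_nonneg_iff.2 dist_nonneg
  have n2 : 0 ≤ Real.sinh (dist x b) := Real.sinh_nonneg_iff.2 dist_nonneg
  have c1 : Real.cosh (dist z a) ≤ Real.cosh (dist w a') := by
    rwa [Real.cosh_le_cosh, abs_of_nonneg dist_nonneg, abs_of_nonneg dist_nonneg]
  have c2 : Real.cosh (dist z b) ≤ Real.cosh (dist w b') := by
    rwa [Real.cosh_le_cosh, abs_of_nonneg dist_nonneg, abs_of_nonneg dist_nonneg]
  have key : Real.cosh (dist z x) ≤ Real.cosh (dist w x') := by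
    refine le_of_mul_le_mul_left ?_ hpos
    rw [s']
    exact s.trans (add_le_add (mul_le_mul_of_nonneg_left c1 n2) (mul_le_mul_of_nonneg_left c2 n1))
  rwa [Real.cosh_le_cosh, abs_of_nonneg dist_nonneg, abs_of_nonneg dist_nonneg] at key

/-- The rigidity step: Stewart, solved for the far end point. A distance that is no shorter than in
the plane at an inner point and no longer at one end cannot be shorter at the other end. -/
lemma IsStewartSpace.le_dist_of_comparison (hX : IsStewartSpace X) {a x b z : X} {a' x' b' w : ℍ}
    (h : Between a x b) (h' : Between a' x' b') (hax : dist a x = dist a' x')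
    (hxb : dist x b = dist x' b') (hne : a ≠ x) (ha : dist z a ≤ dist w a')
    (hx : dist w x' ≤ dist z x) : dist w b' ≤ dist z b := by
  have hab : dist a b = dist a' b' := by unfold Between at h h'; linarith
  have s := hX.stewart _ _ _ h z
  have s' := upperHalfPlane_stewart h' w
  rw [← hab, ← hax, ← hxb] at s'
  have hpos : 0 < Real.sinh (dist a x) := Real.sinh_pos_iff.2 (dist_pos.2 hne)
  have n1 : 0 ≤ Real.sinh (dist a b) := Real.sinh_nonneg_iff.2 dist_nonneg
  have n2 : 0 ≤ Real.sinh (dist x b) := Real.sinh_nonneg_iff.2 dist_nonneg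
  have c1 : Real.cosh (dist z a) ≤ Real.cosh (dist w a') := by
    rwa [Real.cosh_le_cosh, abs_of_nonneg dist_nonneg, abs_of_nonneg dist_nonneg]
  have c2 : Real.cosh (dist w x') ≤ Real.cosh (dist z x) := by
    rwa [Real.cosh_le_cosh, abs_of_nonneg dist_nonneg, abs_of_nonneg dist_nonneg]
  have key : Real.cosh (dist w b') ≤ Real.cosh (dist z b) := by
    refine le_of_mul_le_mul_left ?_ hpos
    have := mul_le_mul_of_nonneg_left c1 n2
    have := mul_le_mul_of_nonneg_left c2 n1
    linarith
  rwa [Real.cosh_le_cosh, abs_of_nonneg dist_nonneg, abs_of_nonneg dist_nonneg] at key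

/-- The pairs of corresponding points on corresponding chords of two pairs of curves. -/
def chordPairs (c c' : ℝ → X) (g g' : ℝ → ℍ) : Set (X × ℍ) :=
  {z | ∃ a b, Between (c a) z.1 (c' b) ∧ Between (g a) z.2 (g' b) ∧
    dist (c a) z.1 = dist (g a) z.2 ∧ dist z.1 (c' b) = dist z.2 (g' b)}

/-- Two pairs of geodesic lines, in `X` and in the hyperbolic plane, with the same mutual
distances. -/
structure IsIsometricCross (c c' : ℝ → X) (g g' : ℝ → ℍ) : Prop where
  left : ∀ s t, dist (c s) (c t) = |s - t|
  right : ∀ s t, dist (c' s) (c' t) = |s - t|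
  left' : ∀ s t, dist (g s) (g t) = |s - t|
  right' : ∀ s t, dist (g' s) (g' t) = |s - t|
  cross : ∀ s t, dist (c s) (c' t) = dist (g s) (g' t)

variable {c c' : ℝ → X} {g g' : ℝ → ℍ}

lemma Between.symm {Y : Type*} [MetricSpace Y] {a x b : Y} (h : Between a x b) : Between b x a := by
  unfold Between at *
  rw [dist_comm b x, dist_comm x a, dist_comm b a, add_comm]
  exact h

lemma IsIsometricCross.swap (H : IsIsometricCross c c' g g') : IsIsometricCross c' c g' g where
  left := H.right
  right := H.left
  left' := H.right'
  right' := H.left'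
  cross s t := by rw [dist_comm, H.cross, dist_comm]

lemma chordPairs_swap {x : X} {q : ℍ} (h : (x, q) ∈ chordPairs c c' g g') :
    (x, q) ∈ chordPairs c' c g' g := by
  obtain ⟨a, b, h1, h2, h3, h4⟩ := h
  exact ⟨b, a, h1.symm, h2.symm, by simpa only [dist_comm] using h4,
    by simpa only [dist_comm] using h3⟩

lemma between_reflect {Y : Type*} [MetricSpace Y] {f : ℝ → Y}
    (hf : ∀ s t, dist (f s) (f t) = |s - t|) (a s : ℝ) : Between (f (2 * a - s)) (f a) (f s) := by
  rw [Between, hf, hf, hf, show 2 * a - s - a = a - s by ring,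
    show 2 * a - s - s = 2 * (a - s) by ring, abs_mul, abs_two]
  ring

/-- The upper bound is Stewart on the chord. For the lower bound, `c a` lies between `c s` and its
reflection `c (2 * a - s)`; there is equality at `c a` and an upper bound at the reflection. -/
lemma IsIsometricCross.dist_left (hX : IsStewartSpace X) (H : IsIsometricCross c c' g g') {x : X}
    {q : ℍ} (h : (x, q) ∈ chordPairs c c' g g') (s : ℝ) : dist x (c s) = dist q (g s) := by
  obtain ⟨a, b, h1, h2, h3, h4⟩ := h
  have hle : ∀ s, dist x (c s) ≤ dist q (g s) := by
    intro s
    rw [dist_comm x, dist_comm q]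
    exact hX.dist_le_of_comparison h1 h2 h3 h4 (by rw [H.left, H.left']) (H.cross s b).le
  rcases eq_or_ne s a with rfl | hsa
  · rw [dist_comm x, dist_comm q]
    exact h3
  refine le_antisymm (hle s) ?_
  refine hX.le_dist_of_comparison (between_reflect H.left a s) (between_reflect H.left' a s) ?_ ?_ ?_ (hle _) ?_
  · rw [H.left, H.left']
  · rw [H.left, H.left']
  · rw [← dist_pos, H.left, abs_pos]
    intro h
    exact hsa (by linarith)
  · rw [dist_comm x, dist_comm q]
    exact h3.ge

lemma IsIsometricCross.dist_right (hX : IsStewartSpace X) (H : IsIsometricCross c c' g g') {x : X}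
    {q : ℍ} (h : (x, q) ∈ chordPairs c c' g g') (s : ℝ) : dist x (c' s) = dist q (g' s) :=
  H.swap.dist_left hX (chordPairs_swap h) s

lemma IsIsometricCross.dist_le (hX : IsStewartSpace X) (H : IsIsometricCross c c' g g') {x x' : X}
    {q q' : ℍ} (h : (x, q) ∈ chordPairs c c' g g') (h' : (x', q') ∈ chordPairs c c' g g') :
    dist x x' ≤ dist q q' := by
  have hl := H.dist_left hX h
  have hr := H.dist_right hX h
  obtain ⟨a, b, h1, h2, h3, h4⟩ := h'
  exact hX.dist_le_of_comparison h1 h2 h3 h4 (hl a).le (hr b).le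

/-- Prolong the chord beyond `g' b` to a point `w` with partner `z`. Then `c' b` lies between `x`
and `z`, and equality at `c' b` with the upper bound at `z` gives the lower bound at `x`. -/
lemma IsIsometricCross.dist_eq (hX : IsStewartSpace X) (H : IsIsometricCross c c' g g')
    (hext : ∀ a b, g a ≠ g' b → ∃ z w, (z, w) ∈ chordPairs c c' g g' ∧
      Between (g a) (g' b) w ∧ g' b ≠ w)
    {x x' : X} {q q' : ℍ} (h : (x, q) ∈ chordPairs c c' g g')
    (h' : (x', q') ∈ chordPairs c c' g g') : dist x x' = dist q q' := by
  obtain ⟨a, b, h1, h2, h3, h4⟩ := id h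
  rcases eq_or_ne (g a) (g' b) with hab | hab
  · have e0 : dist (g a) q + dist q (g' b) = dist (g a) (g' b) := h2
    rw [hab, dist_self, dist_comm (g' b) q] at e0
    have e1 : dist q (g' b) = 0 := by linarith
    have e2 : dist x (c' b) = 0 := by rw [h4, e1]
    rw [dist_eq_zero.1 e1, dist_eq_zero.1 e2, dist_comm, dist_comm (g' b)]
    exact H.dist_right hX h' b
  obtain ⟨z, w, hzw, hw, hne⟩ := hext a b hab
  have t1 : dist (g a) q + dist q (g' b) = dist (g a) (g' b) := h2
  have t2 : dist (g a) (g' b) + dist (g' b) w = dist (g a) w := hw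
  have t3 := dist_triangle (g a) q w
  have t4 := dist_triangle q (g' b) w
  have hbq : Between q (g' b) w := by unfold Between; linarith
  have hzb : dist (c' b) z = dist (g' b) w := by
    rw [dist_comm, dist_comm (g' b)]; exact H.dist_right hX hzw b
  have hza : dist (c a) z = dist (g a) w := by
    rw [dist_comm, dist_comm (g a)]; exact H.dist_left hX hzw a
  have t5 := dist_triangle (c a) x z
  have t6 := dist_triangle x (c' b) z
  have hbx : Between x (c' b) z := by unfold Between at hbq ⊢; linarith
  refine le_antisymm (H.dist_le hX h h') ?_
  rw [dist_comm x, dist_comm q]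
  refine hX.le_dist_of_comparison hbx.symm hbq.symm ?_ ?_ ?_ (H.dist_le hX h' hzw) ?_
  · rw [dist_comm z, hzb, dist_comm]
  · rw [dist_comm, h4, dist_comm]
  · rw [← dist_pos, dist_comm, hzb]
    exact dist_pos.2 hne
  · exact (H.dist_right hX h' b).ge

end Chords

/-! ### The ideal quadrilateral as a convex cone in the hyperboloid model -/

section Quadrilateral

open UpperHalfPlane

variable {X : Type*} [MetricSpace X]

/-- The first coordinate with respect to the directions `(1, 0)` and `(k, √(1 - k²))`. -/
noncomputable def obliqueFst (k : ℝ) (v : ℝ × ℝ × ℝ) : ℝ := v.2.1 - k * (v.2.2 / √(1 - k ^ 2))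

/-- The second coordinate with respect to the directions `(1, 0)` and `(k, √(1 - k²))`. -/
noncomputable def obliqueSnd (k : ℝ) (v : ℝ × ℝ × ℝ) : ℝ := v.2.2 / √(1 - k ^ 2)

/-- A function on `ℝ³` that is positive in the interior of the cone over an ideal quadrilateral,
with diagonals that cross at `i` with angle `arccos k`, and nonnegative on the cone. -/
noncomputable def quadFun (k : ℝ) (v : ℝ × ℝ × ℝ) : ℝ := v.1 - |obliqueFst k v| - |obliqueSnd k v|

lemma quadFun_smul {k r : ℝ} (hr : 0 ≤ r) (v : ℝ × ℝ × ℝ) : quadFun k (r • v) = r * quadFun k v := by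
  have e1 : obliqueFst k (r • v) = r * obliqueFst k v := by
    simp only [obliqueFst, Prod.smul_snd, Prod.smul_fst, smul_eq_mul]; ring
  have e2 : obliqueSnd k (r • v) = r * obliqueSnd k v := by
    simp only [obliqueSnd, Prod.smul_snd, smul_eq_mul]; ring
  rw [quadFun, e1, e2, abs_mul, abs_mul, abs_of_nonneg hr, quadFun, Prod.smul_fst, smul_eq_mul]
  ring

lemma le_quadFun_add (k : ℝ) (v w : ℝ × ℝ × ℝ) : quadFun k v + quadFun k w ≤ quadFun k (v + w) := by
  have e1 : obliqueFst k (v + w) = obliqueFst k v + obliqueFst k w := by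
    simp only [obliqueFst, Prod.snd_add, Prod.fst_add]; ring
  have e2 : obliqueSnd k (v + w) = obliqueSnd k v + obliqueSnd k w := by
    simp only [obliqueSnd, Prod.snd_add]; ring
  rw [quadFun, quadFun, quadFun, e1, e2, Prod.fst_add]
  linarith [abs_add_le (obliqueFst k v) (obliqueFst k w),
    abs_add_le (obliqueSnd k v) (obliqueSnd k w)]

lemma le_quadFun_comb {k r s : ℝ} (hr : 0 ≤ r) (hs : 0 ≤ s) (v w : ℝ × ℝ × ℝ) :
    r * quadFun k v + s * quadFun k w ≤ quadFun k (r • v + s • w) := by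
  rw [← quadFun_smul hr, ← quadFun_smul hs]
  exact le_quadFun_add k _ _

/-- The ideal quadrilateral whose diagonals cross at `i` with angle `arccos k`. -/
def quadrilateral (k : ℝ) : Set ℍ := {q | 0 ≤ quadFun k (vec q)}

/-- `quadFun` is concave and positively homogeneous, and `vec_of_between` turns geodesic segments
into nonnegative combinations. -/
lemma quadrilateral_convex (k : ℝ) : IsConvex (quadrilateral k) := by
  intro a ha b hb x hx
  rcases eq_or_ne a b with rfl | hab
  · have h1 : dist a x + dist x a = dist a a := hx
    rw [dist_self, dist_comm x a] at h1
    rwa [← dist_eq_zero.1 (show dist a x = 0 by linarith)]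
  have h := vec_of_between hx
  have hpos : 0 < Real.sinh (dist a b) := Real.sinh_pos_iff.2 (dist_pos.2 hab)
  have n1 : 0 ≤ Real.sinh (dist a x) := Real.sinh_nonneg_iff.2 dist_nonneg
  have n2 : 0 ≤ Real.sinh (dist x b) := Real.sinh_nonneg_iff.2 dist_nonneg
  have h2 := le_quadFun_comb (k := k) n2 n1 (vec a) (vec b)
  rw [← h, quadFun_smul hpos.le] at h2
  exact nonneg_of_mul_nonneg_right ((add_nonneg (mul_nonneg n2 ha) (mul_nonneg n1 hb)).trans h2) hpos

/-- The geodesics `g` and `g'` through `i` in the directions `(1, 0)` and `(k, √(1 - k²))`. -/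
structure IsStandardCross (k : ℝ) (g g' : ℝ → ℍ) : Prop where
  left : ∀ t, vec (g t) = (Real.cosh t, Real.sinh t, 0)
  right : ∀ t, vec (g' t) = (Real.cosh t, Real.sinh t * k, Real.sinh t * √(1 - k ^ 2))

variable {k : ℝ} {g g' : ℝ → ℍ}

lemma exists_isStandardCross (h1 : -1 < k) (h2 : k < 1) :
    ∃ g g' : ℝ → ℍ, IsStandardCross k g g' ∧ (∀ s t, dist (g s) (g t) = |s - t|) ∧
      (∀ s t, dist (g' s) (g' t) = |s - t|) ∧
      ∀ s t, Real.cosh (dist (g s) (g' t)) =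
        Real.cosh s * Real.cosh t - Real.sinh s * Real.sinh t * k := by
  have hk : 0 ≤ 1 - k ^ 2 := by nlinarith
  have hsq := Real.mul_self_sqrt hk
  obtain ⟨g, hg, hgd⟩ := exists_geodesic_of_frame (v := (1, 0, 0)) (u := (0, 1, 0))
    (by simp [lorentz]) (by simp [lorentz]) (by simp [lorentz]) (by simp)
  obtain ⟨g', hg', hgd'⟩ := exists_geodesic_of_frame (v := (1, 0, 0)) (u := (0, k, √(1 - k ^ 2)))
    (by simp [lorentz]) (by simp only [lorentz]; linarith) (by simp [lorentz]) (by simp)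
  have H : IsStandardCross k g g' := ⟨fun t => by rw [hg]; simp, fun t => by rw [hg']; simp⟩
  refine ⟨g, g', H, hgd, hgd', fun s t => ?_⟩
  rw [cosh_dist_eq_lorentz, H.left, H.right]
  simp only [lorentz]
  ring

lemma quadFun_left (C S : ℝ) : quadFun k (C, S, 0) = C - |S| := by
  simp [quadFun, obliqueFst, obliqueSnd]

lemma quadFun_right (h1 : -1 < k) (h2 : k < 1) (C S : ℝ) :
    quadFun k (C, S * k, S * √(1 - k ^ 2)) = C - |S| := by
  have hk : 0 < √(1 - k ^ 2) := Real.sqrt_pos.2 (by nlinarith)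
  simp [quadFun, obliqueFst, obliqueSnd, hk.ne', mul_comm k S]

lemma abs_sinh_lt_cosh (t : ℝ) : |Real.sinh t| < Real.cosh t :=
  abs_lt_of_sq_lt_sq (by linarith [Real.cosh_sq t]) (Real.cosh_pos t).le

lemma IsStandardCross.quadFun_left_pos (H : IsStandardCross k g g') (t : ℝ) :
    0 < quadFun k (vec (g t)) := by
  rw [H.left, quadFun_left, sub_pos]
  exact abs_sinh_lt_cosh t

lemma exists_cosh_sinh {C S : ℝ} (h : |S| < C) : ∃ l a : ℝ, 0 ≤ l ∧ l * Real.cosh a = C ∧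
    l * Real.sinh a = S := by
  have hC : 0 < C := (abs_nonneg S).trans_lt h
  have hsq : 0 < C ^ 2 - S ^ 2 := by
    have := sq_lt_sq' (by linarith [(abs_lt.1 h).1]) (abs_lt.1 h).2
    linarith
  have hl := Real.sqrt_pos.2 hsq
  have hl2 := Real.sq_sqrt hsq.le
  refine ⟨√(C ^ 2 - S ^ 2), Real.arsinh (S / √(C ^ 2 - S ^ 2)), hl.le, ?_, ?_⟩
  · rw [Real.cosh_arsinh]
    have : 1 + (S / √(C ^ 2 - S ^ 2)) ^ 2 = (C / √(C ^ 2 - S ^ 2)) ^ 2 := by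
      field_simp
      linarith
    rw [this, Real.sqrt_sq (by positivity)]
    field_simp
  · rw [Real.sinh_arsinh]
    field_simp

lemma IsStandardCross.exists_between (H : IsStandardCross k g g') (h1 : -1 < k) (h2 : k < 1) {q : ℍ}
    (hq : 0 < quadFun k (vec q)) : ∃ a b, Between (g a) q (g' b) := by
  have hk : 0 < √(1 - k ^ 2) := Real.sqrt_pos.2 (by nlinarith)
  set x := obliqueFst k (vec q) with hx
  set y := obliqueSnd k (vec q) with hy
  have hq' : 0 < (vec q).1 - |x| - |y| := hq
  -- Split `vec q` along the planes of `g` and `g'`. Each part receives half of the surplus `quadFun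
  -- k (vec q)` in its first coordinate, so both are timelike.
  obtain ⟨l, a, hl, l1, l2⟩ := exists_cosh_sinh (C := |x| + ((vec q).1 - |x| - |y|) / 2) (S := x)
    (by linarith)
  obtain ⟨m, b, hm, m1, m2⟩ := exists_cosh_sinh (C := |y| + ((vec q).1 - |x| - |y|) / 2) (S := y)
    (by linarith)
  refine ⟨a, b, between_of_vec hl hm ?_⟩
  rw [H.left, H.right]
  ext
  · simp only [Prod.smul_mk, Prod.mk_add_mk, smul_eq_mul, l1, m1]; ring
  · simp only [Prod.smul_mk, Prod.mk_add_mk, smul_eq_mul, l2, ← mul_assoc, m2]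
    rw [hx, hy, obliqueFst, obliqueSnd]; ring
  · simp only [Prod.smul_mk, Prod.mk_add_mk, smul_eq_mul, ← mul_assoc, m2]
    rw [hy, obliqueSnd]; field_simp; ring

lemma lorentz_pos_of_quadFun_pos (h1 : -1 < k) (h2 : k < 1) {v : ℝ × ℝ × ℝ} (hv : 0 < quadFun k v) :
    0 < lorentz v v := by
  have hk2 : 0 < 1 - k ^ 2 := by nlinarith
  have hk : 0 < √(1 - k ^ 2) := Real.sqrt_pos.2 hk2
  have hsq := Real.mul_self_sqrt hk2.le
  have e1 : v.2.2 = obliqueSnd k v * √(1 - k ^ 2) := by rw [obliqueSnd]; field_simp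
  have e2 : v.2.1 = obliqueFst k v + k * obliqueSnd k v := by rw [obliqueFst, obliqueSnd]; ring
  rw [quadFun] at hv
  rw [lorentz, e1, e2]
  set x := obliqueFst k v
  set y := obliqueSnd k v
  have a1 : v.1 * v.1 - (x + k * y) * (x + k * y) - y * √(1 - k ^ 2) * (y * √(1 - k ^ 2)) =
      v.1 ^ 2 - (x ^ 2 + y ^ 2 + 2 * k * (x * y)) := by linear_combination (-y ^ 2) * hsq
  rw [a1]
  have a2 : k * (x * y) ≤ |x| * |y| := by
    rw [← abs_mul]
    refine (le_abs_self _).trans ?_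
    rw [abs_mul]
    exact mul_le_of_le_one_left (abs_nonneg _) (abs_le.2 ⟨h1.le, h2.le⟩)
  have a3 : (|x| + |y|) ^ 2 < v.1 ^ 2 := by
    apply pow_lt_pow_left₀ <;> first | linarith | positivity
  nlinarith [sq_abs x, sq_abs y]

/-- A chord can be extended inside the open quadrilateral. -/
lemma IsStandardCross.exists_extension (H : IsStandardCross k g g') (h1 : -1 < k) (h2 : k < 1)
    {a b : ℝ} (hab : g a ≠ g' b) :
    ∃ w, 0 < quadFun k (vec w) ∧ Between (g a) (g' b) w ∧ g' b ≠ w := by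
  have pa := abs_sinh_lt_cosh a
  have pb := abs_sinh_lt_cosh b
  have ha := Real.cosh_pos a
  -- Subtracting `ε • vec (g a)` uses up at most half of the value of `quadFun` at `g' b`. The
  -- extended point is the normalised difference.
  set ε := (Real.cosh b - |Real.sinh b|) / (2 * (Real.cosh a + |Real.sinh a|)) with hε
  have hden : 0 < Real.cosh a + |Real.sinh a| := by positivity
  have hεpos : 0 < ε := div_pos (by linarith) (by positivity)
  have hεmul : ε * (Real.cosh a + |Real.sinh a|) = (Real.cosh b - |Real.sinh b|) / 2 := by
    rw [hε]; field_simp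
  set v := vec (g' b) - ε • vec (g a) with hv
  have hq : 0 < quadFun k v := by
    have e : v = vec (g' b) + ε • (-Real.cosh a, -Real.sinh a, 0) := by
      rw [hv, H.left, sub_eq_add_neg, ← smul_neg]
      simp
    have := le_quadFun_comb (k := k) zero_le_one hεpos.le (vec (g' b)) (-Real.cosh a, -Real.sinh a, 0)
    rw [one_smul, ← e, H.right, quadFun_right h1 h2, quadFun_left, abs_neg] at this
    linarith
  have hN := lorentz_pos_of_quadFun_pos h1 h2 hq
  set N := √(lorentz v v) with hNdef
  have hNpos : 0 < N := Real.sqrt_pos.2 hN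
  have hNsq : N * N = lorentz v v := Real.mul_self_sqrt hN.le
  have hv1 : 0 < v.1 := by
    have := abs_nonneg (obliqueFst k v)
    have := abs_nonneg (obliqueSnd k v)
    unfold quadFun at hq
    linarith
  obtain ⟨w, hw⟩ := exists_vec_eq (N⁻¹ • v)
    (by rw [lorentz_smul_left, lorentz_smul_right, ← hNsq]; field_simp)
    (by rw [Prod.smul_fst, smul_eq_mul]; positivity)
  have hvec : vec (g' b) = ε • vec (g a) + N • vec w := by
    rw [hw, smul_smul, mul_inv_cancel₀ hNpos.ne', one_smul, hv]
    abel
  refine ⟨w, ?_, between_of_vec hεpos.le hNpos.le hvec, ?_⟩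
  · rw [hw, quadFun_smul (by positivity)]
    positivity
  · rintro rfl
    have e1 := congrArg (fun u => lorentz u (vec (g' b))) hvec
    have e2 := congrArg (fun u => lorentz u (vec (g a))) hvec
    simp only [lorentz_add_left, lorentz_smul_left, lorentz_vec_self] at e1 e2
    rw [lorentz_comm (vec (g' b)), ← cosh_dist_eq_lorentz] at e2
    rw [← cosh_dist_eq_lorentz] at e1
    have hD := Real.one_lt_cosh.2 (dist_pos.2 hab).ne'
    set D := Real.cosh (dist (g a) (g' b))
    have : ε * (D * D - 1) = 0 := by linear_combination e2 - D * e1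
    rcases mul_eq_zero.1 this with h | h
    · exact hεpos.ne' h
    · nlinarith

variable {c c' : ℝ → X}

lemma exists_mem_chordPairs (hX : IsStewartSpace X) (H : IsIsometricCross c c' g g')
    (HS : IsStandardCross k g g') (h1 : -1 < k) (h2 : k < 1) {q : ℍ} (hq : 0 < quadFun k (vec q)) :
    ∃ x, (x, q) ∈ chordPairs c c' g g' := by
  obtain ⟨a, b, hab⟩ := HS.exists_between h1 h2 hq
  have hab' : dist (g a) q + dist q (g' b) = dist (g a) (g' b) := hab
  obtain ⟨x, hx1, hx2⟩ := hX.geodesic.exists_between (c a) (c' b) (s := dist (g a) q) dist_nonneg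
    (by rw [H.cross]; linarith [@dist_nonneg _ _ q (g' b)])
  refine ⟨x, a, b, ?_, hab, hx1, ?_⟩
  · simp only [Between]; linarith
  · simp only [hx2, H.cross]; linarith

lemma dist_eq_of_mem_closure {M : Set (X × ℍ)}
    (hM : ∀ z ∈ M, ∀ w ∈ M, dist z.1 w.1 = dist z.2 w.2) {z w : X × ℍ} (hz : z ∈ closure M)
    (hw : w ∈ closure M) : dist z.1 w.1 = dist z.2 w.2 := by
  have hcl : IsClosed {p : (X × ℍ) × (X × ℍ) | dist p.1.1 p.2.1 = dist p.1.2 p.2.2} :=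
    isClosed_eq (by fun_prop) (by fun_prop)
  have hsub : M ×ˢ M ⊆ {p : (X × ℍ) × (X × ℍ) | dist p.1.1 p.2.1 = dist p.1.2 p.2.2} :=
    fun p hp => hM _ hp.1 _ hp.2
  have := closure_minimal hsub hcl
  rw [closure_prod_eq] at this
  exact this (Set.mk_mem_prod hz hw)

lemma exists_tendsto_interior {q p : ℍ} (hq : 0 ≤ quadFun k (vec q)) (hp : 0 < quadFun k (vec p)) :
    ∃ u : ℕ → ℍ, (∀ n, 0 < quadFun k (vec (u n))) ∧ Tendsto u atTop (𝓝 q) := by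
  rcases eq_or_ne q p with rfl | hne
  · exact ⟨fun _ => q, fun _ => hp, tendsto_const_nhds⟩
  have hd := dist_pos.2 hne
  have hle : ∀ n : ℕ, dist q p / ((n : ℝ) + 1) ≤ dist q p := fun n =>
    div_le_self hd.le (by linarith [Nat.cast_nonneg (α := ℝ) n])
  choose u hu1 hu2 using fun n : ℕ => upperHalfPlane_geodesic.exists_between q p
    (s := dist q p / ((n : ℝ) + 1)) (by positivity) (hle n)
  refine ⟨u, fun n => ?_, ?_⟩
  · have hb : Between q (u n) p := by rw [Between, hu1, hu2]; ring
    have h := vec_of_between hb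
    have s1 : 0 < Real.sinh (dist q p) := Real.sinh_pos_iff.2 hd
    have s2 : 0 < Real.sinh (dist q (u n)) := Real.sinh_pos_iff.2 (by rw [hu1]; positivity)
    have s3 : 0 ≤ Real.sinh (dist (u n) p) := Real.sinh_nonneg_iff.2 dist_nonneg
    have h2 := le_quadFun_comb (k := k) s3 s2.le (vec q) (vec p)
    rw [← h, quadFun_smul s1.le] at h2
    have := mul_pos s2 hp
    have := mul_nonneg s3 hq
    exact (mul_pos_iff_of_pos_left s1).1 (by linarith)
  · rw [tendsto_iff_dist_tendsto_zero]
    have := (tendsto_one_div_add_atTop_nhds_zero_nat (𝕜 := ℝ)).const_mul (dist q p)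
    rw [mul_zero] at this
    refine this.congr fun n => ?_
    rw [dist_comm (u n) q, hu1]
    ring

/-- The isometry between two pairs of crossing lines extends to the quadrilateral. -/
lemma exists_extension (hX : IsStewartSpace X) (H : IsIsometricCross c c' g g')
    (HS : IsStandardCross k g g') (h1 : -1 < k) (h2 : k < 1) :
    ∃ Φ : ℍ → X, (∀ q ∈ quadrilateral k, ∀ q' ∈ quadrilateral k, dist (Φ q) (Φ q') = dist q q') ∧
      (∀ t, g t ∈ quadrilateral k ∧ Φ (g t) = c t) ∧
      ∀ t, g' t ∈ quadrilateral k ∧ Φ (g' t) = c' t := by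
  have := hX.complete
  set M := chordPairs c c' g g' with hM
  have hMd : ∀ z ∈ M, ∀ w ∈ M, dist z.1 w.1 = dist z.2 w.2 := by
    intro z hz w hw
    refine H.dist_eq hX (fun a b hab => ?_) hz hw
    obtain ⟨w, hw1, hw2, hw3⟩ := HS.exists_extension h1 h2 hab
    obtain ⟨z, hz⟩ := exists_mem_chordPairs hX H HS h1 h2 hw1
    exact ⟨z, w, hz, hw2, hw3⟩
  -- Over the quadrilateral the graph of `Φ` lies in the closure of the chord pairs, where equality
  -- of distances persists. Elsewhere the value is irrelevant.
  have hex : ∀ q : ℍ, ∃ x, q ∈ quadrilateral k → (x, q) ∈ closure M := by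
    intro q
    by_cases hq : q ∈ quadrilateral k
    · obtain ⟨u, hu, hut⟩ := exists_tendsto_interior hq (HS.quadFun_left_pos 0)
      choose x hx using fun n => exists_mem_chordPairs hX H HS h1 h2 (hu n)
      have hc : CauchySeq x := by
        have := hut.cauchySeq
        rw [cauchySeq_iff_tendsto_dist_atTop_0] at this ⊢
        exact this.congr fun n => (hMd _ (hx n.1) _ (hx n.2)).symm
      obtain ⟨y, hy⟩ := cauchySeq_tendsto_of_complete hc
      exact ⟨y, fun _ => mem_closure_of_tendsto (hy.prodMk_nhds hut) (Eventually.of_forall hx)⟩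
    · exact ⟨c 0, fun h => absurd h hq⟩
  choose Φ hΦ using hex
  have hml : ∀ t, (c t, g t) ∈ M := fun t => ⟨t, 0, by simp [Between], by simp [Between], by simp,
    H.cross t 0⟩
  have hmr : ∀ t, (c' t, g' t) ∈ M := fun t => ⟨0, t, by simp [Between], by simp [Between],
    H.cross 0 t, by simp⟩
  have hql : ∀ t, g t ∈ quadrilateral k := fun t => (HS.quadFun_left_pos t).le
  have hqr : ∀ t, g' t ∈ quadrilateral k := fun t => by
    show 0 ≤ quadFun k (vec (g' t))
    rw [HS.right, quadFun_right h1 h2, sub_nonneg]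
    exact (abs_sinh_lt_cosh t).le
  refine ⟨Φ, fun q hq q' hq' => dist_eq_of_mem_closure hMd (hΦ q hq) (hΦ q' hq'), fun t => ⟨hql t, ?_⟩,
    fun t => ⟨hqr t, ?_⟩⟩
  · have := dist_eq_of_mem_closure hMd (hΦ _ (hql t)) (subset_closure (hml t))
    simpa using this
  · have := dist_eq_of_mem_closure hMd (hΦ _ (hqr t)) (subset_closure (hmr t))
    simpa using this

end Quadrilateral

/-! ### Ideal end points of geodesics of the hyperbolic plane -/

section IdealPoints

open UpperHalfPlane

/-- A geodesic stays in the plane spanned by `vec (e 0)` and `vec (e 1)`; the order of `t`, `0` and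
`1` decides which of the three is the middle point. The vectors `m` and `m'` stand for the two ideal
ends. -/
lemma exists_exp_form {e : ℝ → ℍ} (he : ∀ s t, dist (e s) (e t) = |s - t|) :
    ∃ m m' : ℝ × ℝ × ℝ, ∀ t, vec (e t) = Real.exp t • m + Real.exp (-t) • m' := by
  have hs : Real.sinh 1 ≠ 0 := (Real.sinh_pos_iff.2 one_pos).ne'
  set u := (Real.sinh 1)⁻¹ • (vec (e 1) - Real.cosh 1 • vec (e 0)) with hu
  have h1 : vec (e 1) = Real.cosh 1 • vec (e 0) + Real.sinh 1 • u := by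
    rw [hu, smul_smul, mul_inv_cancel₀ hs, one_smul]
    abel
  have key : ∀ t, vec (e t) = Real.cosh t • vec (e 0) + Real.sinh t • u := by
    intro t
    rcases lt_or_ge t 0 with ht | ht
    · have h := vec_of_between (between_of_line he ht.le zero_le_one)
      rw [he, he, he, abs_of_neg (by linarith), abs_of_neg (by linarith), abs_of_neg (by linarith),
        h1, show -(t - 1) = 1 - t by ring, show -(0 - 1) = (1 : ℝ) by ring,
        show -(t - 0) = -t by ring, Real.sinh_sub, Real.sinh_neg] at h
      rw [← smul_right_inj hs, eq_comm, ← sub_eq_zero]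
      rw [← sub_eq_zero] at h
      rw [← h]
      module
    rcases lt_or_ge 1 t with ht' | ht'
    · have h := vec_of_between (between_of_line he zero_le_one ht'.le)
      rw [he, he, he, abs_of_neg (by linarith), abs_of_neg (by linarith), abs_of_neg (by linarith),
        h1, show -(0 - t) = t by ring, show -(1 - t) = t - 1 by ring,
        show -(0 - 1) = (1 : ℝ) by ring, Real.sinh_sub] at h
      rw [← smul_right_inj hs, ← sub_eq_zero]
      rw [eq_comm, ← sub_eq_zero] at h
      rw [← h]
      module
    · have h := vec_of_between (between_of_line he ht ht')
      rw [he, he, he, abs_of_neg (by linarith), abs_of_nonpos (by linarith),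
        abs_of_nonpos (by linarith), h1, show -(t - 1) = 1 - t by ring,
        show -(0 - 1) = (1 : ℝ) by ring, show -(0 - t) = t by ring, Real.sinh_sub] at h
      rw [← smul_right_inj hs, h]
      module
  refine ⟨(1 / 2 : ℝ) • (vec (e 0) + u), (1 / 2 : ℝ) • (vec (e 0) - u), fun t => ?_⟩
  rw [key, Real.cosh_eq, Real.sinh_eq]
  module

lemma lorentz_self_of_exp_form {e : ℝ → ℍ} {m m' : ℝ × ℝ × ℝ}
    (h : ∀ t, vec (e t) = Real.exp t • m + Real.exp (-t) • m') : lorentz m m = 0 := by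
  have key : ∀ x : ℝ, 0 < x →
      x ^ 2 * lorentz m m + 2 * lorentz m m' + (x⁻¹) ^ 2 * lorentz m' m' = 1 := by
    intro x hx
    have h1 := lorentz_vec_self (e (Real.log x))
    rw [h, Real.exp_neg, Real.exp_log hx] at h1
    simp only [lorentz_add_left, lorentz_add_right, lorentz_smul_left, lorentz_smul_right,
      lorentz_comm m' m] at h1
    rw [← h1]
    field_simp
    ring
  -- Three values of `exp t` determine the three coefficients.
  have k1 := key 1 one_pos
  have k2 := key 2 two_pos
  have k3 := key 2⁻¹ (by norm_num)
  norm_num at k1 k2 k3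
  linarith

lemma exp_form_fst_nonneg {e : ℝ → ℍ} {m m' : ℝ × ℝ × ℝ}
    (h : ∀ t, vec (e t) = Real.exp t • m + Real.exp (-t) • m') : 0 ≤ m.1 := by
  have h2 : Tendsto (fun t : ℝ => Real.exp (-(2 * t))) atTop (𝓝 0) :=
    Real.tendsto_exp_neg_atTop_nhds_zero.comp (tendsto_id.const_mul_atTop (zero_lt_two' ℝ))
  have h3 := (h2.mul_const m'.1).const_add m.1
  rw [zero_mul, add_zero] at h3
  refine ge_of_tendsto' h3 fun t => ?_
  have h4 := vec_fst_pos (e t)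
  rw [h] at h4
  simp only [Prod.fst_add, Prod.smul_fst, smul_eq_mul] at h4
  have h5 := mul_pos (Real.exp_pos (-t)) h4
  have e1 : Real.exp (-t) * Real.exp t = 1 := by rw [← Real.exp_add]; simp
  have e2 : Real.exp (-t) * Real.exp (-t) = Real.exp (-(2 * t)) := by
    rw [← Real.exp_add]; congr 1; ring
  have : Real.exp (-t) * (Real.exp t * m.1 + Real.exp (-t) * m'.1) =
      m.1 + Real.exp (-(2 * t)) * m'.1 := by
    rw [← e2]; linear_combination m.1 * e1
  linarith

/-- Asymptotic geodesics have proportional null vectors as ideal end points. -/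
lemma exists_eq_smul_of_seqEquiv {e f : ℝ → ℍ} {m m' n n' : ℝ × ℝ × ℝ}
    (he : ∀ s t, dist (e s) (e t) = |s - t|) (hf : ∀ s t, dist (f s) (f t) = |s - t|)
    (hm : ∀ t, vec (e t) = Real.exp t • m + Real.exp (-t) • m')
    (hn : ∀ t, vec (f t) = Real.exp t • n + Real.exp (-t) • n') (hn0 : 0 < n.1)
    (h : SeqEquiv (fun i : ℕ => e i) fun i : ℕ => f i) : ∃ r : ℝ, 0 ≤ r ∧ m = r • n := by
  have hnat : Tendsto (fun i : ℕ => (i : ℝ)) atTop atTop := tendsto_natCast_atTop_atTop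
  have hlim : Tendsto (fun i : ℕ => Real.exp (-(2 * (i : ℝ))) * Real.cosh (dist (e i) (f i))) atTop
      (𝓝 (lorentz m n)) := by
    have a1 : Tendsto (fun i : ℕ => Real.exp (-(2 * (i : ℝ)))) atTop (𝓝 0) :=
      Real.tendsto_exp_neg_atTop_nhds_zero.comp (hnat.const_mul_atTop (zero_lt_two' ℝ))
    have a2 := ((a1.mul_const (lorentz m n' + lorentz m' n)).add
      ((a1.mul a1).mul_const (lorentz m' n'))).const_add (lorentz m n)
    rw [zero_mul, mul_zero, zero_mul, add_zero, add_zero] at a2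
    refine a2.congr fun i => ?_
    rw [cosh_dist_eq_lorentz, hm, hn]
    simp only [lorentz_add_left, lorentz_add_right, lorentz_smul_left, lorentz_smul_right]
    have e1 : Real.exp (i : ℝ) * Real.exp (-(i : ℝ)) = 1 := by rw [← Real.exp_add]; simp
    have e2 : Real.exp (-(2 * (i : ℝ))) = Real.exp (-(i : ℝ)) * Real.exp (-(i : ℝ)) := by
      rw [← Real.exp_add]; congr 1; ring
    rw [e2]
    generalize Real.exp (i : ℝ) = x at e1
    generalize Real.exp (-(i : ℝ)) = y at e1
    linear_combination (-(1 + x * y) * lorentz m n - y ^ 2 * (lorentz m n' + lorentz m' n)) * e1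
  have hzero : Tendsto (fun i : ℕ => Real.exp (-(2 * (i : ℝ))) * Real.cosh (dist (e i) (f i))) atTop
      (𝓝 0) := by
    have b1 := ((tendsto_visual_zero_iff.2 (h (f 0))).pow 2).mul_const
      (Real.exp (dist (f 0) (e 0)))
    rw [zero_pow two_ne_zero, zero_mul] at b1
    refine squeeze_zero (fun i => by positivity) (fun i => ?_) b1
    have hi : (0 : ℝ) ≤ i := Nat.cast_nonneg i
    have d1 := dist_triangle (f 0) (e 0) (e i)
    rw [he, zero_sub, abs_neg, abs_of_nonneg hi] at d1
    have d2 : dist (f 0) (f i) = i := by rw [hf, zero_sub, abs_neg, abs_of_nonneg hi]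
    have v1 : Real.cosh (dist (e i) (f i)) ≤ Real.exp (dist (e i) (f i)) := by
      rw [Real.cosh_eq]
      have := Real.exp_le_exp.2 (show -dist (e i) (f i) ≤ dist (e i) (f i) by
        linarith [@dist_nonneg _ _ (e i) (f i)])
      linarith
    have v2 : visual (f 0) (e i) (f i) ^ 2 * Real.exp (dist (f 0) (e 0)) =
        Real.exp (dist (e i) (f i) - dist (f 0) (e i) - i + dist (f 0) (e 0)) := by
      rw [visual, gromovProduct, d2, ← Real.exp_nat_mul, ← Real.exp_add]
      congr 1
      push_cast
      ring
    rw [v2]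
    refine (mul_le_mul_of_nonneg_left v1 (Real.exp_pos _).le).trans ?_
    rw [← Real.exp_add, Real.exp_le_exp]
    linarith
  have hmn : lorentz m n = 0 := tendsto_nhds_unique hlim hzero
  have hmm := lorentz_self_of_exp_form hm
  have hnn := lorentz_self_of_exp_form hn
  have hm0 := exp_form_fst_nonneg hm
  -- Orthogonal null vectors are proportional: this combination is null and has no time component.
  have h0 : n.1 • m - m.1 • n = 0 := by
    refine eq_zero_of_lorentz (v := (1, 0, 0)) (by simp [lorentz]) ?_ ?_
    · simp only [lorentz, Prod.fst_sub, Prod.snd_sub, Prod.smul_fst, Prod.smul_snd, smul_eq_mul]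
      ring
    · simp only [lorentz_sub_left, lorentz_sub_right, lorentz_smul_left, lorentz_smul_right, hmm, hnn,
        hmn, lorentz_comm n m]
      ring
  refine ⟨m.1 / n.1, by positivity, ?_⟩
  rw [div_eq_inv_mul, mul_smul, ← sub_eq_zero.1 h0, smul_smul, inv_mul_cancel₀ hn0.ne', one_smul]

/-- The boundary point `η` is a vertex of the ideal quadrilateral. -/
def IsVertex (k : ℝ) (η : Boundary ℍ) : Prop :=
  ∃ (f : ℝ → ℍ) (n n' : ℝ × ℝ × ℝ), (∀ s t, dist (f s) (f t) = |s - t|) ∧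
    (∀ t, vec (f t) = Real.exp t • n + Real.exp (-t) • n') ∧ 0 < n.1 ∧ 0 ≤ quadFun k n ∧
    Represents (fun i : ℕ => f i) η

/-- The null vectors at the ends of `e` are nonnegative multiples of those of the vertices, so every
`vec (e t)` is a nonnegative combination of vectors in the cone. -/
lemma IsVertex.mem_quadrilateral {k : ℝ} {η η' : Boundary ℍ} (h : IsVertex k η) (h' : IsVertex k η')
    {e : ℝ → ℍ} (he : IsLineJoining η η' e) (t : ℝ) : e t ∈ quadrilateral k := by
  obtain ⟨m, m', hm⟩ := exists_exp_form he.1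
  obtain ⟨f, n, n', hf, hn, hn0, hq, hr⟩ := h
  obtain ⟨f', p, p', hf', hp, hp0, hq', hr'⟩ := h'
  have hS := upperHalfPlane_isStewartSpace
  obtain ⟨r', hr'0, hmr'⟩ := exists_eq_smul_of_seqEquiv he.1 hf' hm hp hp0
    (he.2.2.seqEquiv hS hr')
  obtain ⟨r, hr0, hmr⟩ := exists_eq_smul_of_seqEquiv (e := fun t => e (-t)) (m := m') (m' := m)
    (fun s t => by rw [he.1, ← abs_neg]; congr 1; ring) hf
    (fun t => by rw [hm, neg_neg, add_comm]) hn hn0 (he.2.1.seqEquiv hS hr)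
  show 0 ≤ quadFun k (vec (e t))
  rw [hm, hmr, hmr', smul_smul, smul_smul]
  refine le_trans ?_ (le_quadFun_comb (by positivity) (by positivity) _ _)
  positivity

end IdealPoints

/-! ### Transporting hulls along an isometry -/

section Transport

open UpperHalfPlane

variable {X : Type*} [MetricSpace X]

lemma gromovProduct_map {Q : Set ℍ} {Φ : ℍ → X}
    (hΦ : ∀ q ∈ Q, ∀ q' ∈ Q, dist (Φ q) (Φ q') = dist q q') {a b c : ℍ} (ha : a ∈ Q) (hb : b ∈ Q)
    (hc : c ∈ Q) : gromovProduct (Φ a) (Φ b) (Φ c) = gromovProduct a b c := by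
  rw [gromovProduct, gromovProduct, hΦ a ha b hb, hΦ a ha c hc, hΦ b hb c hc]

lemma convergesToInfinity_map_iff {Q : Set ℍ} {Φ : ℍ → X}
    (hΦ : ∀ q ∈ Q, ∀ q' ∈ Q, dist (Φ q) (Φ q') = dist q q') {u : ℕ → ℍ} (hu : ∀ n, u n ∈ Q) :
    ConvergesToInfinity (Φ ∘ u) ↔ ConvergesToInfinity u := by
  have e : ∀ p : ℕ × ℕ, gromovProduct (Φ (u 0)) ((Φ ∘ u) p.1) ((Φ ∘ u) p.2) =
      gromovProduct (u 0) (u p.1) (u p.2) := fun p => gromovProduct_map hΦ (hu _) (hu _) (hu _)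
  constructor
  · exact fun h o => tendsto_gromovProduct_of_base ((h (Φ (u 0))).congr e) o
  · exact fun h o => tendsto_gromovProduct_of_base (u := fun p : ℕ × ℕ => (Φ ∘ u) p.1)
      (v := fun p : ℕ × ℕ => (Φ ∘ u) p.2) ((h (u 0)).congr fun p => (e p).symm) o

lemma seqEquiv_map_iff {Q : Set ℍ} {Φ : ℍ → X}
    (hΦ : ∀ q ∈ Q, ∀ q' ∈ Q, dist (Φ q) (Φ q') = dist q q') {u v : ℕ → ℍ} (hu : ∀ n, u n ∈ Q)
    (hv : ∀ n, v n ∈ Q) : SeqEquiv (Φ ∘ u) (Φ ∘ v) ↔ SeqEquiv u v := by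
  have e : ∀ i : ℕ, gromovProduct (Φ (u 0)) ((Φ ∘ u) i) ((Φ ∘ v) i) =
      gromovProduct (u 0) (u i) (v i) := fun p => gromovProduct_map hΦ (hu _) (hu _) (hv _)
  constructor
  · exact fun h o => tendsto_gromovProduct_of_base ((h (Φ (u 0))).congr e) o
  · exact fun h o => tendsto_gromovProduct_of_base (u := Φ ∘ u) (v := Φ ∘ v)
      ((h (u 0)).congr fun p => (e p).symm) o

/-- The map `Φ` takes a sequence converging to `η` to a sequence converging to `y`. -/
def Corresponds (Q : Set ℍ) (Φ : ℍ → X) (y : Boundary X) (η : Boundary ℍ) : Prop :=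
  ∃ w : ℕ → ℍ, (∀ n, w n ∈ Q) ∧ Represents w η ∧ Represents (Φ ∘ w) y

variable {Q : Set ℍ} {Φ : ℍ → X}

lemma Corresponds.represents (hX : IsStewartSpace X)
    (hΦ : ∀ q ∈ Q, ∀ q' ∈ Q, dist (Φ q) (Φ q') = dist q q') {y : Boundary X} {η : Boundary ℍ}
    (h : Corresponds Q Φ y η) {u : ℕ → ℍ} (hu : ∀ n, u n ∈ Q) (hr : Represents u η) :
    Represents (Φ ∘ u) y := by
  obtain ⟨w, hw, hwη, hwy⟩ := h
  exact hwy.of_seqEquiv hX ((convergesToInfinity_map_iff hΦ hu).2 hr.conv)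
    ((seqEquiv_map_iff hΦ hw hu).2 (hwη.seqEquiv upperHalfPlane_isStewartSpace hr))

lemma Corresponds.eq_iff (hX : IsStewartSpace X)
    (hΦ : ∀ q ∈ Q, ∀ q' ∈ Q, dist (Φ q) (Φ q') = dist q q') {y y' : Boundary X} {η η' : Boundary ℍ}
    (h : Corresponds Q Φ y η) (h' : Corresponds Q Φ y' η') : y = y' ↔ η = η' := by
  obtain ⟨w, hw, hwη, hwy⟩ := h
  obtain ⟨w', hw', hwη', hwy'⟩ := h'
  constructor
  · rintro rfl
    exact hwη.eq_of_seqEquiv upperHalfPlane_isStewartSpace hwη'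
      ((seqEquiv_map_iff hΦ hw hw').1 (hwy.seqEquiv hX hwy'))
  · rintro rfl
    exact hwy.eq_of_seqEquiv hX hwy'
      ((seqEquiv_map_iff hΦ hw hw').2 (hwη.seqEquiv upperHalfPlane_isStewartSpace hwη'))

lemma Corresponds.line_eq (hX : IsStewartSpace X)
    (hΦ : ∀ q ∈ Q, ∀ q' ∈ Q, dist (Φ q) (Φ q') = dist q q') {y y' : Boundary X} {η η' : Boundary ℍ}
    (h : Corresponds Q Φ y η) (h' : Corresponds Q Φ y' η') (hQ : line η η' ⊆ Q) :
    line y y' = Φ '' line η η' := by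
  have hS := upperHalfPlane_isStewartSpace
  rcases eq_or_ne η η' with rfl | hne
  · rw [(h.eq_iff hX hΦ h').2 rfl, line_self hX, line_self hS, Set.image_empty]
  obtain ⟨e, he⟩ := exists_line hS hne
  have hl := line_eq_range hS he
  have heQ : ∀ t, e t ∈ Q := fun t => hQ (hl ▸ Set.mem_range_self t)
  have hc : IsLineJoining y y' (Φ ∘ e) :=
    ⟨fun s t => by rw [Function.comp, Function.comp, hΦ _ (heQ s) _ (heQ t), he.1],
      h.represents hX hΦ (fun n => heQ _) he.2.1, h'.represents hX hΦ (fun n => heQ _) he.2.2⟩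
  rw [line_eq_range hX hc, hl, Set.range_comp]

lemma line_subset_hull {Y : Type*} [MetricSpace Y] {S : Set (Boundary Y)} {y y' : Boundary Y}
    (hy : y ∈ S) (hy' : y' ∈ S) : line y y' ⊆ hull S := fun _ hx _ hC => hC.2 y hy y' hy' hx

lemma hull_convex {Y : Type*} [MetricSpace Y] (S : Set (Boundary Y)) : IsConvex (hull S) :=
  fun a ha b hb x hx C hC => hC.1 a (ha C hC) b (hb C hC) x hx

/-- Both inclusions use minimality of a hull: `Φ '' hull T` is convex because geodesics of `X` are
unique, and the part of `Q` mapped into `hull S` is convex because `Φ` preserves distances on `Q`.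
-/
lemma hull_eq_image (hX : IsStewartSpace X) (hQc : IsConvex Q)
    (hΦ : ∀ q ∈ Q, ∀ q' ∈ Q, dist (Φ q) (Φ q') = dist q q') {S : Set (Boundary X)}
    {T : Set (Boundary ℍ)} (hST : ∀ y ∈ S, ∃ η ∈ T, Corresponds Q Φ y η)
    (hTS : ∀ η ∈ T, ∃ y ∈ S, Corresponds Q Φ y η)
    (hQ : ∀ η ∈ T, ∀ η' ∈ T, line η η' ⊆ Q) : hull T ⊆ Q ∧ hull S = Φ '' hull T := by
  have hTQ : hull T ⊆ Q := fun q hq => hq Q ⟨hQc, hQ⟩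
  refine ⟨hTQ, Set.Subset.antisymm ?_ ?_⟩
  · refine fun x hx => hx (Φ '' hull T) ⟨?_, ?_⟩
    · rintro _ ⟨a, ha, rfl⟩ _ ⟨b, hb, rfl⟩ z hz
      have hz' : dist (Φ a) z + dist z (Φ b) = dist (Φ a) (Φ b) := hz
      have hab := hΦ a (hTQ ha) b (hTQ hb)
      obtain ⟨q, hq1, hq2⟩ := upperHalfPlane_geodesic.exists_between a b (s := dist (Φ a) z)
        dist_nonneg (by linarith [@dist_nonneg _ _ z (Φ b)])
      have hq : q ∈ hull T := hull_convex T a ha b hb q (by rw [Between, hq1, hq2]; ring)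
      refine ⟨q, hq, (hX.eq_of_between hz ?_ ?_).symm⟩
      · rw [hΦ a (hTQ ha) q (hTQ hq), hq1]
      · rw [hΦ q (hTQ hq) b (hTQ hb), hq2]
        linarith
    · intro y hy y' hy'
      obtain ⟨η, hη, hc⟩ := hST y hy
      obtain ⟨η', hη', hc'⟩ := hST y' hy'
      rw [hc.line_eq hX hΦ hc' (hQ η hη η' hη')]
      exact Set.image_mono (line_subset_hull hη hη')
  · rintro _ ⟨q, hq, rfl⟩
    refine (hq {p | p ∈ Q ∧ Φ p ∈ hull S} ⟨?_, ?_⟩).2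
    · rintro a ⟨ha, ha'⟩ b ⟨hb, hb'⟩ p hp
      have hpQ := hQc a ha b hb p hp
      refine ⟨hpQ, hull_convex S _ ha' _ hb' _ ?_⟩
      rw [Between, hΦ a ha p hpQ, hΦ p hpQ b hb, hΦ a ha b hb]
      exact hp
    · intro η hη η' hη' p hp
      have hpQ := hQ η hη η' hη' hp
      obtain ⟨y, hy, hc⟩ := hTS η hη
      obtain ⟨y', hy', hc'⟩ := hTS η' hη'
      refine ⟨hpQ, line_subset_hull hy hy' ?_⟩
      rw [hc.line_eq hX hΦ hc' (hQ η hη η' hη')]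
      exact Set.mem_image_of_mem Φ hp

end Transport

/-! ### Characterisation of equality, and reduction of both metrics to `rho` -/

section Main

open UpperHalfPlane

variable {X : Type*} [MetricSpace X]

lemma IsStandardCross.isVertex {k : ℝ} {g g' : ℝ → ℍ} (H : IsStandardCross k g g') (h1 : -1 < k)
    (h2 : k < 1) (hg : ∀ s t, dist (g s) (g t) = |s - t|)
    (hg' : ∀ s t, dist (g' s) (g' t) = |s - t|) {η : Boundary ℍ}
    (h : Represents (fun n : ℕ => g n) η ∨ Represents (fun n : ℕ => g (-n)) η ∨
      Represents (fun n : ℕ => g' n) η ∨ Represents (fun n : ℕ => g' (-n)) η) : IsVertex k η := by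
  have neg : ∀ {f : ℝ → ℍ}, (∀ s t, dist (f s) (f t) = |s - t|) →
      ∀ s t, dist (f (-s)) (f (-t)) = |s - t| := by
    intro f hf s t
    rw [hf, ← abs_neg]
    congr 1
    ring
  rcases h with h | h | h | h
  · refine ⟨g, (1 / 2, 1 / 2, 0), (1 / 2, -1 / 2, 0), hg, fun t => ?_, by norm_num, ?_, h⟩
    · rw [H.left, Real.cosh_eq, Real.sinh_eq]
      ext <;> simp <;> ring
    · rw [quadFun_left]; norm_num
  · refine ⟨fun t => g (-t), (1 / 2, -1 / 2, 0), (1 / 2, 1 / 2, 0), neg hg, fun t => ?_, by norm_num,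
      ?_, h⟩
    · rw [H.left, Real.cosh_eq, Real.sinh_eq, neg_neg]
      ext <;> simp <;> ring
    · rw [quadFun_left]; norm_num
  · refine ⟨g', (1 / 2, 1 / 2 * k, 1 / 2 * √(1 - k ^ 2)), (1 / 2, -1 / 2 * k, -1 / 2 * √(1 - k ^ 2)),
      hg', fun t => ?_, by norm_num, ?_, h⟩
    · rw [H.right, Real.cosh_eq, Real.sinh_eq]
      ext <;> simp <;> ring
    · rw [quadFun_right h1 h2]; norm_num
  · refine ⟨fun t => g' (-t), (1 / 2, -1 / 2 * k, -1 / 2 * √(1 - k ^ 2)),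
      (1 / 2, 1 / 2 * k, 1 / 2 * √(1 - k ^ 2)), neg hg', fun t => ?_, by norm_num, ?_, h⟩
    · rw [H.right, Real.cosh_eq, Real.sinh_eq, neg_neg]
      ext <;> simp <;> ring
    · rw [quadFun_right h1 h2]; norm_num

lemma exists_represents_line {f : ℝ → ℍ} (hf : ∀ s t, dist (f s) (f t) = |s - t|) :
    ∃ η η' : Boundary ℍ, IsLineJoining η η' f := by
  have hr : IsRay f := fun s t _ _ => hf s t
  have hl : IsRay fun t => f (-t) := fun s t _ _ => by
    rw [hf, ← abs_neg]
    congr 1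
    ring
  obtain ⟨η', h'⟩ := (hr.conv tendsto_natCast_atTop_atTop).exists_represents
  obtain ⟨η, h⟩ := (hl.conv tendsto_natCast_atTop_atTop).exists_represents
  exact ⟨η, η', hf, h, h'⟩

lemma spansIdealQuadrilateral_of_eq (hX : IsStewartSpace X) {y₁ y₂ y₃ y₄ : Boundary X}
    (hy : [y₁, y₂, y₃, y₄].Nodup) {o : X}
    (h : rho o y₁ y₃ * rho o y₂ y₄ = rho o y₁ y₂ * rho o y₃ y₄ + rho o y₂ y₃ * rho o y₄ y₁) :
    SpansIdealQuadrilateral y₁ y₂ y₃ y₄ := by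
  obtain ⟨⟨h12, h13, h14⟩, ⟨h23, h24⟩, h34⟩ : (y₁ ≠ y₂ ∧ y₁ ≠ y₃ ∧ y₁ ≠ y₄) ∧ (y₂ ≠ y₃ ∧ y₂ ≠ y₄) ∧
      y₃ ≠ y₄ := by simpa using hy
  obtain ⟨c, c', k, hc, hc', k1, k2, hcc⟩ := exists_crossing hX h12 h13 h14 h23 h34 h
  obtain ⟨g, g', HS, hg, hg', hgg⟩ := exists_isStandardCross k1 k2
  have H : IsIsometricCross c c' g g' := by
    refine ⟨hc.1, hc'.1, hg, hg', fun s t => ?_⟩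
    have := abs_eq_abs_of_cosh_eq ((hcc s t).trans (hgg s t).symm)
    rwa [abs_of_nonneg dist_nonneg, abs_of_nonneg dist_nonneg] at this
  obtain ⟨Φ, hΦ, hΦg, hΦg'⟩ := exists_extension hX H HS k1 k2
  obtain ⟨η₁, η₃, hη⟩ := exists_represents_line hg
  obtain ⟨η₂, η₄, hη'⟩ := exists_represents_line hg'
  have c1 : Corresponds (quadrilateral k) Φ y₁ η₁ := ⟨_, fun n => (hΦg _).1, hη.2.1, by
    convert hc.2.1 using 1
    exact funext fun n => (hΦg _).2⟩
  have c3 : Corresponds (quadrilateral k) Φ y₃ η₃ := ⟨_, fun n => (hΦg _).1, hη.2.2, by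
    convert hc.2.2 using 1
    exact funext fun n => (hΦg _).2⟩
  have c2 : Corresponds (quadrilateral k) Φ y₂ η₂ := ⟨_, fun n => (hΦg' _).1, hη'.2.1, by
    convert hc'.2.1 using 1
    exact funext fun n => (hΦg' _).2⟩
  have c4 : Corresponds (quadrilateral k) Φ y₄ η₄ := ⟨_, fun n => (hΦg' _).1, hη'.2.2, by
    convert hc'.2.2 using 1
    exact funext fun n => (hΦg' _).2⟩
  have v1 : IsVertex k η₁ := HS.isVertex k1 k2 hg hg' (Or.inr (Or.inl hη.2.1))
  have v3 : IsVertex k η₃ := HS.isVertex k1 k2 hg hg' (Or.inl hη.2.2)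
  have v2 : IsVertex k η₂ := HS.isVertex k1 k2 hg hg' (Or.inr (Or.inr (Or.inr hη'.2.1)))
  have v4 : IsVertex k η₄ := HS.isVertex k1 k2 hg hg' (Or.inr (Or.inr (Or.inl hη'.2.2)))
  have hvert : ∀ η ∈ ({η₁, η₂, η₃, η₄} : Set (Boundary ℍ)), IsVertex k η := by
    rintro η (rfl | rfl | rfl | rfl) <;> assumption
  have hQ : ∀ η ∈ ({η₁, η₂, η₃, η₄} : Set (Boundary ℍ)), ∀ η' ∈ ({η₁, η₂, η₃, η₄} : Set (Boundary ℍ)),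
      line η η' ⊆ quadrilateral k := by
    rintro η h1 η' h2 q ⟨e, he, t, rfl⟩
    exact (hvert η h1).mem_quadrilateral (hvert η' h2) he t
  obtain ⟨hTQ, hhull⟩ := hull_eq_image hX (quadrilateral_convex k) hΦ
    (S := {y₁, y₂, y₃, y₄}) (T := {η₁, η₂, η₃, η₄})
    (by
      rintro y (rfl | rfl | rfl | rfl)
      exacts [⟨η₁, by simp, c1⟩, ⟨η₂, by simp, c2⟩, ⟨η₃, by simp, c3⟩, ⟨η₄, by simp, c4⟩])
    (by
      rintro y (rfl | rfl | rfl | rfl)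
      exacts [⟨y₁, by simp, c1⟩, ⟨y₂, by simp, c2⟩, ⟨y₃, by simp, c3⟩, ⟨y₄, by simp, c4⟩]) hQ
  have hinj : Set.InjOn Φ (quadrilateral k) := by
    intro q hq q' hq' heq
    rw [← dist_eq_zero, ← hΦ q hq q' hq', heq, dist_self]
  have l13 := c1.line_eq hX hΦ c3 (hQ _ (by simp) _ (by simp))
  have l24 := c2.line_eq hX hΦ c4 (hQ _ (by simp) _ (by simp))
  let ψ : hull {η₁, η₂, η₃, η₄} → hull {y₁, y₂, y₃, y₄} := fun q =>
    ⟨Φ q, hhull ▸ Set.mem_image_of_mem Φ q.2⟩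
  have hψ : Isometry ψ := Isometry.of_dist_eq fun q q' => hΦ _ (hTQ q.2) _ (hTQ q'.2)
  have hψs : Function.Surjective ψ := by
    rintro ⟨x, hx⟩
    obtain ⟨q, hq, rfl⟩ : x ∈ Φ '' hull {η₁, η₂, η₃, η₄} := hhull ▸ hx
    exact ⟨⟨q, hq⟩, rfl⟩
  let e : hull {η₁, η₂, η₃, η₄} ≃ᵢ hull {y₁, y₂, y₃, y₄} :=
    ⟨Equiv.ofBijective ψ ⟨hψ.injective, hψs⟩, hψ⟩
  have hmem : ∀ {η η' : Boundary ℍ}, line η η' ⊆ quadrilateral k →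
      ∀ p : hull {y₁, y₂, y₃, y₄}, (p : X) ∈ Φ '' line η η' ↔ (e.symm p : ℍ) ∈ line η η' := by
    intro η η' hsub p
    obtain ⟨q, rfl⟩ := e.surjective p
    rw [e.symm_apply_apply]
    show Φ q ∈ Φ '' line η η' ↔ (q : ℍ) ∈ line η η'
    constructor
    · rintro ⟨r, hr, heq⟩
      rwa [← hinj (hsub hr) (hTQ q.2) heq]
    · exact fun hq => Set.mem_image_of_mem Φ hq
  refine ⟨η₁, η₂, η₃, η₄, ?_, ?_, e.symm, ?_, ?_⟩
  · have := fun {y y' η η'} (h : Corresponds (quadrilateral k) Φ y η)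
      (h' : Corresponds (quadrilateral k) Φ y' η') => not_congr (h.eq_iff hX hΦ h')
    simp only [List.nodup_cons, List.mem_cons, List.not_mem_nil, or_false, not_or,
      not_false_eq_true, List.nodup_nil, and_true]
    exact ⟨⟨(this c1 c2).1 h12, (this c1 c3).1 h13, (this c1 c4).1 h14⟩,
      ⟨(this c2 c3).1 h23, (this c2 c4).1 h24⟩, (this c3 c4).1 h34⟩
  · refine ⟨g 0, ⟨g, hη, 0, rfl⟩, ⟨g', hη', 0, ?_⟩⟩
    apply vec_injective
    rw [HS.left, HS.right]
    simp
  · rw [l13]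
    exact hmem (hQ _ (by simp) _ (by simp))
  · rw [l24]
    exact hmem (hQ _ (by simp) _ (by simp))

/-- The preimage of the crossing point of the diagonals lies on both `y₁ y₃` and `y₂ y₄`.
Parametrised from there, the lines and their images satisfy `rho_ptolemy_eq_of_crossing`. -/
lemma eq_of_spansIdealQuadrilateral (hX : IsStewartSpace X) {y₁ y₂ y₃ y₄ : Boundary X} (o : X)
    (h : SpansIdealQuadrilateral y₁ y₂ y₃ y₄) :
    rho o y₁ y₃ * rho o y₂ y₄ = rho o y₁ y₂ * rho o y₃ y₄ + rho o y₂ y₃ * rho o y₄ y₁ := by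
  obtain ⟨η₁, η₂, η₃, η₄, -, ⟨q, hq, hq'⟩, e, he, he'⟩ := h
  have hqh : q ∈ hull {η₁, η₂, η₃, η₄} := line_subset_hull (by simp) (by simp) hq
  obtain ⟨p, hp⟩ := e.surjective ⟨q, hqh⟩
  have hp1 : (p : X) ∈ line y₁ y₃ := (he p).2 (by rw [hp]; exact hq)
  have hp2 : (p : X) ∈ line y₂ y₄ := (he' p).2 (by rw [hp]; exact hq')
  obtain ⟨c₀, hc₀, s, hs⟩ := hp1
  obtain ⟨c₀', hc₀', s', hs'⟩ := hp2
  have hc := hc₀.shift hX s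
  have hc' := hc₀'.shift hX s'
  have hmem : ∀ t, c₀ (t + s) ∈ hull {y₁, y₂, y₃, y₄} := fun t =>
    line_subset_hull (y := y₁) (y' := y₃) (by simp) (by simp) ⟨c₀, hc₀, Set.mem_range_self _⟩
  have hmem' : ∀ t, c₀' (t + s') ∈ hull {y₁, y₂, y₃, y₄} := fun t =>
    line_subset_hull (y := y₂) (y' := y₄) (by simp) (by simp) ⟨c₀', hc₀', Set.mem_range_self _⟩
  refine rho_ptolemy_eq_of_base hX o _ (rho_ptolemy_eq_of_crossing hX hc hc'
    (by simp only [zero_add, hs, hs']) (e := fun t => (e ⟨_, hmem t⟩ : ℍ))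
    (e' := fun t => (e ⟨_, hmem' t⟩ : ℍ)) (fun t t' => ?_) (fun t t' => ?_) fun t t' => ?_)
  · exact (e.dist_eq _ _).trans (hc.1 t t')
  · exact (e.dist_eq _ _).trans (hc'.1 t t')
  · exact e.dist_eq _ _

/-- Every point occurs once in each of the three products of the Ptolemy inequality, so the weights
`f` and the constant `r` factor out. The weight is `1` for Bourdon and `1 / rho o y ω` for
Hamenstädt. -/
lemma exists_rho_scale (hX : IsStewartSpace X) {Y : Set (Boundary X)}
    {ρ : Boundary X → Boundary X → ℝ} (hρ : IsBourdonOrHamenstadt Y ρ) :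
    ∃ (o : X) (r : ℝ) (f : Boundary X → ℝ), 0 < r ∧ (∀ y ∈ Y, 0 < f y) ∧
      ∀ y ∈ Y, ∀ y' ∈ Y, ρ y y' = r * (f y * f y' * rho o y y') := by
  rcases hρ with ⟨-, o, rfl⟩ | ⟨ω, b, hb, rfl, rfl⟩
  · exact ⟨o, 1, fun _ => 1, one_pos, fun _ _ => one_pos, fun y _ y' _ => by
      rw [bourdon_eq_rho hX]; ring⟩
  · obtain ⟨o, k, hbk⟩ := hb.exists_eq_bus hX
    refine ⟨o, Real.exp (-k), fun y => (rho o y ω)⁻¹, Real.exp_pos _, fun y hy =>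
      inv_pos.2 (rho_pos hX o hy), fun y hy y' hy' => ?_⟩
    rw [hamenstadt_eq hX hbk hy hy']
    have := rho_pos hX o hy
    have := rho_pos hX o hy'
    field_simp

end Main

end BoundaryPtolemy

theorem theorem1p1 {X : Type*} [MetricSpace X] (hX : BoundaryPtolemy.IsCATNegOne X)
    (Y : Set (BoundaryPtolemy.Boundary X))
    (ρ : BoundaryPtolemy.Boundary X → BoundaryPtolemy.Boundary X → ℝ)
    (hρ : BoundaryPtolemy.IsBourdonOrHamenstadt Y ρ)
    (y₁ y₂ y₃ y₄ : BoundaryPtolemy.Boundary X)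
    (h₁ : y₁ ∈ Y) (h₂ : y₂ ∈ Y) (h₃ : y₃ ∈ Y) (h₄ : y₄ ∈ Y) :
    ρ y₁ y₃ * ρ y₂ y₄ ≤ ρ y₁ y₂ * ρ y₃ y₄ + ρ y₂ y₃ * ρ y₄ y₁ ∧
    ([y₁, y₂, y₃, y₄].Nodup →
      (ρ y₁ y₃ * ρ y₂ y₄ = ρ y₁ y₂ * ρ y₃ y₄ + ρ y₂ y₃ * ρ y₄ y₁ ↔
        BoundaryPtolemy.SpansIdealQuadrilateral y₁ y₂ y₃ y₄)) := by
  have hS := hX.isStewartSpace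
  obtain ⟨o, r, f, hr, hf, hρo⟩ := BoundaryPtolemy.exists_rho_scale hS hρ
  have hF : 0 < r * r * (f y₁ * f y₂ * f y₃ * f y₄) := by
    have := hf _ h₁
    have := hf _ h₂
    have := hf _ h₃
    have := hf _ h₄
    positivity
  set R := fun y y' => BoundaryPtolemy.rho o y y' with hR
  have e1 : ρ y₁ y₃ * ρ y₂ y₄ = r * r * (f y₁ * f y₂ * f y₃ * f y₄) * (R y₁ y₃ * R y₂ y₄) := by
    rw [hρo _ h₁ _ h₃, hρo _ h₂ _ h₄]; ring
  have e2 : ρ y₁ y₂ * ρ y₃ y₄ + ρ y₂ y₃ * ρ y₄ y₁ =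
      r * r * (f y₁ * f y₂ * f y₃ * f y₄) * (R y₁ y₂ * R y₃ y₄ + R y₂ y₃ * R y₄ y₁) := by
    rw [hρo _ h₁ _ h₂, hρo _ h₃ _ h₄, hρo _ h₂ _ h₃, hρo _ h₄ _ h₁]; ring
  rw [e1, e2]
  refine ⟨mul_le_mul_of_nonneg_left (BoundaryPtolemy.rho_ptolemy hS o y₁ y₂ y₃ y₄) hF.le,
    fun hy => ?_⟩
  rw [mul_right_inj' hF.ne']
  exact ⟨fun h => BoundaryPtolemy.spansIdealQuadrilateral_of_eq hS hy h,
    fun h => BoundaryPtolemy.eq_of_spansIdealQuadrilateral hS o h⟩
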